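/- Let $k$ be a field, and write $\otimes=\otimes_k$. For a Hopf algebra $A$ over $k$, let ${}_A\mathsf M$ be the $k$-linear monoidal category of all left $A$-modules, with unit object $k$. The antipode of a finite-dimensional Hopf algebra is bijective. Sweedler's notation is used throughout. A monoidal functor is a functor together with its (invertible) structure maps, and two monoidal functors are equal if they are equal as functors and have the same structure maps. An equivalence of $k$-linear (braided) monoidal categories is a $k$-linear (braided) monoidal functor which is an equivalence of categories. **Schrödinger objects.** For a monoidal category $\mathcal C$, let $\mathcal Z(\mathcal C)$ be its center, whose objects are pairs $(V,c_{-,V})$ of an object $V$ and a half-braiding $c_{X,V}:X\otimes V\to V\otimes X$, and let $\Pi:\mathcal Z(\mathcal C)\to\mathcal C$ be the forgetful functor. An object $\mathbf S$ of $\mathcal Z(\mathcal C)$ is a *Schrödinger object* for $\mathcal C$ if there is a bijection $\mathrm{Hom}_{\mathcal C}(\Pi(\mathbf X),\mathbb 1)\cong\mathrm{Hom}_{\mathcal Z(\mathcal C)}(\mathbf X,\mathbf S)$, natural in $\mathbf X\in\mathcal Z(\mathcal C)$. **Yetter–Drinfel'd modules.** Let the antipode $S$ of $A$ be bijective. Let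 ${}_A\mathcal{YD}^A$ be the category of Yetter–Drinfel'd modules, i.e. of left $A$-modules and right $A$-comodules $V$ with $$\sum a_{(1)}v_{(0)}\otimes a_{(2)}v_{(1)}=\sum (a_{(2)}v)_{(0)}\otimes (a_{(2)}v)_{(1)}a_{(1)}\qquad(a\in A,\ v\in V).$$ It is a $k$-linear braided monoidal category: on $V\otimes W$ the action is $a(v\otimes w)=\sum a_{(1)}v\otimes a_{(2)}w$, the coaction is $v\otimes w\mapsto\sum v_{(0)}\otimes w_{(0)}\otimes w_{(1)}v_{(1)}$, and the braiding $V\otimes W\to W\otimes V$ is $v\otimes w\mapsto\sum w_{(0)}\otimes w_{(1)}v$. Let $R_A:{}_A\mathcal{YD}^A\to{}_A\mathsf M$ be the forgetful functor, and let $I_A:{}_A\mathsf M\to{}_A\mathcal{YD}^A$ be Radford's induction functor: $I_A(L)=L\otimes A$, with action $h(l\otimes a)=\sum h_{(2)}l\otimes h_{(3)}aS^{-1}(h_{(1)})$ and coaction $l\otimes a\mapsto\sum l\otimes a_{(1)}\otimes a_{(2)}$. Let $\Phi_A:\mathcal Z({}_A\mathsf M)\to{}_A\mathcal{YD}^A$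 be the isomorphism of categories which sends $(V,c_{-,V})$ to $V$ with the coaction $v\mapsto c_{A,V}(1\otimes v)$; its inverse equips $V$ with the half-braiding $x\otimes v\mapsto\sum v_{(0)}\otimes v_{(1)}x$. **The double.** Let $A$ be finite-dimensional. The Drinfel'd double $D(A)$ is the vector space $A^*\otimes A$ with the product $$(p\bowtie a)(p'\bowtie a')=\sum p\cdot p'\bigl(S^{-1}(a_{(3)})\,\cdot\,a_{(1)}\bigr)\bowtie a_{(2)}a',$$ where $A^*$ has the convolution product and $p'(u\cdot w)$ denotes the form $x\mapsto p'(uxw)$, and with the coproduct $p\bowtie a\mapsto\sum(p_{(2)}\bowtie a_{(1)})\otimes(p_{(1)}\bowtie a_{(2)})$, where $\sum p_{(1)}(x)p_{(2)}(y)=p(xy)$. With $\mathcal R=\sum_i(\varepsilon\bowtie e_i)\otimes(e_i^*\bowtie1)$, for a basis $(e_i)$ of $A$, the category ${}_{D(A)}\mathsf M$ is a $k$-linear braided monoidal category; its braiding is $m\otimes n\mapsto\sum_i e_i^*n\otimes e_im$. Let $R_A:{}_{D(A)}\mathsf M\to{}_A\mathsf M$ be restriction along $a\mapsto\varepsilon\bowtie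 a$. Through the isomorphism ${}_A\mathcal{YD}^A\cong{}_{D(A)}\mathsf M$, under which $(p\bowtie a)m=\sum p((am)_{(1)})(am)_{(0)}$, the functor $I_A$ above becomes a functor $I_A:{}_A\mathsf M\to{}_{D(A)}\mathsf M$, and $\Phi_A$ becomes an isomorphism of categories $\Psi_A:\mathcal Z({}_A\mathsf M)\to{}_{D(A)}\mathsf M$. The *Schrödinger module* ${}_{D(A)}A$ is the vector space $A$ with the action $$(p\bowtie a)\bullet b=\sum p\bigl(S^{-1}(x_{(1)})\bigr)x_{(2)},\qquad x=\sum a_{(1)}\,b\,S(a_{(2)}).$$ **Theorem (Yetter–Drinfel'd version).** Let $A$ and $B$ be Hopf algebras over $k$ with bijective antipode, and let $F:{}_A\mathsf M\to{}_B\mathsf M$ be an equivalence of $k$-linear monoidal categories. 1. $\mathbf S_A:=\Phi_A^{-1}(I_A(k))$ is a Schrödinger object for ${}_A\mathsf M$. 2. There is a unique equivalence $\widetilde F:{}_A\mathcal{YD}^A\to{}_B\mathcal{YD}^B$ of $k$-linear braided monoidal categories with $R_B\circ\widetilde F=F\circ R_A$ as monoidal functors. 3. The functor $\widetilde F$ satisfies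 $I_B\circ F\cong\widetilde F\circ I_A$. **Theorem (version for the double).** Let $A$ and $B$ be finite-dimensional Hopf algebras over $k$, and let $F:{}_A\mathsf M\to{}_B\mathsf M$ be an equivalence of $k$-linear monoidal categories. 1. $\mathbf S_A:=\Psi_A^{-1}({}_{D(A)}A)$ is a Schrödinger object for ${}_A\mathsf M$. 2. There is a unique equivalence $\widetilde F:{}_{D(A)}\mathsf M\to{}_{D(B)}\mathsf M$ of $k$-linear braided monoidal categories with $R_B\circ\widetilde F=F\circ R_A$ as monoidal functors. 3. The functor $\widetilde F$ satisfies $I_B\circ F\cong\widetilde F\circ I_A$. 4. The functor $\widetilde F$ preserves the Schrödinger module: $\widetilde F({}_{D(A)}A)\cong{}_{D(B)}B$. -/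

import Mathlib

open CategoryTheory MonoidalCategory
open scoped TensorProduct
universe u
noncomputable section
set_option linter.unusedSimpArgs false
set_option linter.unusedSectionVars false

namespace HopfCat

section Shortcuts

variable {k M N : Type u} [Field k] [AddCommMonoid M] [Module k M] [AddCommMonoid N] [Module k N]

instance : AddHomClass (M →ₗ[k] N) M N := inferInstance
instance : AddHomClass (M ≃ₗ[k] N) M N := inferInstance
instance : ZeroHomClass (M →ₗ[k] N) M N := inferInstance
instance : ZeroHomClass (M ≃ₗ[k] N) M N := inferInstance
instance : AddMonoidHomClass (M →ₗ[k] N) M N := inferInstance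
instance : AddMonoidHomClass (M ≃ₗ[k] N) M N := inferInstance

variable {R S : Type u} [Semiring R] [Algebra k R] [Semiring S] [Algebra k S]

instance : AddHomClass (R →ₐ[k] S) R S := inferInstance
instance : ZeroHomClass (R →ₐ[k] S) R S := inferInstance
instance : OneHomClass (R →ₐ[k] S) R S := inferInstance
instance : MulHomClass (R →ₐ[k] S) R S := inferInstance
instance : AddMonoidHomClass (R →ₐ[k] S) R S := inferInstance

end Shortcuts

section Modules

variable {k : Type u} [Field k]

/-- If `V` is a module over `A` and `W` is a module over `B`, then `V ⊗ W` is a module over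
`A ⊗ B`, by `(a ⊗ b) (v ⊗ w) = a v ⊗ b w`. -/
def outerAct {A B V W : Type u} [Ring A] [Algebra k A] [Ring B] [Algebra k B]
    [AddCommGroup V] [Module k V] [AddCommGroup W] [Module k W]
    (f : A →ₐ[k] Module.End k V) (g : B →ₐ[k] Module.End k W) :
    A ⊗[k] B →ₐ[k] Module.End k (V ⊗[k] W) :=
  Module.endTensorEndAlgHom.comp (Algebra.TensorProduct.map f g)

@[simp]
theorem outerAct_tmul {A B V W : Type u} [Ring A] [Algebra k A] [Ring B] [Algebra k B]
    [AddCommGroup V] [Module k V] [AddCommGroup W] [Module k W]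
    (f : A →ₐ[k] Module.End k V) (g : B →ₐ[k] Module.End k W) (a : A) (b : B) :
    outerAct f g (a ⊗ₜ b) = TensorProduct.map (f a) (g b) := by
  ext; simp [outerAct, Module.endTensorEndAlgHom_apply]

variable (k) in
/-- A left module over the `k`-algebra `A`: a `k`-vector space `V` together with a homomorphism of
`k`-algebras from `A` to the endomorphisms of `V`. -/
structure LMod (A : Type u) [Ring A] [Algebra k A] where
  V : ModuleCat.{u} k
  act : A →ₐ[k] Module.End k V

namespace LMod

variable {A : Type u} [Ring A] [Algebra k A]

/-- A homomorphism of left `A`-modules. -/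
@[ext]
structure Hom (M N : LMod k A) where
  hom : M.V ⟶ N.V
  comm : ∀ (a : A) (m : M.V), hom (M.act a m) = N.act a (hom m)

instance : Category (LMod k A) where
  Hom M N := Hom M N
  id M := ⟨𝟙 _, fun _ _ => rfl⟩
  comp f g := ⟨f.hom ≫ g.hom, fun a m => by
    simp [ModuleCat.hom_comp, f.comm, g.comm]⟩

@[ext]
theorem hom_ext {M N : LMod k A} {f g : M ⟶ N} (h : f.hom = g.hom) : f = g := Hom.ext h

@[simp] theorem id_hom (M : LMod k A) : Hom.hom (𝟙 M) = 𝟙 M.V := rfl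
@[simp] theorem comp_hom {M N P : LMod k A} (f : M ⟶ N) (g : N ⟶ P) :
    (f ≫ g).hom = f.hom ≫ g.hom := rfl

/-- The underlying vector space. -/
def toVect : LMod k A ⥤ ModuleCat.{u} k where
  obj M := M.V
  map f := f.hom

instance : (toVect (k := k) (A := A)).Faithful where
  map_injective h := hom_ext h

/-- A linear isomorphism which commutes with the actions. -/
def isoMk {M N : LMod k A} (e : M.V ≅ N.V)
    (h : ∀ (a : A) (m : M.V), e.hom (M.act a m) = N.act a (e.hom m)) : M ≅ N where
  hom := ⟨e.hom, h⟩
  inv := ⟨e.inv, fun a n => by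
    have := h a (e.inv n)
    apply (ModuleCat.mono_iff_injective e.hom).1 inferInstance
    simpa using this.symm⟩
  hom_inv_id := by ext1; exact e.hom_inv_id
  inv_hom_id := by ext1; exact e.inv_hom_id

section Linear

variable {M N : LMod k A}

instance : Zero (M ⟶ N) := ⟨⟨0, fun a m => by simp⟩⟩
instance : Add (M ⟶ N) := ⟨fun f g => ⟨f.hom + g.hom, fun a m => by simp [f.comm, g.comm]⟩⟩
instance : Neg (M ⟶ N) := ⟨fun f => ⟨-f.hom, fun a m => by simp [f.comm]⟩⟩
instance : SMul k (M ⟶ N) := ⟨fun c f => ⟨c • f.hom, fun a m => by simp [f.comm]⟩⟩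

@[simp] theorem zero_hom : Hom.hom (0 : M ⟶ N) = 0 := rfl
@[simp] theorem add_hom (f g : M ⟶ N) : (f + g).hom = f.hom + g.hom := rfl
@[simp] theorem neg_hom (f : M ⟶ N) : (-f).hom = -f.hom := rfl
@[simp] theorem smul_hom (c : k) (f : M ⟶ N) : (c • f).hom = c • f.hom := rfl

instance : AddCommGroup (M ⟶ N) where
  add_assoc f g h := by ext1; exact add_assoc _ _ _
  zero_add f := by ext1; exact zero_add _
  add_zero f := by ext1; exact add_zero _
  neg_add_cancel f := by ext1; exact neg_add_cancel _
  add_comm f g := by ext1; exact add_comm _ _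
  nsmul := nsmulRec
  zsmul := zsmulRec

instance : Preadditive (LMod k A) where
  add_comp _ _ _ f f' g := by ext1; exact Preadditive.add_comp ..
  comp_add _ _ _ f g g' := by ext1; exact Preadditive.comp_add ..

instance : Linear k (LMod k A) where
  homModule M N :=
    { one_smul := fun f => by ext1; exact one_smul ..
      mul_smul := fun c d f => by ext1; exact mul_smul ..
      smul_zero := fun c => by ext1; exact smul_zero _
      smul_add := fun c f g => by ext1; exact smul_add ..
      add_smul := fun c d f => by ext1; exact add_smul ..
      zero_smul := fun f => by ext1; exact zero_smul _ _ }
  smul_comp _ _ _ c f g := by ext1; exact Linear.smul_comp ..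
  comp_smul _ _ _ f c g := by ext1; exact Linear.comp_smul ..

end Linear

/-- Restriction of scalars along a homomorphism of `k`-algebras. -/
def restrict {B : Type u} [Ring B] [Algebra k B] (f : A →ₐ[k] B) : LMod k B ⥤ LMod k A where
  obj M := ⟨M.V, M.act.comp f⟩
  map g := ⟨g.hom, fun a m => g.comm (f a) m⟩

end LMod

end Modules

section Monoidal

variable {k : Type u} [Field k] {A : Type u} [Ring A] [Bialgebra k A]

open Coalgebra Bialgebra

/-- The diagonal action of a bialgebra on a tensor product, `a (v ⊗ w) = ∑ a₁ v ⊗ a₂ w`. -/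
def diagAct {V W : Type u} [AddCommGroup V] [Module k V] [AddCommGroup W] [Module k W]
    (f : A →ₐ[k] Module.End k V) (g : A →ₐ[k] Module.End k W) :
    A →ₐ[k] Module.End k (V ⊗[k] W) :=
  (outerAct f g).comp (comulAlgHom k A)

theorem diagAct_apply {V W : Type u} [AddCommGroup V] [Module k V] [AddCommGroup W] [Module k W]
    (f : A →ₐ[k] Module.End k V) (g : A →ₐ[k] Module.End k W) (a : A) :
    diagAct f g a = outerAct f g (comul a) := rfl

/-- The trivial action on `k`, through the counit. -/
def trivAct (k : Type u) [Field k] (A : Type u) [Ring A] [Bialgebra k A] :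
    A →ₐ[k] Module.End k k :=
  (Algebra.ofId k (Module.End k k)).comp (counitAlgHom k A)

theorem trivAct_apply (a : A) (c : k) : trivAct k A a c = counit (R := k) a * c := by
  simp [trivAct, Algebra.ofId_apply, Module.algebraMap_end_apply]

theorem outerAct_comm {A B V W V' W' : Type u} [Ring A] [Algebra k A] [Ring B] [Algebra k B]
    [AddCommGroup V] [Module k V] [AddCommGroup W] [Module k W]
    [AddCommGroup V'] [Module k V'] [AddCommGroup W'] [Module k W']
    {f : A →ₐ[k] Module.End k V} {g : B →ₐ[k] Module.End k W}
    {f' : A →ₐ[k] Module.End k V'} {g' : B →ₐ[k] Module.End k W'}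
    {φ : V →ₗ[k] V'} {ψ : W →ₗ[k] W'} (hφ : ∀ a v, φ (f a v) = f' a (φ v))
    (hψ : ∀ a v, ψ (g a v) = g' a (ψ v)) (x : A ⊗[k] B) (t : V ⊗[k] W) :
    TensorProduct.map φ ψ (outerAct f g x t) = outerAct f' g' x (TensorProduct.map φ ψ t) := by
  induction x with
  | zero => simp
  | add x y hx hy => simp [hx, hy]
  | tmul a b =>
    induction t with
    | zero => simp
    | add x y hx hy => rw [map_add, map_add, map_add, map_add, hx, hy]
    | tmul v w => simp [hφ, hψ]

theorem diagAct_assoc {U V W : Type u} [AddCommGroup U] [Module k U] [AddCommGroup V] [Module k V]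
    [AddCommGroup W] [Module k W]
    (e : A →ₐ[k] Module.End k U) (f : A →ₐ[k] Module.End k V) (g : A →ₐ[k] Module.End k W) (a : A)
    (t : (U ⊗[k] V) ⊗[k] W) :
    TensorProduct.assoc k U V W (diagAct (diagAct e f) g a t) =
      diagAct e (diagAct f g) a (TensorProduct.assoc k U V W t) := by
  have h1 : ∀ x : A ⊗[k] A, outerAct (diagAct e f) g x =
      outerAct (outerAct e f) g (comul.rTensor A x) := by
    intro x
    induction x with
    | zero => simp
    | add x y hx hy => rw [map_add, map_add, map_add, hx, hy]
    | tmul a b => simp [diagAct_apply]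
  have h2 : ∀ x : A ⊗[k] A, outerAct e (diagAct f g) x =
      outerAct e (outerAct f g) (comul.lTensor A x) := by
    intro x
    induction x with
    | zero => simp
    | add x y hx hy => rw [map_add, map_add, map_add, hx, hy]
    | tmul a b => simp [diagAct_apply]
  have h3 : ∀ (x : (A ⊗[k] A) ⊗[k] A) (t : (U ⊗[k] V) ⊗[k] W),
      TensorProduct.assoc k U V W (outerAct (outerAct e f) g x t) =
      outerAct e (outerAct f g) (TensorProduct.assoc k A A A x)
        (TensorProduct.assoc k U V W t) := by
    intro x t
    induction x with
    | zero => simp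
    | add x y hx hy => simp only [map_add, LinearMap.add_apply, hx, hy]
    | tmul a c =>
      induction a with
      | zero => simp
      | add x y hx hy => simp only [map_add, TensorProduct.add_tmul, LinearMap.add_apply, hx, hy]
      | tmul a b =>
        simp only [outerAct_tmul, TensorProduct.assoc_tmul]
        exact congr($((TensorProduct.map_map_comp_assoc_eq (e a) (f b) (g c)).symm) t)
  rw [diagAct_apply, diagAct_apply, h1, h2, h3, coassoc_apply]

theorem diagAct_lid {V : Type u} [AddCommGroup V] [Module k V] (f : A →ₐ[k] Module.End k V)
    (a : A) (t : k ⊗[k] V) :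
    TensorProduct.lid k V (diagAct (trivAct k A) f a t) = f a (TensorProduct.lid k V t) := by
  have h : ∀ x : A ⊗[k] A, TensorProduct.lid k V (outerAct (trivAct k A) f x t) =
      f (TensorProduct.lid k A (counit.rTensor A x)) (TensorProduct.lid k V t) := by
    intro x
    induction x with
    | zero => simp
    | add x y hx hy => simp only [map_add, LinearMap.add_apply, hx, hy]
    | tmul a b =>
      induction t with
      | zero => simp
      | add x y hx hy => simp only [map_add, hx, hy]
      | tmul c v =>
        simp [trivAct_apply, mul_smul]
        exact smul_comm _ _ _
  rw [diagAct_apply, h, rTensor_counit_comul]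
  simp

theorem diagAct_rid {V : Type u} [AddCommGroup V] [Module k V] (f : A →ₐ[k] Module.End k V)
    (a : A) (t : V ⊗[k] k) :
    TensorProduct.rid k V (diagAct f (trivAct k A) a t) = f a (TensorProduct.rid k V t) := by
  have h : ∀ x : A ⊗[k] A, TensorProduct.rid k V (outerAct f (trivAct k A) x t) =
      f (TensorProduct.rid k A (counit.lTensor A x)) (TensorProduct.rid k V t) := by
    intro x
    induction x with
    | zero => simp
    | add x y hx hy => simp only [map_add, LinearMap.add_apply, hx, hy]
    | tmul a b =>
      induction t with
      | zero => simp
      | add x y hx hy => simp only [map_add, hx, hy]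
      | tmul c v =>
        simp [trivAct_apply, mul_smul]
        exact smul_comm _ _ _
  rw [diagAct_apply, h, lTensor_counit_comul]
  simp

namespace LMod

/-- The operations of the monoidal category of left modules over a bialgebra: the tensor product
over `k` with the diagonal action, and `k` with the trivial action. -/
instance : MonoidalCategoryStruct (LMod k A) where
  tensorObj M N := ⟨M.V ⊗ N.V, diagAct M.act N.act⟩
  whiskerLeft M _ _ f := ⟨M.V ◁ f.hom, fun a m =>
    outerAct_comm (φ := LinearMap.id) (ψ := f.hom.hom) (fun _ _ => rfl) f.comm (comul a) m⟩
  whiskerRight f N := ⟨f.hom ▷ N.V, fun a m =>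
    outerAct_comm (φ := f.hom.hom) (ψ := LinearMap.id) f.comm (fun _ _ => rfl) (comul a) m⟩
  tensorHom f g := ⟨f.hom ⊗ₘ g.hom, fun a m =>
    outerAct_comm (φ := f.hom.hom) (ψ := g.hom.hom) f.comm g.comm (comul a) m⟩
  tensorUnit := ⟨𝟙_ (ModuleCat.{u} k), trivAct k A⟩
  associator M N P := isoMk (α_ M.V N.V P.V) (fun a t => diagAct_assoc _ _ _ a t)
  leftUnitor M := isoMk (λ_ M.V) (fun a t => diagAct_lid _ a t)
  rightUnitor M := isoMk (ρ_ M.V) (fun a t => diagAct_rid _ a t)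

instance : MonoidalCategory (LMod k A) where
  tensorHom_def f g := hom_ext (MonoidalCategory.tensorHom_def f.hom g.hom)
  id_tensorHom_id M N := hom_ext (MonoidalCategory.id_tensorHom_id M.V N.V)
  tensorHom_comp_tensorHom f g f' g' :=
    hom_ext (MonoidalCategory.tensorHom_comp_tensorHom f.hom g.hom f'.hom g'.hom)
  whiskerLeft_id M N := hom_ext (MonoidalCategory.whiskerLeft_id M.V N.V)
  id_whiskerRight M N := hom_ext (MonoidalCategory.id_whiskerRight M.V N.V)
  associator_naturality f g h :=
    hom_ext (MonoidalCategory.associator_naturality f.hom g.hom h.hom)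
  leftUnitor_naturality f := hom_ext (MonoidalCategory.leftUnitor_naturality f.hom)
  rightUnitor_naturality f := hom_ext (MonoidalCategory.rightUnitor_naturality f.hom)
  pentagon M N P Q := hom_ext (MonoidalCategory.pentagon M.V N.V P.V Q.V)
  triangle M N := hom_ext (MonoidalCategory.triangle M.V N.V)

instance : MonoidalPreadditive (LMod k A) where
  whiskerLeft_zero := hom_ext (MonoidalPreadditive.whiskerLeft_zero ..)
  zero_whiskerRight := hom_ext (MonoidalPreadditive.zero_whiskerRight ..)
  whiskerLeft_add f g := hom_ext (MonoidalPreadditive.whiskerLeft_add f.hom g.hom)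
  add_whiskerRight f g := hom_ext (MonoidalPreadditive.add_whiskerRight f.hom g.hom)

instance : MonoidalLinear k (LMod k A) where
  whiskerLeft_smul M _ _ c f := hom_ext (MonoidalLinear.whiskerLeft_smul M.V c f.hom)
  smul_whiskerRight c _ _ f M := hom_ext (MonoidalLinear.smul_whiskerRight c f.hom M.V)

@[simp] theorem tensor_V (M N : LMod k A) : (M ⊗ N).V = M.V ⊗ N.V := rfl
theorem tensor_act (M N : LMod k A) : (M ⊗ N).act = diagAct M.act N.act := rfl
@[simp] theorem whiskerLeft_hom (M : LMod k A) {N P : LMod k A} (f : N ⟶ P) :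
    (M ◁ f).hom = M.V ◁ f.hom := rfl
@[simp] theorem whiskerRight_hom {N P : LMod k A} (f : N ⟶ P) (M : LMod k A) :
    (f ▷ M).hom = f.hom ▷ M.V := rfl
@[simp] theorem tensorHom_hom {M N P Q : LMod k A} (f : M ⟶ N) (g : P ⟶ Q) :
    (f ⊗ₘ g).hom = f.hom ⊗ₘ g.hom := rfl
@[simp] theorem associator_hom_hom (M N P : LMod k A) :
    (α_ M N P).hom.hom = (α_ M.V N.V P.V).hom := rfl
@[simp] theorem associator_inv_hom (M N P : LMod k A) :
    (α_ M N P).inv.hom = (α_ M.V N.V P.V).inv := rfl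
@[simp] theorem leftUnitor_hom_hom (M : LMod k A) : (λ_ M).hom.hom = (λ_ M.V).hom := rfl
@[simp] theorem rightUnitor_hom_hom (M : LMod k A) : (ρ_ M).hom.hom = (ρ_ M.V).hom := rfl
@[simp] theorem leftUnitor_inv_hom (M : LMod k A) : (λ_ M).inv.hom = (λ_ M.V).inv := rfl
@[simp] theorem rightUnitor_inv_hom (M : LMod k A) : (ρ_ M).inv.hom = (ρ_ M.V).inv := rfl

end LMod

end Monoidal

end HopfCat

namespace HopfCat
open Coalgebra Bialgebra HopfAlgebra

section Coactions

variable {k : Type u} [Field k] {A : Type u} [Ring A]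

variable {V W X Y : Type u} [AddCommGroup V] [Module k V] [AddCommGroup W] [Module k W]
  [AddCommGroup X] [Module k X] [AddCommGroup Y] [Module k Y]

section

variable [Bialgebra k A]

/-- For a map `ρ : V → V ⊗ A`, written `ρ v = ∑ v₀ ⊗ v₁`, and a left `A`-module `X`, the map
`X ⊗ V → V ⊗ X`, `x ⊗ v ↦ ∑ v₀ ⊗ v₁ x`. -/
def coactBraid (g : A →ₐ[k] Module.End k X) (ρ : V →ₗ[k] V ⊗[k] A) : X ⊗[k] V →ₗ[k] V ⊗[k] X :=
  TensorProduct.lift ((LinearMap.lTensorHom V ∘ₗ g.toLinearMap.flip).compl₂ ρ)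

theorem coactBraid_tmul (g : A →ₐ[k] Module.End k X) (ρ : V →ₗ[k] V ⊗[k] A) (x : X) (v : V) :
    coactBraid g ρ (x ⊗ₜ v) = (g.toLinearMap.flip x).lTensor V (ρ v) := rfl

/-- For a map `ρ : V → V ⊗ A`, an action of `A` on `V` and `v ∈ V`, the map
`A ⊗ A → V ⊗ A`, `a ⊗ b ↦ ∑ (b v)₀ ⊗ (b v)₁ a`. -/
def coactAfter (f : A →ₐ[k] Module.End k V) (ρ : V →ₗ[k] V ⊗[k] A) (v : V) :
    A ⊗[k] A →ₗ[k] V ⊗[k] A :=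
  TensorProduct.lift
    ((LinearMap.lTensorHom V ∘ₗ (LinearMap.mul k A).flip).compl₂ (ρ ∘ₗ f.toLinearMap.flip v))

theorem coactAfter_tmul (f : A →ₐ[k] Module.End k V) (ρ : V →ₗ[k] V ⊗[k] A) (v : V) (a b : A) :
    coactAfter f ρ v (a ⊗ₜ b) = (LinearMap.mulRight k a).lTensor V (ρ (f b v)) := rfl

theorem coactBraid_outerAct (f : A →ₐ[k] Module.End k V) (g : A →ₐ[k] Module.End k X)
    (ρ : V →ₗ[k] V ⊗[k] A) (t : A ⊗[k] A) (x : X) (v : V) :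
    coactBraid g ρ (outerAct g f t (x ⊗ₜ v)) =
      (g.toLinearMap.flip x).lTensor V (coactAfter f ρ v t) := by
  induction t with
  | zero => simp
  | add a b ha hb => simp only [map_add, LinearMap.add_apply, ha, hb]
  | tmul a b =>
    rw [outerAct_tmul, TensorProduct.map_tmul, coactBraid_tmul, coactAfter_tmul,
      ← LinearMap.lTensor_comp_apply]
    congr 2
    ext c
    simp

theorem flip_act (g : A →ₐ[k] Module.End k X) (a b : A) (x : X) :
    (g.toLinearMap.flip x) (a * b) = g a (g.toLinearMap.flip x b) := by simp

theorem coactBraid_linear {f : A →ₐ[k] Module.End k V} {ρ : V →ₗ[k] V ⊗[k] A}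
    (h : ∀ (a : A) (v : V), outerAct f (Algebra.lmul k A) (comul a) (ρ v) =
      coactAfter f ρ v (comul a)) (g : A →ₐ[k] Module.End k X) (a : A) (t : X ⊗[k] V) :
    coactBraid g ρ (diagAct g f a t) = diagAct f g a (coactBraid g ρ t) := by
  induction t with
  | zero => simp
  | add x y hx hy => simp only [map_add, hx, hy]
  | tmul x v =>
    rw [diagAct_apply, coactBraid_outerAct, ← h, coactBraid_tmul, diagAct_apply]
    exact outerAct_comm (φ := LinearMap.id) (fun _ _ => rfl) (fun a b => flip_act g a b x) _ _

theorem coactBraid_one (ρ : V →ₗ[k] V ⊗[k] A) (v : V) :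
    coactBraid (Algebra.lmul k A) ρ (1 ⊗ₜ v) = ρ v := by
  rw [coactBraid_tmul]
  have : (Algebra.lmul k A).toLinearMap.flip 1 = LinearMap.id := by ext; simp
  rw [this, LinearMap.lTensor_id, LinearMap.id_apply]

theorem yd_of_linear {f : A →ₐ[k] Module.End k V} {ρ : V →ₗ[k] V ⊗[k] A}
    (h : ∀ (a : A) (t : A ⊗[k] V), coactBraid (Algebra.lmul k A) ρ
      (diagAct (Algebra.lmul k A) f a t) =
        diagAct f (Algebra.lmul k A) a (coactBraid (Algebra.lmul k A) ρ t)) (a : A) (v : V) :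
    outerAct f (Algebra.lmul k A) (comul a) (ρ v) = coactAfter f ρ v (comul a) := by
  have := h a (1 ⊗ₜ v)
  rw [coactBraid_one, diagAct_apply, coactBraid_outerAct, diagAct_apply] at this
  rw [← this]
  have : (Algebra.lmul k A).toLinearMap.flip 1 = LinearMap.id := by ext; simp
  rw [this, LinearMap.lTensor_id, LinearMap.id_apply]

theorem coactBraid_natural {g : A →ₐ[k] Module.End k X} {g' : A →ₐ[k] Module.End k Y}
    (ρ : V →ₗ[k] V ⊗[k] A) (φ : X →ₗ[k] Y) (hφ : ∀ a x, φ (g a x) = g' a (φ x)) (t : X ⊗[k] V) :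
    coactBraid g' ρ (φ.rTensor V t) = φ.lTensor V (coactBraid g ρ t) := by
  induction t with
  | zero => simp
  | add x y hx hy => simp only [map_add, hx, hy]
  | tmul x v =>
    rw [LinearMap.rTensor_tmul, coactBraid_tmul, coactBraid_tmul, ← LinearMap.lTensor_comp_apply]
    congr 2
    ext a
    simp [hφ]

theorem coactBraid_natural' {ρ : V →ₗ[k] V ⊗[k] A} {ρ' : W →ₗ[k] W ⊗[k] A}
    (g : A →ₐ[k] Module.End k X) (φ : V →ₗ[k] W) (hφ : ∀ v, φ.rTensor A (ρ v) = ρ' (φ v))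
    (t : X ⊗[k] V) :
    coactBraid g ρ' (φ.lTensor X t) = φ.rTensor X (coactBraid g ρ t) := by
  induction t with
  | zero => simp
  | add x y hx hy => simp only [map_add, hx, hy]
  | tmul x v =>
    rw [LinearMap.lTensor_tmul, coactBraid_tmul, coactBraid_tmul, ← hφ]
    exact congr($((LinearMap.lTensor_comp_rTensor _ φ _).trans
      (LinearMap.rTensor_comp_lTensor _ φ _).symm) (ρ v))

theorem flip_diagAct (g : A →ₐ[k] Module.End k X) (g' : A →ₐ[k] Module.End k Y) (x : X) (y : Y) :
    (diagAct g g').toLinearMap.flip (x ⊗ₜ y) =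
      TensorProduct.map (g.toLinearMap.flip x) (g'.toLinearMap.flip y) ∘ₗ comul := by
  ext a
  have : ∀ t : A ⊗[k] A, outerAct g g' t (x ⊗ₜ y) =
      TensorProduct.map (g.toLinearMap.flip x) (g'.toLinearMap.flip y) t := by
    intro t
    induction t with
    | zero => simp
    | add a b ha hb => simp only [map_add, LinearMap.add_apply, ha, hb]
    | tmul a b => simp
  exact this (comul a)

theorem coactBraid_tensor {ρ : V →ₗ[k] V ⊗[k] A}
    (h : ∀ v, TensorProduct.assoc k V A A (ρ.rTensor A (ρ v)) = comul.lTensor V (ρ v))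
    (g : A →ₐ[k] Module.End k X) (g' : A →ₐ[k] Module.End k Y) (t : (X ⊗[k] Y) ⊗[k] V) :
    coactBraid (diagAct g g') ρ t = TensorProduct.assoc k V X Y ((coactBraid g ρ).rTensor Y
      ((TensorProduct.assoc k X V Y).symm ((coactBraid g' ρ).lTensor X
        (TensorProduct.assoc k X Y V t)))) := by
  induction t with
  | zero => simp
  | add x y hx hy => simp only [map_add, hx, hy]
  | tmul t v =>
    induction t with
    | zero => simp
    | add x y hx hy => simp only [map_add, TensorProduct.add_tmul, hx, hy]
    | tmul x y =>
      rw [coactBraid_tmul, flip_diagAct, LinearMap.lTensor_comp, LinearMap.comp_apply, ← h,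
        TensorProduct.assoc_tmul, LinearMap.lTensor_tmul, coactBraid_tmul]
      generalize ρ v = s
      induction s with
      | zero => simp
      | add s t hs ht => simp only [map_add, TensorProduct.tmul_add, hs, ht]
      | tmul v a =>
        rw [LinearMap.rTensor_tmul, LinearMap.lTensor_tmul, TensorProduct.assoc_symm_tmul,
          LinearMap.rTensor_tmul, coactBraid_tmul]
        generalize ρ v = s
        induction s with
        | zero => simp
        | add s t hs ht => simp only [map_add, TensorProduct.add_tmul, hs, ht]
        | tmul v b => simp

/-- The codiagonal coaction on a tensor product, `v ⊗ w ↦ ∑ v₀ ⊗ w₀ ⊗ w₁ v₁`. -/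
def tensorCoact (ρ : V →ₗ[k] V ⊗[k] A) (σ : W →ₗ[k] W ⊗[k] A) :
    V ⊗[k] W →ₗ[k] (V ⊗[k] W) ⊗[k] A :=
  TensorProduct.map LinearMap.id (LinearMap.mul' k A ∘ₗ (TensorProduct.comm k A A).toLinearMap) ∘ₗ
    (TensorProduct.tensorTensorTensorComm k V A W A).toLinearMap ∘ₗ TensorProduct.map ρ σ

theorem coactBraid_tensorCoact (ρ : V →ₗ[k] V ⊗[k] A) (σ : W →ₗ[k] W ⊗[k] A)
    (g : A →ₐ[k] Module.End k X) (t : (X ⊗[k] V) ⊗[k] W) :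
    coactBraid g (tensorCoact ρ σ) (TensorProduct.assoc k X V W t) =
      (TensorProduct.assoc k V W X).symm ((coactBraid g σ).lTensor V
        (TensorProduct.assoc k V X W ((coactBraid g ρ).rTensor W t))) := by
  induction t with
  | zero => simp
  | add x y hx hy => simp only [map_add, hx, hy]
  | tmul t w =>
    induction t with
    | zero => simp
    | add x y hx hy => simp only [map_add, TensorProduct.add_tmul, hx, hy]
    | tmul x v =>
      rw [TensorProduct.assoc_tmul, coactBraid_tmul, LinearMap.rTensor_tmul, coactBraid_tmul]
      simp only [tensorCoact, LinearMap.comp_apply, TensorProduct.map_tmul]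
      generalize ρ v = s
      induction s with
      | zero => simp
      | add s t hs ht => simp only [map_add, TensorProduct.add_tmul, hs, ht]
      | tmul v a =>
        rw [LinearMap.lTensor_tmul, TensorProduct.assoc_tmul, LinearMap.lTensor_tmul,
          coactBraid_tmul]
        generalize σ w = s
        induction s with
        | zero => simp
        | add s t hs ht => simp only [map_add, TensorProduct.tmul_add, hs, ht]
        | tmul w b => simp

theorem tensorCoact_linear {f : A →ₐ[k] Module.End k V} {ρ : V →ₗ[k] V ⊗[k] A}
    {g : A →ₐ[k] Module.End k W} {σ : W →ₗ[k] W ⊗[k] A}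
    (h : ∀ (a : A) (v : V), outerAct f (Algebra.lmul k A) (comul a) (ρ v) =
      coactAfter f ρ v (comul a))
    (h' : ∀ (a : A) (v : W), outerAct g (Algebra.lmul k A) (comul a) (σ v) =
      coactAfter g σ v (comul a)) (a : A) (t : V ⊗[k] W) :
    outerAct (diagAct f g) (Algebra.lmul k A) (comul a) (tensorCoact ρ σ t) =
      coactAfter (diagAct f g) (tensorCoact ρ σ) t (comul a) := by
  apply yd_of_linear
  intro a t
  obtain ⟨t, rfl⟩ := (TensorProduct.assoc k A V W).surjective t
  rw [← diagAct_assoc, coactBraid_tensorCoact, coactBraid_tensorCoact]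
  have h1 : ∀ t, (coactBraid (Algebra.lmul k A) ρ).rTensor W
      (diagAct (diagAct (Algebra.lmul k A) f) g a t) =
      diagAct (diagAct f (Algebra.lmul k A)) g a ((coactBraid (Algebra.lmul k A) ρ).rTensor W t) :=
    fun t => outerAct_comm (ψ := LinearMap.id) (coactBraid_linear h _) (fun _ _ => rfl) _ t
  have h2 : ∀ t, (coactBraid (Algebra.lmul k A) σ).lTensor V
      (diagAct f (diagAct (Algebra.lmul k A) g) a t) =
      diagAct f (diagAct g (Algebra.lmul k A)) a ((coactBraid (Algebra.lmul k A) σ).lTensor V t) :=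
    fun t => outerAct_comm (φ := LinearMap.id) (fun _ _ => rfl) (coactBraid_linear h' _) _ t
  rw [h1, diagAct_assoc, h2, LinearEquiv.symm_apply_eq, diagAct_assoc, LinearEquiv.apply_symm_apply]

theorem tensorCoact_coassoc {ρ : V →ₗ[k] V ⊗[k] A} {σ : W →ₗ[k] W ⊗[k] A}
    (h : ∀ v, TensorProduct.assoc k V A A (ρ.rTensor A (ρ v)) = comul.lTensor V (ρ v))
    (h' : ∀ v, TensorProduct.assoc k W A A (σ.rTensor A (σ v)) = comul.lTensor W (σ v))
    (t : V ⊗[k] W) :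
    TensorProduct.assoc k (V ⊗[k] W) A A ((tensorCoact ρ σ).rTensor A (tensorCoact ρ σ t)) =
      comul.lTensor (V ⊗[k] W) (tensorCoact ρ σ t) := by
  let Ψ := TensorProduct.map (LinearMap.id (R := k) (M := V ⊗[k] W))
    (LinearMap.mul' k A ∘ₗ (TensorProduct.comm k A A).toLinearMap) ∘ₗ
    (TensorProduct.tensorTensorTensorComm k V A W A).toLinearMap
  let Θ := TensorProduct.map (LinearMap.id (R := k) (M := V ⊗[k] W))
    (LinearMap.mul' k (A ⊗[k] A) ∘ₗ (TensorProduct.comm k (A ⊗[k] A) (A ⊗[k] A)).toLinearMap) ∘ₗ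
    (TensorProduct.tensorTensorTensorComm k V (A ⊗[k] A) W (A ⊗[k] A)).toLinearMap
  induction t with
  | zero => simp
  | add x y hx hy => simp only [map_add, hx, hy]
  | tmul v w =>
    have e1 : ∀ (s : V ⊗[k] A) (t : W ⊗[k] A), comul.lTensor (V ⊗[k] W) (Ψ (s ⊗ₜ t)) =
        Θ (comul.lTensor V s ⊗ₜ comul.lTensor W t) := by
      intro s t
      induction s with
      | zero => simp
      | add x y hx hy => simp only [map_add, TensorProduct.add_tmul, hx, hy]
      | tmul v a =>
        induction t with
        | zero => simp
        | add x y hx hy => simp only [map_add, TensorProduct.tmul_add, hx, hy]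
        | tmul w b => simp [Ψ, Θ]
    have e3 : ∀ (s : V ⊗[k] A) (t : W ⊗[k] A) (a b : A),
        TensorProduct.assoc k (V ⊗[k] W) A A (Ψ (s ⊗ₜ t) ⊗ₜ (b * a)) =
        Θ (TensorProduct.assoc k V A A (s ⊗ₜ a) ⊗ₜ TensorProduct.assoc k W A A (t ⊗ₜ b)) := by
      intro s t a b
      induction s with
      | zero => simp
      | add x y hx hy => simp only [map_add, TensorProduct.add_tmul, hx, hy]
      | tmul v a =>
        induction t with
        | zero => simp
        | add x y hx hy => simp only [map_add, TensorProduct.tmul_add, TensorProduct.add_tmul, hx, hy]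
        | tmul w b => simp [Ψ, Θ]
    have e2 : ∀ (s : V ⊗[k] A) (t : W ⊗[k] A),
        TensorProduct.assoc k (V ⊗[k] W) A A ((tensorCoact ρ σ).rTensor A (Ψ (s ⊗ₜ t))) =
        Θ (TensorProduct.assoc k V A A (ρ.rTensor A s) ⊗ₜ
          TensorProduct.assoc k W A A (σ.rTensor A t)) := by
      intro s t
      induction s with
      | zero => simp
      | add x y hx hy => simp only [map_add, TensorProduct.add_tmul, hx, hy]
      | tmul v a =>
        induction t with
        | zero => simp
        | add x y hx hy => simp only [map_add, TensorProduct.tmul_add, hx, hy]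
        | tmul w b =>
          rw [LinearMap.rTensor_tmul, LinearMap.rTensor_tmul, ← e3]
          simp [Ψ, tensorCoact]
    change TensorProduct.assoc k (V ⊗[k] W) A A
      ((tensorCoact ρ σ).rTensor A (Ψ (ρ v ⊗ₜ σ w))) = comul.lTensor _ (Ψ (ρ v ⊗ₜ σ w))
    rw [e2, h, h', e1]

theorem tensorCoact_counit {ρ : V →ₗ[k] V ⊗[k] A} {σ : W →ₗ[k] W ⊗[k] A}
    (h : ∀ v, counit.lTensor V (ρ v) = v ⊗ₜ[k] (1 : k))
    (h' : ∀ v, counit.lTensor W (σ v) = v ⊗ₜ[k] (1 : k)) (t : V ⊗[k] W) :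
    counit.lTensor (V ⊗[k] W) (tensorCoact ρ σ t) = t ⊗ₜ[k] (1 : k) := by
  let Θ := TensorProduct.map (LinearMap.id (R := k) (M := V ⊗[k] W))
    (LinearMap.mul' k k ∘ₗ (TensorProduct.comm k k k).toLinearMap) ∘ₗ
    (TensorProduct.tensorTensorTensorComm k V k W k).toLinearMap
  induction t with
  | zero => simp
  | add x y hx hy => simp only [map_add, TensorProduct.add_tmul, hx, hy]
  | tmul v w =>
    have : ∀ (s : V ⊗[k] A) (t : W ⊗[k] A), counit.lTensor (V ⊗[k] W)
        (TensorProduct.map (LinearMap.id (R := k) (M := V ⊗[k] W))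
          (LinearMap.mul' k A ∘ₗ (TensorProduct.comm k A A).toLinearMap)
          (TensorProduct.tensorTensorTensorComm k V A W A (s ⊗ₜ t))) =
        Θ (counit.lTensor V s ⊗ₜ counit.lTensor W t) := by
      intro s t
      induction s with
      | zero => simp
      | add x y hx hy => simp only [map_add, TensorProduct.add_tmul, hx, hy]
      | tmul v a =>
        induction t with
        | zero => simp
        | add x y hx hy => simp only [map_add, TensorProduct.tmul_add, hx, hy]
        | tmul w b => simp [Θ]
    exact (this (ρ v) (σ w)).trans (by rw [h, h']; simp [Θ])

theorem tensorCoact_eq (ρ : V →ₗ[k] V ⊗[k] A) (σ : W →ₗ[k] W ⊗[k] A) (t : V ⊗[k] W) :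
    tensorCoact ρ σ t = (TensorProduct.assoc k V W A).symm
      ((coactBraid (Algebra.lmul k A) σ).lTensor V
        (TensorProduct.assoc k V A W (ρ.rTensor W t))) := by
  have h1 := coactBraid_one (tensorCoact ρ σ) t
  have h2 : ∀ t : V ⊗[k] W, (coactBraid (Algebra.lmul k A) ρ).rTensor W
      ((TensorProduct.assoc k A V W).symm (1 ⊗ₜ t)) = ρ.rTensor W t := by
    intro t
    induction t with
    | zero => simp
    | add x y hx hy => simp only [map_add, TensorProduct.tmul_add, hx, hy]
    | tmul v w => simp [coactBraid_one]
  rw [← h1, ← h2, ← coactBraid_tensorCoact, LinearEquiv.apply_symm_apply]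

/-- The braiding of two Yetter-Drinfel'd modules is a map of comodules. -/
theorem coactBraid_colinear {f : A →ₐ[k] Module.End k V} {ρ : V →ₗ[k] V ⊗[k] A}
    {σ : W →ₗ[k] W ⊗[k] A}
    (h : ∀ (a : A) (v : V), outerAct f (Algebra.lmul k A) (comul a) (ρ v) =
      coactAfter f ρ v (comul a))
    (h' : ∀ v, TensorProduct.assoc k W A A (σ.rTensor A (σ v)) = comul.lTensor W (σ v))
    (t : V ⊗[k] W) :
    (coactBraid f σ).rTensor A (tensorCoact ρ σ t) = tensorCoact σ ρ (coactBraid f σ t) := by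
  have h1 : ∀ t : V ⊗[k] W, ρ.rTensor W t = (coactBraid (Algebra.lmul k A) ρ).rTensor W
      ((TensorProduct.assoc k A V W).symm (1 ⊗ₜ t)) := by
    intro t
    induction t with
    | zero => simp
    | add x y hx hy => simp only [map_add, TensorProduct.tmul_add, hx, hy]
    | tmul v w => simp [coactBraid_one]
  have h2 : ∀ t : W ⊗[k] V, σ.rTensor V t = (coactBraid (Algebra.lmul k A) σ).rTensor V
      ((TensorProduct.assoc k A W V).symm (1 ⊗ₜ t)) := by
    intro t
    induction t with
    | zero => simp
    | add x y hx hy => simp only [map_add, TensorProduct.tmul_add, hx, hy]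
    | tmul v w => simp [coactBraid_one]
  rw [tensorCoact_eq, tensorCoact_eq]
  apply (TensorProduct.assoc k W V A).injective
  rw [← coactBraid_tensor h', h1, coactBraid_natural σ _ (coactBraid_linear h _),
    coactBraid_tensor h', LinearEquiv.apply_symm_apply, LinearEquiv.apply_symm_apply,
    LinearMap.lTensor_tmul, h2]

end

end Coactions
end HopfCat

namespace HopfCat
open Coalgebra Bialgebra HopfAlgebra

section Inverse

variable {k : Type u} [Field k] {A : Type u} [Ring A] [HopfAlgebra k A]

variable {V X : Type u} [AddCommGroup V] [Module k V] [AddCommGroup X] [Module k X]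

/-- The inverse of `coactBraid`, `v ⊗ x ↦ ∑ S(v₁) x ⊗ v₀`. -/
def coactBraidInv (g : A →ₐ[k] Module.End k X) (ρ : V →ₗ[k] V ⊗[k] A) : V ⊗[k] X →ₗ[k] X ⊗[k] V :=
  TensorProduct.lift (((LinearMap.lTensorHom V ∘ₗ LinearMap.lcomp k X (antipode k (A := A)) ∘ₗ
    g.toLinearMap.flip).compl₂ ρ).compr₂ (TensorProduct.comm k V X).toLinearMap).flip

theorem coactBraidInv_tmul (g : A →ₐ[k] Module.End k X) (ρ : V →ₗ[k] V ⊗[k] A) (v : V) (x : X) :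
    coactBraidInv g ρ (v ⊗ₜ x) = TensorProduct.comm k V X
      ((g.toLinearMap.flip x ∘ₗ antipode k).lTensor V (ρ v)) := rfl

theorem coactBraid_inv {ρ : V →ₗ[k] V ⊗[k] A}
    (h : ∀ v, TensorProduct.assoc k V A A (ρ.rTensor A (ρ v)) = comul.lTensor V (ρ v))
    (h' : ∀ v, counit.lTensor V (ρ v) = v ⊗ₜ[k] (1 : k))
    (g : A →ₐ[k] Module.End k X) (t : V ⊗[k] X) :
    coactBraid g ρ (coactBraidInv g ρ t) = t := by
  induction t with
  | zero => simp
  | add x y hx hy => simp only [map_add, hx, hy]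
  | tmul v x =>
    have key : ∀ s : V ⊗[k] A, coactBraid g ρ (TensorProduct.comm k V X
        ((g.toLinearMap.flip x ∘ₗ antipode k).lTensor V s)) =
        (g.toLinearMap.flip x ∘ₗ LinearMap.mul' k A ∘ₗ (antipode k).lTensor A).lTensor V
          (TensorProduct.assoc k V A A (ρ.rTensor A s)) := by
      intro s
      induction s with
      | zero => simp
      | add x y hx hy => simp only [map_add, hx, hy]
      | tmul v a =>
        rw [LinearMap.lTensor_tmul, TensorProduct.comm_tmul, coactBraid_tmul,
          LinearMap.rTensor_tmul]
        generalize ρ v = s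
        induction s with
        | zero => simp
        | add x y hx hy => simp only [map_add, TensorProduct.add_tmul, hx, hy]
        | tmul v b => simp
    rw [coactBraidInv_tmul, key, h, ← LinearMap.lTensor_comp_apply, LinearMap.comp_assoc,
      LinearMap.comp_assoc, mul_antipode_lTensor_comul, ← LinearMap.comp_assoc,
      LinearMap.lTensor_comp_apply, h']
    simp

theorem coactBraidInv_coactBraid {ρ : V →ₗ[k] V ⊗[k] A}
    (h : ∀ v, TensorProduct.assoc k V A A (ρ.rTensor A (ρ v)) = comul.lTensor V (ρ v))
    (h' : ∀ v, counit.lTensor V (ρ v) = v ⊗ₜ[k] (1 : k))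
    (g : A →ₐ[k] Module.End k X) (t : X ⊗[k] V) :
    coactBraidInv g ρ (coactBraid g ρ t) = t := by
  induction t with
  | zero => simp
  | add x y hx hy => simp only [map_add, hx, hy]
  | tmul x v =>
    have key : ∀ s : V ⊗[k] A, coactBraidInv g ρ ((g.toLinearMap.flip x).lTensor V s) =
        TensorProduct.comm k V X
        ((g.toLinearMap.flip x ∘ₗ LinearMap.mul' k A ∘ₗ (antipode k).rTensor A).lTensor V
          (TensorProduct.assoc k V A A (ρ.rTensor A s))) := by
      intro s
      induction s with
      | zero => simp
      | add x y hx hy => simp only [map_add, hx, hy]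
      | tmul v a =>
        rw [LinearMap.lTensor_tmul, coactBraidInv_tmul, LinearMap.rTensor_tmul]
        generalize ρ v = s
        induction s with
        | zero => simp
        | add x y hx hy => simp only [map_add, TensorProduct.add_tmul, hx, hy]
        | tmul v b => simp
    rw [coactBraid_tmul, key, h, ← LinearMap.lTensor_comp_apply, LinearMap.comp_assoc,
      LinearMap.comp_assoc, mul_antipode_rTensor_comul, ← LinearMap.comp_assoc,
      LinearMap.lTensor_comp_apply, h']
    simp

end Inverse

section YetterDrinfeld

/-- A (left-right) Yetter-Drinfel'd module: a left module `V` and right comodule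
`ρ : V → V ⊗ A` over the bialgebra `A` such that
`∑ a₁ v₀ ⊗ a₂ v₁ = ∑ (a₂ v)₀ ⊗ (a₂ v)₁ a₁`. -/
structure YD (k : Type u) [Field k] (A : Type u) [Ring A] [Bialgebra k A] where
  toLMod : LMod k A
  coact : toLMod.V →ₗ[k] toLMod.V ⊗[k] A
  coassoc : ∀ v, TensorProduct.assoc k toLMod.V A A (coact.rTensor A (coact v)) =
    comul.lTensor toLMod.V (coact v)
  counit_coact : ∀ v, counit.lTensor toLMod.V (coact v) = v ⊗ₜ[k] (1 : k)
  compat : ∀ (a : A) (v : toLMod.V),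
    outerAct toLMod.act (Algebra.lmul k A) (comul a) (coact v) =
      coactAfter toLMod.act coact v (comul a)

namespace YD

variable {k : Type u} [Field k] {A : Type u} [Ring A]

section Bialgebra

variable [Bialgebra k A]

/-- A homomorphism of Yetter-Drinfel'd modules: a map of modules and of comodules. -/
@[ext]
structure Hom (M N : YD k A) where
  hom : M.toLMod ⟶ N.toLMod
  comm : ∀ m : M.toLMod.V, hom.hom.hom.rTensor A (M.coact m) = N.coact (hom.hom m)

instance : Category (YD k A) where
  Hom M N := Hom M N
  id M := ⟨𝟙 _, fun m => congr($(LinearMap.rTensor_id A M.toLMod.V) (M.coact m))⟩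
  comp f g := ⟨f.hom ≫ g.hom, fun m => by
    rw [LMod.comp_hom, ModuleCat.hom_comp, LinearMap.rTensor_comp_apply, f.comm, g.comm]
    rfl⟩

@[ext]
theorem hom_ext {M N : YD k A} {f g : M ⟶ N} (h : f.hom = g.hom) : f = g := Hom.ext h

@[simp] theorem id_hom (M : YD k A) : Hom.hom (𝟙 M) = 𝟙 M.toLMod := rfl
@[simp] theorem comp_hom {M N P : YD k A} (f : M ⟶ N) (g : N ⟶ P) :
    (f ≫ g).hom = f.hom ≫ g.hom := rfl

variable (k A) in
/-- The forgetful functor from Yetter-Drinfel'd modules to modules. -/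
def forget : YD k A ⥤ LMod k A where
  obj M := M.toLMod
  map f := f.hom

instance : (forget k A).Faithful where
  map_injective h := hom_ext h

/-- An isomorphism of modules which commutes with the coactions. -/
def isoMk {M N : YD k A} (e : M.toLMod ≅ N.toLMod)
    (h : ∀ m : M.toLMod.V, e.hom.hom.hom.rTensor A (M.coact m) = N.coact (e.hom.hom m)) :
    M ≅ N where
  hom := ⟨e.hom, h⟩
  inv := ⟨e.inv, fun n => by
    have h1 : ∀ x, e.hom.hom (e.inv.hom x) = x := fun x =>
      congr(($(e.inv_hom_id).hom) x)
    have h2 : ∀ x, e.inv.hom.hom.rTensor A (e.hom.hom.hom.rTensor A x) = x := fun x => by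
      rw [← LinearMap.rTensor_comp_apply, ← ModuleCat.hom_comp, ← LMod.comp_hom, e.hom_inv_id]
      exact congr($(LinearMap.rTensor_id A M.toLMod.V) x)
    rw [← h2 (M.coact _), h, h1]⟩
  hom_inv_id := hom_ext e.hom_inv_id
  inv_hom_id := hom_ext e.inv_hom_id

section Linear

variable {M N : YD k A}

instance : Zero (M ⟶ N) := ⟨⟨0, fun m => by simp⟩⟩
instance : Add (M ⟶ N) := ⟨fun f g => ⟨f.hom + g.hom, fun m => by
  simp [LinearMap.rTensor_add, f.comm, g.comm]⟩⟩
instance : Neg (M ⟶ N) := ⟨fun f => ⟨-f.hom, fun m => by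
  simp [LinearMap.rTensor_neg, f.comm]⟩⟩
instance : SMul k (M ⟶ N) := ⟨fun c f => ⟨c • f.hom, fun m => by
  simp [LinearMap.rTensor_smul, f.comm]⟩⟩

@[simp] theorem zero_hom : Hom.hom (0 : M ⟶ N) = 0 := rfl
@[simp] theorem add_hom (f g : M ⟶ N) : (f + g).hom = f.hom + g.hom := rfl
@[simp] theorem neg_hom (f : M ⟶ N) : (-f).hom = -f.hom := rfl
@[simp] theorem smul_hom (c : k) (f : M ⟶ N) : (c • f).hom = c • f.hom := rfl

instance : AddCommGroup (M ⟶ N) where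
  add_assoc f g h := by ext1; exact add_assoc _ _ _
  zero_add f := by ext1; exact zero_add _
  add_zero f := by ext1; exact add_zero _
  neg_add_cancel f := by ext1; exact neg_add_cancel _
  add_comm f g := by ext1; exact add_comm _ _
  nsmul := nsmulRec
  zsmul := zsmulRec

instance : Preadditive (YD k A) where
  add_comp _ _ _ f f' g := by ext1; exact Preadditive.add_comp ..
  comp_add _ _ _ f g g' := by ext1; exact Preadditive.comp_add ..

instance : Linear k (YD k A) where
  homModule M N :=
    { one_smul := fun f => by ext1; exact one_smul ..
      mul_smul := fun c d f => by ext1; exact mul_smul ..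
      smul_zero := fun c => by ext1; exact smul_zero _
      smul_add := fun c f g => by ext1; exact smul_add ..
      add_smul := fun c d f => by ext1; exact add_smul ..
      zero_smul := fun f => by ext1; exact zero_smul _ _ }
  smul_comp _ _ _ c f g := by ext1; exact Linear.smul_comp ..
  comp_smul _ _ _ f c g := by ext1; exact Linear.comp_smul ..

end Linear

/-- The tensor product of Yetter-Drinfel'd modules, with `a (v ⊗ w) = ∑ a₁ v ⊗ a₂ w` and
coaction `v ⊗ w ↦ ∑ v₀ ⊗ w₀ ⊗ w₁ v₁`. -/
def tensorObj (M N : YD k A) : YD k A where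
  toLMod := M.toLMod ⊗ N.toLMod
  coact := tensorCoact M.coact N.coact
  coassoc := tensorCoact_coassoc M.coassoc N.coassoc
  counit_coact := tensorCoact_counit M.counit_coact N.counit_coact
  compat := tensorCoact_linear M.compat N.compat

/-- The field `k` with the trivial action and coaction. -/
def tensorUnit : YD k A where
  toLMod := 𝟙_ (LMod k A)
  coact := (TensorProduct.mk k k A).flip 1
  coassoc := fun (v : k) => by
    change TensorProduct.assoc k k A A (((TensorProduct.mk k k A).flip 1).rTensor A (v ⊗ₜ 1)) =
      comul.lTensor k (v ⊗ₜ 1)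
    simp [Algebra.TensorProduct.one_def]
  counit_coact := fun (v : k) => by
    change counit.lTensor k (v ⊗ₜ 1) = _
    simp
  compat a v := by
    have h1 : ∀ t : A ⊗[k] A, outerAct (trivAct k A) (Algebra.lmul k A) t (v ⊗ₜ[k] (1 : A)) =
        v ⊗ₜ[k] TensorProduct.lid k A (counit.rTensor A t) := by
      intro t
      induction t with
      | zero => simp
      | add x y hx hy => simp only [map_add, TensorProduct.tmul_add, LinearMap.add_apply, hx, hy]
      | tmul a b => simp [trivAct_apply, TensorProduct.smul_tmul', TensorProduct.tmul_smul]
    have h2 : ∀ t : A ⊗[k] A,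
        coactAfter (trivAct k A) ((TensorProduct.mk k k A).flip 1) v t =
        v ⊗ₜ[k] TensorProduct.rid k A (counit.lTensor A t) := by
      intro t
      induction t with
      | zero => simp
      | add x y hx hy => simp only [map_add, TensorProduct.tmul_add, hx, hy]
      | tmul a b =>
        simp [coactAfter_tmul, trivAct_apply, TensorProduct.smul_tmul', TensorProduct.tmul_smul]
    refine (h1 _).trans (Eq.trans ?_ (h2 _).symm)
    simp

theorem rTensor_tensorCoact {M M' N N' : YD k A} (f : M ⟶ M') (g : N ⟶ N')
    (t : M.toLMod.V ⊗[k] N.toLMod.V) :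
    (TensorProduct.map f.hom.hom.hom g.hom.hom.hom).rTensor A (tensorCoact M.coact N.coact t) =
      tensorCoact M'.coact N'.coact (TensorProduct.map f.hom.hom.hom g.hom.hom.hom t) := by
  induction t with
  | zero => simp
  | add x y hx hy => simp only [map_add, hx, hy]
  | tmul m n =>
    simp only [tensorCoact, LinearMap.comp_apply, TensorProduct.map_tmul]
    erw [← f.comm, ← g.comm]
    generalize M.coact m = s
    generalize N.coact n = t
    induction s with
    | zero => simp
    | add x y hx hy => simp only [map_add, TensorProduct.add_tmul, hx, hy]
    | tmul v a =>
      induction t with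
      | zero => simp
      | add x y hx hy => simp only [map_add, TensorProduct.tmul_add, hx, hy]
      | tmul w b => simp

theorem assoc_tensorCoact (M N P : YD k A)
    (t : (M.toLMod.V ⊗[k] N.toLMod.V) ⊗[k] P.toLMod.V) :
    (TensorProduct.assoc k M.toLMod.V N.toLMod.V P.toLMod.V).toLinearMap.rTensor A
        (tensorCoact (tensorCoact M.coact N.coact) P.coact t) =
      tensorCoact M.coact (tensorCoact N.coact P.coact)
        (TensorProduct.assoc k M.toLMod.V N.toLMod.V P.toLMod.V t) := by
  induction t with
  | zero => simp
  | add x y hx hy => simp only [map_add, hx, hy]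
  | tmul t p =>
    induction t with
    | zero => simp
    | add x y hx hy => simp only [map_add, TensorProduct.add_tmul, hx, hy]
    | tmul m n =>
      simp only [tensorCoact, LinearMap.comp_apply, TensorProduct.map_tmul,
        TensorProduct.assoc_tmul]
      generalize M.coact m = s
      generalize N.coact n = t
      generalize P.coact p = r
      induction s with
      | zero => simp
      | add x y hx hy => simp only [map_add, TensorProduct.add_tmul, hx, hy]
      | tmul v a =>
        induction t with
        | zero => simp
        | add x y hx hy =>
          simp only [map_add, TensorProduct.tmul_add, TensorProduct.add_tmul, hx, hy]
        | tmul w b =>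
          induction r with
          | zero => simp
          | add x y hx hy => simp only [map_add, TensorProduct.tmul_add, hx, hy]
          | tmul p c => simp [mul_assoc]

theorem lid_tensorCoact (M : YD k A) (t : k ⊗[k] M.toLMod.V) :
    (TensorProduct.lid k M.toLMod.V).toLinearMap.rTensor A
        (tensorCoact ((TensorProduct.mk k k A).flip 1) M.coact t) =
      M.coact (TensorProduct.lid k M.toLMod.V t) := by
  induction t with
  | zero => simp
  | add x y hx hy => simp only [map_add, hx, hy]
  | tmul c m =>
    simp only [tensorCoact, LinearMap.comp_apply, TensorProduct.map_tmul, TensorProduct.lid_tmul,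
      map_smul]
    generalize M.coact m = s
    induction s with
    | zero => simp
    | add x y hx hy => simp only [map_add, TensorProduct.tmul_add, smul_add, hx, hy]
    | tmul v a => simp [TensorProduct.smul_tmul']

theorem rid_tensorCoact (M : YD k A) (t : M.toLMod.V ⊗[k] k) :
    (TensorProduct.rid k M.toLMod.V).toLinearMap.rTensor A
        (tensorCoact M.coact ((TensorProduct.mk k k A).flip 1) t) =
      M.coact (TensorProduct.rid k M.toLMod.V t) := by
  induction t with
  | zero => simp
  | add x y hx hy => simp only [map_add, hx, hy]
  | tmul m c =>
    simp only [tensorCoact, LinearMap.comp_apply, TensorProduct.map_tmul, TensorProduct.rid_tmul,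
      map_smul]
    generalize M.coact m = s
    induction s with
    | zero => simp
    | add x y hx hy => simp only [map_add, TensorProduct.add_tmul, smul_add, hx, hy]
    | tmul v a => simp [TensorProduct.smul_tmul']

instance : MonoidalCategoryStruct (YD k A) where
  tensorObj := tensorObj
  whiskerLeft M _ _ f := ⟨M.toLMod ◁ f.hom, rTensor_tensorCoact (𝟙 M) f⟩
  whiskerRight f N := ⟨f.hom ▷ N.toLMod, rTensor_tensorCoact f (𝟙 N)⟩
  tensorHom f g := ⟨f.hom ⊗ₘ g.hom, rTensor_tensorCoact f g⟩
  tensorUnit := tensorUnit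
  associator M N P := isoMk (α_ M.toLMod N.toLMod P.toLMod) (assoc_tensorCoact M N P)
  leftUnitor M := isoMk (λ_ M.toLMod) (lid_tensorCoact M)
  rightUnitor M := isoMk (ρ_ M.toLMod) (rid_tensorCoact M)

instance : MonoidalCategory (YD k A) where
  tensorHom_def f g := hom_ext (MonoidalCategory.tensorHom_def f.hom g.hom)
  id_tensorHom_id M N := hom_ext (MonoidalCategory.id_tensorHom_id M.toLMod N.toLMod)
  tensorHom_comp_tensorHom f g f' g' :=
    hom_ext (MonoidalCategory.tensorHom_comp_tensorHom f.hom g.hom f'.hom g'.hom)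
  whiskerLeft_id M N := hom_ext (MonoidalCategory.whiskerLeft_id M.toLMod N.toLMod)
  id_whiskerRight M N := hom_ext (MonoidalCategory.id_whiskerRight M.toLMod N.toLMod)
  associator_naturality f g h :=
    hom_ext (MonoidalCategory.associator_naturality f.hom g.hom h.hom)
  leftUnitor_naturality f := hom_ext (MonoidalCategory.leftUnitor_naturality f.hom)
  rightUnitor_naturality f := hom_ext (MonoidalCategory.rightUnitor_naturality f.hom)
  pentagon M N P Q := hom_ext (MonoidalCategory.pentagon M.toLMod N.toLMod P.toLMod Q.toLMod)
  triangle M N := hom_ext (MonoidalCategory.triangle M.toLMod N.toLMod)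

@[simp] theorem tensor_toLMod (M N : YD k A) : (M ⊗ N).toLMod = M.toLMod ⊗ N.toLMod := rfl
theorem tensor_coact (M N : YD k A) : (M ⊗ N).coact = tensorCoact M.coact N.coact := rfl

/-- The forgetful functor is (strictly) monoidal. -/
instance : (forget k A).Monoidal :=
  Functor.CoreMonoidal.toMonoidal
    { εIso := Iso.refl _
      μIso := fun _ _ => Iso.refl _
      μIso_hom_natural_left := fun f N => (Category.comp_id _).trans (Category.id_comp _).symm
      μIso_hom_natural_right := fun f N => (Category.comp_id _).trans (Category.id_comp _).symm
      associativity := fun M N P => by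
        apply LMod.hom_ext
        apply ModuleCat.MonoidalCategory.tensor_ext₃'
        intro m n p
        rfl
      left_unitality := fun M => by
        apply LMod.hom_ext
        apply ModuleCat.MonoidalCategory.tensor_ext
        intro m n
        rfl
      right_unitality := fun M => by
        apply LMod.hom_ext
        apply ModuleCat.MonoidalCategory.tensor_ext
        intro m n
        rfl }

end Bialgebra

section Hopf

variable [HopfAlgebra k A]

/-- For a Yetter-Drinfel'd module `V` and a module `X`, the isomorphism of modules
`X ⊗ V ≅ V ⊗ X`, `x ⊗ v ↦ ∑ v₀ ⊗ v₁ x`. -/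
def halfBraid (X : LMod k A) (V : YD k A) : X ⊗ V.toLMod ≅ V.toLMod ⊗ X :=
  LMod.isoMk
    { hom := ModuleCat.ofHom (coactBraid X.act V.coact)
      inv := ModuleCat.ofHom (coactBraidInv X.act V.coact)
      hom_inv_id := ModuleCat.hom_ext
        (LinearMap.ext (coactBraidInv_coactBraid V.coassoc V.counit_coact X.act))
      inv_hom_id := ModuleCat.hom_ext
        (LinearMap.ext (coactBraid_inv V.coassoc V.counit_coact X.act)) }
    (coactBraid_linear V.compat X.act)

theorem halfBraid_hom_apply (X : LMod k A) (V : YD k A) (t : X.V ⊗[k] V.toLMod.V) :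
    (halfBraid X V).hom.hom t = coactBraid X.act V.coact t := rfl

/-- The braiding `M ⊗ N ≅ N ⊗ M`, `m ⊗ n ↦ ∑ n₀ ⊗ n₁ m`. -/
instance : BraidedCategory (YD k A) where
  braiding M N := isoMk (halfBraid M.toLMod N) (coactBraid_colinear M.compat N.coassoc)
  braiding_naturality_right M N P f := hom_ext (LMod.hom_ext (ModuleCat.hom_ext (LinearMap.ext
    (coactBraid_natural' M.toLMod.act f.hom.hom.hom f.comm))))
  braiding_naturality_left {M N} f P := hom_ext (LMod.hom_ext (ModuleCat.hom_ext (LinearMap.ext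
    (coactBraid_natural P.coact f.hom.hom.hom f.hom.comm))))
  hexagon_forward M N P := hom_ext (LMod.hom_ext (ModuleCat.hom_ext (LinearMap.ext fun t =>
    ((LinearEquiv.eq_symm_apply _).1 (coactBraid_tensorCoact N.coact P.coact M.toLMod.act t)))))
  hexagon_reverse M N P := hom_ext (LMod.hom_ext (ModuleCat.hom_ext (LinearMap.ext
    fun (t : M.toLMod.V ⊗[k] (N.toLMod.V ⊗[k] P.toLMod.V)) => by
    have := coactBraid_tensor P.coassoc M.toLMod.act N.toLMod.act
      ((TensorProduct.assoc k _ _ _).symm t)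
    rw [LinearEquiv.apply_symm_apply] at this
    exact (LinearEquiv.symm_apply_eq _).2 this)))

end Hopf

end YD

end YetterDrinfeld
end HopfCat

namespace HopfCat
open Coalgebra Bialgebra HopfAlgebra

section Convolution

open WithConv

variable {k : Type u} [Field k] {A : Type u} [Ring A] {E : Type u} [Semiring E] [Algebra k E]

section

variable [Bialgebra k A]

/-- The convolution of two homomorphisms of algebras with commuting images. -/
def convHom (f g : A →ₐ[k] E) (h : ∀ a b, Commute (f a) (g b)) : A →ₐ[k] E :=
  (Algebra.TensorProduct.lift f g h).comp (comulAlgHom k A)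

theorem toConv_convHom (f g : A →ₐ[k] E) (h : ∀ a b, Commute (f a) (g b)) :
    toConv (convHom f g h).toLinearMap = toConv f.toLinearMap * toConv g.toLinearMap := by
  ext a
  change Algebra.TensorProduct.lift f g h (comul a) =
    LinearMap.mul' k E (TensorProduct.map f.toLinearMap g.toLinearMap (comul a))
  generalize (comul a : A ⊗[k] A) = t
  induction t with
  | zero => simp
  | add x y hx hy => simp only [map_add, hx, hy]
  | tmul a b => simp

/-- The map `a ↦ ε(a) e`. -/
def convConst (k : Type u) [Field k] (A : Type u) [Ring A] [Bialgebra k A] {E : Type u} [Semiring E]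
    [Algebra k E] (e : E) : A →ₗ[k] E :=
  (counit (R := k) (A := A)).smulRight e

theorem convConst_mul (e : E) (f : A →ₗ[k] E) :
    toConv (convConst k A e) * toConv f = toConv (LinearMap.mulLeft k e ∘ₗ f) := by
  ext a
  have : ∀ t : A ⊗[k] A, LinearMap.mul' k E (TensorProduct.map (convConst k A e) f t) =
      e * f (TensorProduct.lid k A (counit.rTensor A t)) := by
    intro t
    induction t with
    | zero => simp
    | add x y hx hy => simp only [map_add, mul_add, hx, hy]
    | tmul a b => simp [convConst]
  refine (this _).trans ?_
  rw [rTensor_counit_comul]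
  simp

theorem mul_convConst (e : E) (f : A →ₗ[k] E) :
    toConv f * toConv (convConst k A e) = toConv (LinearMap.mulRight k e ∘ₗ f) := by
  ext a
  have : ∀ t : A ⊗[k] A, LinearMap.mul' k E (TensorProduct.map f (convConst k A e) t) =
      f (TensorProduct.rid k A (counit.lTensor A t)) * e := by
    intro t
    induction t with
    | zero => simp
    | add x y hx hy => simp only [map_add, add_mul, hx, hy]
    | tmul a b => simp [convConst]
  refine (this _).trans ?_
  rw [lTensor_counit_comul]
  simp

theorem convConst_mul_apply (e : E) (F : WithConv (A →ₗ[k] E)) (a : A) :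
    (toConv (convConst k A e) * F).ofConv a = e * F.ofConv a :=
  congr(($(convConst_mul e F.ofConv)).ofConv a)

theorem mul_convConst_apply (e : E) (F : WithConv (A →ₗ[k] E)) (a : A) :
    (F * toConv (convConst k A e)).ofConv a = F.ofConv a * e :=
  congr(($(mul_convConst e F.ofConv)).ofConv a)

theorem conv_comp {E' : Type u} [Semiring E'] [Algebra k E'] (h : E →ₐ[k] E') (f g : A →ₗ[k] E) :
    toConv (h.toLinearMap ∘ₗ (toConv f * toConv g).ofConv) =
      toConv (h.toLinearMap ∘ₗ f) * toConv (h.toLinearMap ∘ₗ g) := by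
  rw [LinearMap.algHom_comp_convMul_distrib]

theorem conv_one_comp {E' : Type u} [Semiring E'] [Algebra k E'] (h : E →ₐ[k] E') :
    toConv (h.toLinearMap ∘ₗ (1 : WithConv (A →ₗ[k] E)).ofConv) = 1 := by
  ext a
  exact h.commutes _

end

section Hopf

variable [HopfAlgebra k A]

theorem algHom_conv_antipode (i : A →ₐ[k] E) :
    toConv i.toLinearMap * toConv (i.toLinearMap ∘ₗ antipode k) = 1 := by
  have := conv_comp i LinearMap.id (antipode k (A := A))
  rw [LinearMap.id_mul_antipode, conv_one_comp] at this
  exact this.symm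

theorem antipode_conv_algHom (i : A →ₐ[k] E) :
    toConv (i.toLinearMap ∘ₗ antipode k) * toConv i.toLinearMap = 1 := by
  have := conv_comp i (antipode k (A := A)) LinearMap.id
  rw [LinearMap.antipode_mul_id, conv_one_comp] at this
  exact this.symm

theorem toConv_comul :
    toConv (comul (R := k) (A := A)) =
      toConv (Algebra.TensorProduct.includeLeft (R := k) (S := k) (A := A) (B := A)).toLinearMap *
      toConv (Algebra.TensorProduct.includeRight (R := k) (A := A) (B := A)).toLinearMap := by
  ext a
  change comul a = LinearMap.mul' k _ (TensorProduct.map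
    (Algebra.TensorProduct.includeLeft (R := k) (S := k) (A := A) (B := A)).toLinearMap
    (Algebra.TensorProduct.includeRight (R := k) (A := A) (B := A)).toLinearMap (comul a))
  generalize (comul a : A ⊗[k] A) = t
  induction t with
  | zero => simp
  | add x y hx hy => rw [map_add, map_add, ← hx, ← hy]
  | tmul a b => simp

/-- The antipode is an anti-homomorphism of coalgebras. -/
theorem comul_antipode (a : A) : comul (R := k) (antipode k a) =
    TensorProduct.map (antipode k) (antipode k) (TensorProduct.comm k A A (comul a)) := by
  let l := (Algebra.TensorProduct.includeLeft (R := k) (S := k) (A := A) (B := A))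
  let r := (Algebra.TensorProduct.includeRight (R := k) (A := A) (B := A))
  have h1 : toConv (TensorProduct.map (antipode k) (antipode k) ∘ₗ
      (TensorProduct.comm k A A).toLinearMap ∘ₗ comul) =
      toConv (r.toLinearMap ∘ₗ antipode k) * toConv (l.toLinearMap ∘ₗ antipode k) := by
    ext a
    change TensorProduct.map (antipode k) (antipode k) (TensorProduct.comm k A A (comul a)) =
      LinearMap.mul' k _ (TensorProduct.map (r.toLinearMap ∘ₗ antipode k)
        (l.toLinearMap ∘ₗ antipode k) (comul a))
    generalize (comul a : A ⊗[k] A) = t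
    induction t with
    | zero => simp
    | add x y hx hy => simp only [map_add, hx, hy]
    | tmul a b => simp [l, r]
  have h2 : toConv (TensorProduct.map (antipode k) (antipode k) ∘ₗ
      (TensorProduct.comm k A A).toLinearMap ∘ₗ comul) * toConv (comul (R := k) (A := A)) = 1 := by
    rw [h1, toConv_comul, mul_assoc, ← mul_assoc (toConv (l.toLinearMap ∘ₗ _)),
      antipode_conv_algHom, one_mul, antipode_conv_algHom]
  have h3 := algHom_conv_antipode (comulAlgHom k A)
  have := left_inv_eq_right_inv h2 h3
  exact congr(($this).ofConv a).symm

end Hopf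

end Convolution

section OneSided

variable {k : Type u} [Field k] {A : Type u} [Ring A] [Algebra k A] {X : Type u} [AddCommGroup X]
  [Module k X] (V : Type u) [AddCommGroup V] [Module k V]

/-- The action of `A` on the second factor of `V ⊗ X`. -/
def actL (g : A →ₐ[k] Module.End k X) : A →ₐ[k] Module.End k (V ⊗[k] X) :=
  (Module.End.lTensorAlgHom k X V).comp g

/-- The action of `A` on the first factor of `X ⊗ V`. -/
def actR (g : A →ₐ[k] Module.End k X) : A →ₐ[k] Module.End k (X ⊗[k] V) :=
  (Module.End.rTensorAlgHom k X V).comp g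

@[simp] theorem actL_tmul (g : A →ₐ[k] Module.End k X) (a : A) (v : V) (x : X) :
    actL V g a (v ⊗ₜ x) = v ⊗ₜ g a x := rfl

@[simp] theorem actR_tmul (g : A →ₐ[k] Module.End k X) (a : A) (v : V) (x : X) :
    actR V g a (x ⊗ₜ v) = g a x ⊗ₜ v := rfl

end OneSided

section BijectiveAntipode

/-- The antipode of the Hopf algebra `A` is bijective. -/
class HasBijectiveAntipode (k : Type u) [Field k] (A : Type u) [Ring A] [HopfAlgebra k A] :
    Prop where
  bijective : Function.Bijective (antipode k (A := A))

variable (k : Type u) [Field k] {A : Type u} [Ring A] [HopfAlgebra k A] [HasBijectiveAntipode k A]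

/-- The inverse of the antipode. -/
def antipodeInv : A →ₗ[k] A :=
  (LinearEquiv.ofBijective (antipode k (A := A)) HasBijectiveAntipode.bijective).symm.toLinearMap

@[simp]
theorem antipode_antipodeInv (a : A) : antipode k (antipodeInv k a) = a :=
  (LinearEquiv.ofBijective (antipode k (A := A))
    HasBijectiveAntipode.bijective).apply_symm_apply a

@[simp]
theorem antipodeInv_antipode (a : A) : antipodeInv k (antipode k a) = a :=
  (LinearEquiv.ofBijective (antipode k (A := A))
    HasBijectiveAntipode.bijective).symm_apply_apply a

theorem antipode_inj {a b : A} (h : antipode k a = antipode k b) : a = b := by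
  rw [← antipodeInv_antipode k a, h, antipodeInv_antipode]

theorem antipodeInv_one : antipodeInv k (1 : A) = 1 := by
  apply antipode_inj k; simp

theorem antipodeInv_mul (a b : A) :
    antipodeInv k (a * b) = antipodeInv k b * antipodeInv k a := by
  apply antipode_inj k; simp [antipode_mul_antidistrib]

theorem comul_antipodeInv (a : A) : comul (R := k) (antipodeInv k a) =
    TensorProduct.map (antipodeInv k) (antipodeInv k) (TensorProduct.comm k A A (comul a)) := by
  have h := comul_antipode (k := k) (antipodeInv k a)
  rw [antipode_antipodeInv] at h
  rw [h]
  generalize (comul (antipodeInv k a) : A ⊗[k] A) = t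
  induction t with
  | zero => simp
  | add x y hx hy => simp only [map_add, ← hx, ← hy]
  | tmul a b => simp

variable (A) in
/-- The inverse of the antipode, as a homomorphism from `A` to the opposite algebra. -/
def antipodeInvOp : A →ₐ[k] Aᵐᵒᵖ :=
  AlgHom.ofLinearMap ((MulOpposite.opLinearEquiv k).toLinearMap ∘ₗ antipodeInv k)
    (by simp [antipodeInv_one]) (fun a b => by simp [antipodeInv_mul])

@[simp] theorem antipodeInvOp_apply (a : A) :
    antipodeInvOp k A a = MulOpposite.op (antipodeInv k a) := rfl

/-- `∑ S⁻¹(a₂) a₁ = ε(a)`. -/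
theorem antipodeInv_mul_comul (a : A) : LinearMap.mul' k A
    (TensorProduct.map (antipodeInv k) LinearMap.id (TensorProduct.comm k A A (comul a))) =
      algebraMap k A (counit a) := by
  apply antipode_inj k
  have : ∀ t : A ⊗[k] A, antipode k (LinearMap.mul' k A
      (TensorProduct.map (antipodeInv k) LinearMap.id (TensorProduct.comm k A A t))) =
      LinearMap.mul' k A ((antipode k).rTensor A t) := by
    intro t
    induction t with
    | zero => simp
    | add x y hx hy => simp only [map_add, hx, hy]
    | tmul a b => simp [antipode_mul_antidistrib]
  rw [this, mul_antipode_rTensor_comul_apply, Algebra.algebraMap_eq_smul_one, map_smul,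
    antipode_one]

/-- `∑ a₂ S⁻¹(a₁) = ε(a)`. -/
theorem mul_antipodeInv_comul (a : A) : LinearMap.mul' k A
    (TensorProduct.map LinearMap.id (antipodeInv k) (TensorProduct.comm k A A (comul a))) =
      algebraMap k A (counit a) := by
  apply antipode_inj k
  have : ∀ t : A ⊗[k] A, antipode k (LinearMap.mul' k A
      (TensorProduct.map LinearMap.id (antipodeInv k) (TensorProduct.comm k A A t))) =
      LinearMap.mul' k A ((antipode k).lTensor A t) := by
    intro t
    induction t with
    | zero => simp
    | add x y hx hy => simp only [map_add, hx, hy]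
    | tmul a b => simp [antipode_mul_antidistrib]
  rw [this, mul_antipode_lTensor_comul_apply, Algebra.algebraMap_eq_smul_one, map_smul,
    antipode_one]

end BijectiveAntipode
end HopfCat

namespace HopfCat
open Coalgebra Bialgebra HopfAlgebra

section Radford

open WithConv

section Coaction

variable {k : Type u} [Field k] {A : Type u} [Ring A] [Bialgebra k A]
  {L : Type u} [AddCommGroup L] [Module k L]

variable (k A L) in
/-- The coaction `l ⊗ a ↦ ∑ l ⊗ a₁ ⊗ a₂` of `A` on `L ⊗ A`. -/
def radfordCoact : L ⊗[k] A →ₗ[k] (L ⊗[k] A) ⊗[k] A :=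
  (TensorProduct.assoc k L A A).symm.toLinearMap ∘ₗ comul.lTensor L

theorem radfordCoact_tmul (l : L) (a : A) :
    radfordCoact k A L (l ⊗ₜ a) = (TensorProduct.assoc k L A A).symm (l ⊗ₜ comul a) := rfl

theorem radfordCoact_coassoc (t : L ⊗[k] A) :
    TensorProduct.assoc k (L ⊗[k] A) A A
      ((radfordCoact k A L).rTensor A (radfordCoact k A L t)) =
    comul.lTensor (L ⊗[k] A) (radfordCoact k A L t) := by
  induction t with
  | zero => simp
  | add x y hx hy => simp only [map_add, hx, hy]
  | tmul l a =>
    have h1 : ∀ t : A ⊗[k] A, TensorProduct.assoc k (L ⊗[k] A) A A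
        ((radfordCoact k A L).rTensor A ((TensorProduct.assoc k L A A).symm (l ⊗ₜ t))) =
        (TensorProduct.assoc k L A (A ⊗[k] A)).symm (l ⊗ₜ TensorProduct.assoc k A A A
          (comul.rTensor A t)) := by
      intro t
      induction t with
      | zero => simp
      | add x y hx hy => simp only [map_add, TensorProduct.tmul_add, hx, hy]
      | tmul a b =>
        simp only [TensorProduct.assoc_symm_tmul, LinearMap.rTensor_tmul, radfordCoact_tmul]
        generalize (comul a : A ⊗[k] A) = s
        induction s with
        | zero => simp
        | add x y hx hy =>
          simp only [map_add, TensorProduct.tmul_add, TensorProduct.add_tmul, hx, hy]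
        | tmul a c => simp
    have h2 : ∀ t : A ⊗[k] A, comul.lTensor (L ⊗[k] A)
        ((TensorProduct.assoc k L A A).symm (l ⊗ₜ t)) =
        (TensorProduct.assoc k L A (A ⊗[k] A)).symm (l ⊗ₜ comul.lTensor A t) := by
      intro t
      induction t with
      | zero => simp
      | add x y hx hy => simp only [map_add, TensorProduct.tmul_add, hx, hy]
      | tmul a b => simp
    rw [radfordCoact_tmul, h1, h2, coassoc_apply]

theorem radfordCoact_counit (t : L ⊗[k] A) :
    counit.lTensor (L ⊗[k] A) (radfordCoact k A L t) = t ⊗ₜ[k] (1 : k) := by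
  induction t with
  | zero => simp
  | add x y hx hy => simp only [map_add, TensorProduct.add_tmul, hx, hy]
  | tmul l a =>
    have h2 : ∀ t : A ⊗[k] A, counit.lTensor (L ⊗[k] A)
        ((TensorProduct.assoc k L A A).symm (l ⊗ₜ t)) =
        (TensorProduct.assoc k L A k).symm (l ⊗ₜ counit.lTensor A t) := by
      intro t
      induction t with
      | zero => simp
      | add x y hx hy => simp only [map_add, TensorProduct.tmul_add, hx, hy]
      | tmul a b => simp
    rw [radfordCoact_tmul, h2, lTensor_counit_comul, TensorProduct.assoc_symm_tmul]

variable (k A L) in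
/-- The map `l ⊗ a ⊗ b ↦ ∑ l ⊗ a₁ ⊗ a₂ b`. -/
def radfordAux : Module.End k ((L ⊗[k] A) ⊗[k] A) :=
  (LinearMap.mul' k A).lTensor (L ⊗[k] A) ∘ₗ (TensorProduct.assoc k (L ⊗[k] A) A A).toLinearMap ∘ₗ
    (radfordCoact k A L).rTensor A

theorem radfordAux_tmul (l : L) (a b : A) : radfordAux k A L ((l ⊗ₜ a) ⊗ₜ b) =
    (TensorProduct.assoc k L A A).symm (l ⊗ₜ (comul a * (1 ⊗ₜ b))) := by
  simp only [radfordAux, LinearMap.comp_apply, LinearMap.rTensor_tmul, radfordCoact_tmul]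
  generalize (comul a : A ⊗[k] A) = s
  induction s with
  | zero => simp
  | add x y hx hy =>
    simp only [map_add, TensorProduct.tmul_add, TensorProduct.add_tmul, add_mul, hx, hy]
  | tmul a c => simp

theorem radfordAux_tmul_one (m : L ⊗[k] A) :
    radfordAux k A L (m ⊗ₜ 1) = radfordCoact k A L m := by
  simp only [radfordAux, LinearMap.comp_apply, LinearMap.rTensor_tmul]
  generalize radfordCoact k A L m = s
  induction s with
  | zero => simp
  | add x y hx hy =>
    simp only [map_add, TensorProduct.tmul_add, TensorProduct.add_tmul, add_mul, hx, hy]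
  | tmul a c => simp

theorem radfordCoact_natural {M : Type u} [AddCommGroup M] [Module k M] (φ : L →ₗ[k] M)
    (m : L ⊗[k] A) : (φ.rTensor A).rTensor A (radfordCoact k A L m) =
      radfordCoact k A M (φ.rTensor A m) := by
  induction m with
  | zero => simp
  | add x y hx hy => simp only [map_add, hx, hy]
  | tmul l a =>
    rw [LinearMap.rTensor_tmul, radfordCoact_tmul, radfordCoact_tmul]
    generalize (comul a : A ⊗[k] A) = s
    induction s with
    | zero => simp
    | add x y hx hy => simp only [map_add, TensorProduct.tmul_add, hx, hy]
    | tmul a c => simp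

end Coaction

variable {k : Type u} [Field k] {A : Type u} [Ring A] [HopfAlgebra k A] [HasBijectiveAntipode k A]
  {L : Type u} [AddCommGroup L] [Module k L]

theorem op_conv_antipodeInv :
    toConv (MulOpposite.opLinearEquiv k : A ≃ₗ[k] Aᵐᵒᵖ).toLinearMap *
      toConv (antipodeInvOp k A).toLinearMap = 1 := by
  ext a
  have : ∀ t : A ⊗[k] A, LinearMap.mul' k Aᵐᵒᵖ
      (TensorProduct.map (MulOpposite.opLinearEquiv k : A ≃ₗ[k] Aᵐᵒᵖ).toLinearMap
        (antipodeInvOp k A).toLinearMap t) =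
      MulOpposite.op (LinearMap.mul' k A
        (TensorProduct.map (antipodeInv k) LinearMap.id (TensorProduct.comm k A A t))) := by
    intro t
    induction t with
    | zero => simp
    | add x y hx hy => simp only [map_add, hx, hy, MulOpposite.op_add]
    | tmul a b => simp
  refine (this _).trans ?_
  rw [antipodeInv_mul_comul]
  rfl

theorem antipodeInv_conv_op :
    toConv (antipodeInvOp k A).toLinearMap *
      toConv (MulOpposite.opLinearEquiv k : A ≃ₗ[k] Aᵐᵒᵖ).toLinearMap = 1 := by
  ext a
  have : ∀ t : A ⊗[k] A, LinearMap.mul' k Aᵐᵒᵖ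
      (TensorProduct.map (antipodeInvOp k A).toLinearMap
        (MulOpposite.opLinearEquiv k : A ≃ₗ[k] Aᵐᵒᵖ).toLinearMap t) =
      MulOpposite.op (LinearMap.mul' k A
        (TensorProduct.map LinearMap.id (antipodeInv k) (TensorProduct.comm k A A t))) := by
    intro t
    induction t with
    | zero => simp
    | add x y hx hy => simp only [map_add, hx, hy, MulOpposite.op_add]
    | tmul a b => simp
  refine (this _).trans ?_
  rw [mul_antipodeInv_comul]
  rfl

/-- `∑ Δ(S⁻¹(a₂)) (1 ⊗ a₁) = S⁻¹(a) ⊗ 1`. -/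
theorem comul_antipodeInv_mul (a : A) : LinearMap.mul' k (A ⊗[k] A)
    (TensorProduct.map (comul ∘ₗ antipodeInv k)
      (Algebra.TensorProduct.includeRight (R := k) (A := A) (B := A)).toLinearMap
      (TensorProduct.comm k A A (comul a))) = antipodeInv k a ⊗ₜ 1 := by
  let o : A →ₗ[k] Aᵐᵒᵖ := (MulOpposite.opLinearEquiv k : A ≃ₗ[k] Aᵐᵒᵖ).toLinearMap
  let l := AlgHom.op (Algebra.TensorProduct.includeLeft (R := k) (S := k) (A := A) (B := A))
  let r := AlgHom.op (Algebra.TensorProduct.includeRight (R := k) (A := A) (B := A))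
  let d := AlgHom.op (comulAlgHom k A)
  have h1 : toConv (d.toLinearMap ∘ₗ o) = toConv (l.toLinearMap ∘ₗ o) *
      toConv (r.toLinearMap ∘ₗ o) := by
    ext a
    have : ∀ t : A ⊗[k] A, MulOpposite.op t = LinearMap.mul' k _
        (TensorProduct.map (l.toLinearMap ∘ₗ o) (r.toLinearMap ∘ₗ o) t) := by
      intro t
      induction t with
      | zero => simp
      | add x y hx hy => simp only [map_add, MulOpposite.op_add, ← hx, ← hy]
      | tmul a b => simp [l, r, o, ← MulOpposite.op_mul]
    exact this (comul a)
  have h2 : toConv (d.toLinearMap ∘ₗ o) *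
      toConv (d.toLinearMap ∘ₗ (antipodeInvOp k A).toLinearMap) = 1 := by
    rw [← conv_comp, op_conv_antipodeInv, conv_one_comp]
  have h3 : toConv (l.toLinearMap ∘ₗ (antipodeInvOp k A).toLinearMap) *
      toConv (l.toLinearMap ∘ₗ o) = 1 := by
    rw [← conv_comp, antipodeInv_conv_op, conv_one_comp]
  have h4 : toConv (l.toLinearMap ∘ₗ (antipodeInvOp k A).toLinearMap) =
      toConv (r.toLinearMap ∘ₗ o) *
        toConv (d.toLinearMap ∘ₗ (antipodeInvOp k A).toLinearMap) := by
    rw [h1, mul_assoc] at h2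
    exact left_inv_eq_right_inv h3 h2
  have h5 : ∀ t : A ⊗[k] A, MulOpposite.op (LinearMap.mul' k (A ⊗[k] A)
      (TensorProduct.map (comul ∘ₗ antipodeInv k)
      (Algebra.TensorProduct.includeRight (R := k) (A := A) (B := A)).toLinearMap
      (TensorProduct.comm k A A t))) = LinearMap.mul' k _ (TensorProduct.map
        (r.toLinearMap ∘ₗ o) (d.toLinearMap ∘ₗ (antipodeInvOp k A).toLinearMap) t) := by
    intro t
    induction t with
    | zero => simp
    | add x y hx hy => simp only [map_add, MulOpposite.op_add, hx, hy]
    | tmul a b => simp [d, r, o]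
  apply MulOpposite.op_injective
  rw [h5]
  exact congr(($h4).ofConv a).symm

/-- `∑ (a₂ ⊗ 1) Δ(S⁻¹(a₁)) = 1 ⊗ S⁻¹(a)`. -/
theorem mul_comul_antipodeInv (a : A) : LinearMap.mul' k (A ⊗[k] A)
    (TensorProduct.map
      (Algebra.TensorProduct.includeLeft (R := k) (S := k) (A := A) (B := A)).toLinearMap
      (comul ∘ₗ antipodeInv k)
      (TensorProduct.comm k A A (comul a))) = 1 ⊗ₜ antipodeInv k a := by
  let o : A →ₗ[k] Aᵐᵒᵖ := (MulOpposite.opLinearEquiv k : A ≃ₗ[k] Aᵐᵒᵖ).toLinearMap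
  let l := AlgHom.op (Algebra.TensorProduct.includeLeft (R := k) (S := k) (A := A) (B := A))
  let r := AlgHom.op (Algebra.TensorProduct.includeRight (R := k) (A := A) (B := A))
  let d := AlgHom.op (comulAlgHom k A)
  have h1 : toConv (d.toLinearMap ∘ₗ o) = toConv (l.toLinearMap ∘ₗ o) *
      toConv (r.toLinearMap ∘ₗ o) := by
    ext a
    have : ∀ t : A ⊗[k] A, MulOpposite.op t = LinearMap.mul' k _
        (TensorProduct.map (l.toLinearMap ∘ₗ o) (r.toLinearMap ∘ₗ o) t) := by
      intro t
      induction t with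
      | zero => simp
      | add x y hx hy => simp only [map_add, MulOpposite.op_add, ← hx, ← hy]
      | tmul a b => simp [l, r, o, ← MulOpposite.op_mul]
    exact this (comul a)
  have h2 : toConv (d.toLinearMap ∘ₗ (antipodeInvOp k A).toLinearMap) *
      toConv (d.toLinearMap ∘ₗ o) = 1 := by
    rw [← conv_comp, antipodeInv_conv_op, conv_one_comp]
  have h3 : toConv (r.toLinearMap ∘ₗ o) *
      toConv (r.toLinearMap ∘ₗ (antipodeInvOp k A).toLinearMap) = 1 := by
    rw [← conv_comp, op_conv_antipodeInv, conv_one_comp]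
  have h4 : toConv (d.toLinearMap ∘ₗ (antipodeInvOp k A).toLinearMap) *
      toConv (l.toLinearMap ∘ₗ o) = toConv (r.toLinearMap ∘ₗ (antipodeInvOp k A).toLinearMap) := by
    rw [h1, ← mul_assoc] at h2
    exact left_inv_eq_right_inv h2 h3
  have h5 : ∀ t : A ⊗[k] A, MulOpposite.op (LinearMap.mul' k (A ⊗[k] A)
      (TensorProduct.map
      (Algebra.TensorProduct.includeLeft (R := k) (S := k) (A := A) (B := A)).toLinearMap
      (comul ∘ₗ antipodeInv k)
      (TensorProduct.comm k A A t))) = LinearMap.mul' k _ (TensorProduct.map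
        (d.toLinearMap ∘ₗ (antipodeInvOp k A).toLinearMap) (l.toLinearMap ∘ₗ o) t) := by
    intro t
    induction t with
    | zero => simp
    | add x y hx hy => simp only [map_add, MulOpposite.op_add, hx, hy]
    | tmul a b => simp [d, l, o]
  apply MulOpposite.op_injective
  rw [h5]
  exact congr(($h4).ofConv a)

variable (k A L) in
/-- The action `h (l ⊗ a) = l ⊗ a S⁻¹(h)`. -/
def rightInvAct : A →ₐ[k] Module.End k (L ⊗[k] A) :=
  actL L ((Algebra.lsmul k k A : Aᵐᵒᵖ →ₐ[k] Module.End k A).comp (antipodeInvOp k A))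

theorem rightInvAct_tmul (h : A) (l : L) (a : A) :
    rightInvAct k A L h (l ⊗ₜ a) = l ⊗ₜ (a * antipodeInv k h) := rfl

theorem rightInvAct_commute (f : A →ₐ[k] Module.End k L) (a b : A) :
    Commute (rightInvAct k A L a) (diagAct f (Algebra.lmul k A) b) := by
  apply TensorProduct.ext'
  intro l x
  simp only [Module.End.mul_apply, rightInvAct_tmul, diagAct_apply]
  generalize (comul b : A ⊗[k] A) = t
  induction t with
  | zero => simp
  | add x y hx hy => simp only [map_add, LinearMap.add_apply, hx, hy]
  | tmul c d => simp [rightInvAct_tmul, mul_assoc]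

/-- The action `h (l ⊗ a) = ∑ h₂ l ⊗ h₃ a S⁻¹(h₁)` of `A` on `L ⊗ A`, for a left `A`-module `L`. -/
def radfordAct (f : A →ₐ[k] Module.End k L) : A →ₐ[k] Module.End k (L ⊗[k] A) :=
  convHom (rightInvAct k A L) (diagAct f (Algebra.lmul k A)) (rightInvAct_commute f)


theorem radfordAct_natural {M : Type u} [AddCommGroup M] [Module k M]
    {f : A →ₐ[k] Module.End k L} {g : A →ₐ[k] Module.End k M} {φ : L →ₗ[k] M}
    (h : ∀ a l, φ (f a l) = g a (φ l)) (a : A) (m : L ⊗[k] A) :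
    φ.rTensor A (radfordAct f a m) = radfordAct g a (φ.rTensor A m) := by
  have h1 : ∀ (b : A) (m : L ⊗[k] A), φ.rTensor A (diagAct f (Algebra.lmul k A) b m) =
      diagAct g (Algebra.lmul k A) b (φ.rTensor A m) := fun b m =>
    outerAct_comm (ψ := LinearMap.id) h (fun _ _ => rfl) (comul b) m
  have h2 : ∀ (b : A) (m : L ⊗[k] A), φ.rTensor A (rightInvAct k A L b m) =
      rightInvAct k A M b (φ.rTensor A m) := by
    intro b m
    induction m with
    | zero => simp
    | add x y hx hy => simp only [map_add, hx, hy]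
    | tmul l x => simp [rightInvAct_tmul]
  change φ.rTensor A (Algebra.TensorProduct.lift _ _ (rightInvAct_commute f) (comul a) m) =
    Algebra.TensorProduct.lift _ _ (rightInvAct_commute g) (comul a) (φ.rTensor A m)
  generalize (comul a : A ⊗[k] A) = t
  induction t with
  | zero => simp
  | add x y hx hy => simp only [map_add, LinearMap.add_apply, hx, hy]
  | tmul b c => simp [h1, h2]

section Compat

variable (f : A →ₐ[k] Module.End k L)

variable (k A L) in
theorem radfordAux_mul_right :
    toConv (convConst k A (radfordAux k A L)) *
      (toConv (actL (L ⊗[k] A) (Algebra.lmul k A)).toLinearMap *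
      toConv (actR A (rightInvAct k A L)).toLinearMap) =
    toConv (actR A (rightInvAct k A L)).toLinearMap *
      toConv (convConst k A (radfordAux k A L)) := by
  apply WithConv.ext
  apply LinearMap.ext
  intro h
  refine (convConst_mul_apply _ _ _).trans (Eq.trans ?_ (mul_convConst_apply _ _ _).symm)
  refine TensorProduct.ext_threefold fun l a b => ?_
  have h1 : ∀ t : A ⊗[k] A, radfordAux k A L (LinearMap.mul' k _ (TensorProduct.map
      (actL (L ⊗[k] A) (Algebra.lmul k A)).toLinearMap
      (actR A (rightInvAct k A L)).toLinearMap t)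
      ((l ⊗ₜ a) ⊗ₜ b)) = (TensorProduct.assoc k L A A).symm (l ⊗ₜ (comul a *
        LinearMap.mul' k (A ⊗[k] A) (TensorProduct.map (comul ∘ₗ antipodeInv k)
        (Algebra.TensorProduct.includeRight (R := k) (A := A) (B := A)).toLinearMap
        (TensorProduct.comm k A A t)) * (1 ⊗ₜ b))) := by
    intro t
    induction t with
    | zero => simp
    | add x y hx hy =>
      simp only [map_add, LinearMap.add_apply, hx, hy, mul_add, add_mul, TensorProduct.tmul_add]
    | tmul x y => simp [rightInvAct_tmul, radfordAux_tmul, mul_assoc]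
  refine (h1 (comul h)).trans ?_
  rw [comul_antipodeInv_mul]
  change _ = ((rightInvAct k A L h).rTensor A) (radfordAux k A L ((l ⊗ₜ a) ⊗ₜ b))
  rw [radfordAux_tmul]
  generalize (comul a : A ⊗[k] A) = s
  induction s with
  | zero => simp
  | add x y hx hy =>
    simp only [map_add, LinearMap.add_apply, hx, hy, mul_add, add_mul, TensorProduct.tmul_add]
  | tmul x y => simp [rightInvAct_tmul]

theorem radfordAux_mul_left :
    toConv (convConst k A (radfordAux k A L)) *
      toConv (actR A
        (diagAct f (Algebra.lmul k A))).toLinearMap =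
    toConv (actR A
        (diagAct f (Algebra.lmul k A))).toLinearMap *
      toConv (actL (L ⊗[k] A) (Algebra.lmul k A)).toLinearMap *
      toConv (convConst k A (radfordAux k A L)) := by
  apply WithConv.ext
  apply LinearMap.ext
  intro h
  refine (convConst_mul_apply _ _ _).trans (Eq.trans ?_ (mul_convConst_apply _ _ _).symm)
  refine TensorProduct.ext_threefold fun l a b => ?_
  have h1 : ∀ t : A ⊗[k] A, radfordAux k A L
      ((outerAct f (Algebra.lmul k A) t (l ⊗ₜ a)) ⊗ₜ b) =
      outerAct (outerAct f (Algebra.lmul k A)) (Algebra.lmul k A)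
        ((TensorProduct.assoc k A A A).symm (comul.lTensor A t))
        ((TensorProduct.assoc k L A A).symm (l ⊗ₜ (comul a * (1 ⊗ₜ b)))) := by
    intro t
    induction t with
    | zero => simp
    | add x y hx hy => simp only [map_add, LinearMap.add_apply, hx, hy, TensorProduct.add_tmul]
    | tmul p q =>
      simp only [outerAct_tmul, TensorProduct.map_tmul, radfordAux_tmul, LinearMap.lTensor_tmul,
        Algebra.coe_lmul_eq_mul, LinearMap.mul_apply', Bialgebra.comul_mul, mul_assoc]
      generalize (comul a * (1 ⊗ₜ b) : A ⊗[k] A) = s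
      generalize (comul q : A ⊗[k] A) = t
      induction t with
      | zero => simp
      | add x y hx hy =>
        simp only [map_add, LinearMap.add_apply, hx, hy, TensorProduct.tmul_add, add_mul]
      | tmul x y =>
        induction s with
        | zero => simp
        | add x y hx hy =>
          simp only [map_add, LinearMap.add_apply, hx, hy, TensorProduct.tmul_add, mul_add]
        | tmul c d => simp
  have h2 : ∀ (t : A ⊗[k] A), LinearMap.mul' k _ (TensorProduct.map
      (actR A
        (diagAct f (Algebra.lmul k A))).toLinearMap
      (actL (L ⊗[k] A) (Algebra.lmul k A)).toLinearMap t) =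
      outerAct (outerAct f (Algebra.lmul k A)) (Algebra.lmul k A) (comul.rTensor A t) := by
    intro t
    induction t with
    | zero => simp
    | add x y hx hy => simp only [map_add, hx, hy]
    | tmul p q =>
      apply TensorProduct.ext'
      intro x y
      simp [diagAct_apply]
  refine (h1 (comul h)).trans ?_
  rw [coassoc_symm_apply]
  refine Eq.trans ?_ congr($((h2 (comul h)).symm) (radfordAux k A L ((l ⊗ₜ a) ⊗ₜ b)))
  rw [radfordAux_tmul]

theorem radford_compat (a : A) (m : L ⊗[k] A) :
    outerAct (radfordAct f) (Algebra.lmul k A) (comul a) (radfordCoact k A L m) =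
      coactAfter (radfordAct f) (radfordCoact k A L) m (comul a) := by
  let lam := toConv (actL (L ⊗[k] A) (Algebra.lmul k A)).toLinearMap
  let U := toConv (convConst k A (radfordAux k A L))
  let R := toConv (actR A (radfordAct f)).toLinearMap
  have hR : R = toConv (actR A
      (rightInvAct k A L)).toLinearMap * toConv (actR A
        (diagAct f (Algebra.lmul k A))).toLinearMap := by
    refine Eq.trans ?_ (conv_comp (Module.End.rTensorAlgHom k (L ⊗[k] A) A)
      (rightInvAct k A L).toLinearMap (diagAct f (Algebra.lmul k A)).toLinearMap)
    rw [← toConv_convHom _ _ (rightInvAct_commute f)]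
    rfl
  have key : U * (lam * R) = R * lam * U := by
    rw [hR, ← mul_assoc, ← mul_assoc, mul_assoc U, radfordAux_mul_right, mul_assoc,
      radfordAux_mul_left]
    simp only [mul_assoc, lam, U]
  have h1 : ∀ (t : A ⊗[k] A) s, outerAct (radfordAct f) (Algebra.lmul k A) t s =
      LinearMap.mul' k _ (TensorProduct.map R.ofConv lam.ofConv t) s := by
    intro t s
    congr 1
    induction t with
    | zero => simp
    | add x y hx hy => simp only [map_add, hx, hy]
    | tmul p q =>
      apply TensorProduct.ext'
      intro x y
      simp [R, lam]
  have h2 : ∀ (t : A ⊗[k] A), coactAfter (radfordAct f) (radfordCoact k A L) m t =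
      radfordAux k A L (LinearMap.mul' k _ (TensorProduct.map lam.ofConv R.ofConv t)
        (m ⊗ₜ 1)) := by
    intro t
    induction t with
    | zero => simp
    | add x y hx hy => simp only [map_add, LinearMap.add_apply, hx, hy]
    | tmul p q =>
      rw [coactAfter_tmul, ← radfordAux_tmul_one]
      have : ∀ (x : L ⊗[k] A) (b c : A), (LinearMap.mulRight k c).lTensor (L ⊗[k] A)
          (radfordAux k A L (x ⊗ₜ b)) = radfordAux k A L (x ⊗ₜ (b * c)) := by
        intro x b c
        simp only [radfordAux, LinearMap.comp_apply, LinearMap.rTensor_tmul]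
        generalize radfordCoact k A L x = s
        induction s with
        | zero => simp
        | add x y hx hy => simp only [map_add, TensorProduct.add_tmul, hx, hy]
        | tmul a c => simp [mul_assoc]
      rw [this]
      simp [R, lam]
  rw [h1, h2, ← radfordAux_tmul_one]
  have e1 := congr(($key).ofConv a (m ⊗ₜ 1))
  have e2 := congr($(mul_convConst_apply (radfordAux k A L) (R * lam) a) (m ⊗ₜ 1))
  have e3 := congr($(convConst_mul_apply (radfordAux k A L) (lam * R) a) (m ⊗ₜ 1))
  exact e2.symm.trans (e1.symm.trans e3)

end Compat

variable (k A) in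
/-- Radford's induction functor: `L ↦ L ⊗ A`, with the action
`h (l ⊗ a) = ∑ h₂ l ⊗ h₃ a S⁻¹(h₁)` and the coaction `l ⊗ a ↦ ∑ l ⊗ a₁ ⊗ a₂`. -/
def radford : LMod k A ⥤ YD k A where
  obj L :=
    { toLMod := ⟨ModuleCat.of k (L.V ⊗[k] A), radfordAct L.act⟩
      coact := radfordCoact k A L.V
      coassoc := radfordCoact_coassoc
      counit_coact := radfordCoact_counit
      compat := radford_compat L.act }
  map {L M} f :=
    { hom := ⟨ModuleCat.ofHom (f.hom.hom.rTensor A), fun a m => by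
        refine radfordAct_natural f.comm a m⟩
      comm := radfordCoact_natural f.hom.hom }
  map_id L := YD.hom_ext (LMod.hom_ext (ModuleCat.hom_ext (LinearMap.rTensor_id A L.V)))
  map_comp f g := YD.hom_ext (LMod.hom_ext (ModuleCat.hom_ext
    (LinearMap.rTensor_comp A g.hom.hom f.hom.hom)))

end Radford
end HopfCat

namespace HopfCat
open Coalgebra Bialgebra HopfAlgebra

section Dual

open WithConv

/-- The dual algebra `A*` of a coalgebra `A`, with the product `(p q)(a) = ∑ p(a₁) q(a₂)`. -/
def DualAlg (k : Type u) [Field k] (A : Type u) [Ring A] [Bialgebra k A] : Type u :=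
  WithConv (A →ₗ[k] k)

section

variable {k : Type u} [Field k] {A : Type u} [Ring A] [Bialgebra k A]

instance : Ring (DualAlg k A) := inferInstanceAs (Ring (WithConv (A →ₗ[k] k)))
instance : Algebra k (DualAlg k A) := inferInstanceAs (Algebra k (WithConv (A →ₗ[k] k)))

/-- An element of the dual algebra as a linear form. -/
def dualEv : DualAlg k A ≃ₗ[k] (A →ₗ[k] k) where
  toFun p := WithConv.ofConv p
  invFun p := WithConv.toConv p
  map_add' _ _ := rfl
  map_smul' _ _ := rfl
  left_inv _ := rfl
  right_inv _ := rfl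

@[ext] theorem DualAlg.ext {p q : DualAlg k A} (h : ∀ a, dualEv p a = dualEv q a) : p = q :=
  dualEv.injective (LinearMap.ext h)

theorem dualEv_mul (p q : DualAlg k A) (a : A) : dualEv (p * q) a =
    LinearMap.mul' k k (TensorProduct.map (dualEv p) (dualEv q) (comul a)) := rfl

@[simp] theorem dualEv_one (a : A) : dualEv (1 : DualAlg k A) a = counit a := rfl

end

variable (k : Type u) [Field k] (A : Type u) [Ring A] [Bialgebra k A]

/-- The map which sends `a` and `p` to `x ↦ p(a x)`. -/
def dualPre : A →ₗ[k] Module.End k (DualAlg k A) :=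
  LinearMap.mk₂ k (fun a p => dualEv.symm ((dualEv p) ∘ₗ LinearMap.mulLeft k a))
    (fun a b p => by ext x; simp [add_mul]) (fun c a p => by ext x; simp)
    (fun a p q => by ext x; simp) (fun c a p => by ext x; simp)

/-- The map which sends `a` and `p` to `x ↦ p(x a)`. -/
def dualPost : A →ₗ[k] Module.End k (DualAlg k A) :=
  LinearMap.mk₂ k (fun a p => dualEv.symm ((dualEv p) ∘ₗ LinearMap.mulRight k a))
    (fun a b p => by ext x; simp [mul_add]) (fun c a p => by ext x; simp)
    (fun a p q => by ext x; simp) (fun c a p => by ext x; simp)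

variable {k A}

@[simp] theorem dualPre_apply (a : A) (p : DualAlg k A) (x : A) :
    (dualEv (dualPre k A a p)) x = dualEv p (a * x) := rfl

@[simp] theorem dualPost_apply (a : A) (p : DualAlg k A) (x : A) :
    (dualEv (dualPost k A a p)) x = dualEv p (x * a) := rfl

variable (k A) in
/-- The action of `A` on `A*` with `(a p)(x) = p(x a)`. -/
def dualPostAct : A →ₐ[k] Module.End k (DualAlg k A) :=
  AlgHom.ofLinearMap (dualPost k A) (by ext; simp) (fun a b => by ext; simp [mul_assoc])

@[simp] theorem dualPostAct_apply (a : A) (p : DualAlg k A) :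
    dualPostAct k A a p = dualPost k A a p := rfl

/-- For a map `i` from `A` and a map `j` from `A*` to an algebra, the condition
`∑ i(a₁) j(p(a₂ -)) = ∑ j(p(- a₁)) i(a₂)`. -/
def CrossRel {E : Type u} [Semiring E] [Algebra k E] (i : A →ₗ[k] E) (j : DualAlg k A →ₗ[k] E) :
    Prop :=
  ∀ p : DualAlg k A, toConv i * toConv (j ∘ₗ (dualPre k A).flip p) =
    toConv (j ∘ₗ (dualPost k A).flip p) * toConv i

/-- The map `p ⊗ a ↦ j(p) i(a)`. -/
def prodMap {E : Type u} [Semiring E] [Algebra k E] (i : A →ₗ[k] E) (j : DualAlg k A →ₗ[k] E) :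
    DualAlg k A ⊗[k] A →ₗ[k] E :=
  LinearMap.mul' k E ∘ₗ TensorProduct.map j i

@[simp] theorem prodMap_tmul {E : Type u} [Semiring E] [Algebra k E] (i : A →ₗ[k] E)
    (j : DualAlg k A →ₗ[k] E) (p : DualAlg k A) (a : A) : prodMap i j (p ⊗ₜ a) = j p * i a := by
  simp [prodMap]

theorem CrossRel.comp {E E' : Type u} [Semiring E] [Algebra k E] [Semiring E'] [Algebra k E']
    {i : A →ₗ[k] E} {j : DualAlg k A →ₗ[k] E} (h : CrossRel i j) (f : E →ₐ[k] E') :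
    CrossRel (f.toLinearMap ∘ₗ i) (f.toLinearMap ∘ₗ j) := by
  intro p
  have := congr(toConv (f.toLinearMap ∘ₗ ($(h p)).ofConv))
  rw [conv_comp f, conv_comp f] at this
  exact this

theorem CrossRel.of_comp {E E' : Type u} [Semiring E] [Algebra k E] [Semiring E'] [Algebra k E']
    {i : A →ₗ[k] E} {j : DualAlg k A →ₗ[k] E} (f : E →ₐ[k] E') (hf : Function.Injective f)
    (h : CrossRel (f.toLinearMap ∘ₗ i) (f.toLinearMap ∘ₗ j)) : CrossRel i j := by
  intro p
  have := h p
  rw [LinearMap.comp_assoc, LinearMap.comp_assoc, ← conv_comp f, ← conv_comp f] at this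
  ext a
  exact hf congr(($this).ofConv a)

theorem conv_transfer {E X : Type u} [Semiring E] [Algebra k E] [AddCommGroup X] [Module k X]
    (i : A →ₗ[k] E) (P : X →ₗ[k] E) (F G H : WithConv (A →ₗ[k] Module.End k X))
    (h : ∀ a x, P (F.ofConv a x) =
      (toConv i * toConv (P ∘ₗ LinearMap.applyₗ x ∘ₗ G.ofConv)).ofConv a) (a : A) (x : X) :
    P ((F * H).ofConv a x) =
      (toConv i * toConv (P ∘ₗ LinearMap.applyₗ x ∘ₗ (G * H).ofConv)).ofConv a := by
  let W : A ⊗[k] (A ⊗[k] A) →ₗ[k] E := LinearMap.mul' k E ∘ₗ TensorProduct.map i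
    (P ∘ₗ LinearMap.applyₗ x ∘ₗ LinearMap.mul' k _ ∘ₗ TensorProduct.map G.ofConv H.ofConv)
  have h1 : ∀ t : A ⊗[k] A, P (LinearMap.mul' k _ (TensorProduct.map F.ofConv H.ofConv t) x) =
      W (TensorProduct.assoc k A A A (comul.rTensor A t)) := by
    intro t
    induction t with
    | zero => simp
    | add x y hx hy => simp only [map_add, LinearMap.add_apply, hx, hy]
    | tmul b c =>
      rw [TensorProduct.map_tmul, LinearMap.mul'_apply, Module.End.mul_apply, h,
        LinearMap.rTensor_tmul]
      have : ∀ s : A ⊗[k] A, LinearMap.mul' k E (TensorProduct.map i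
          (P ∘ₗ LinearMap.applyₗ (H.ofConv c x) ∘ₗ G.ofConv) s) =
          W (TensorProduct.assoc k A A A (s ⊗ₜ c)) := by
        intro s
        induction s with
        | zero => simp
        | add x y hx hy => simp only [map_add, TensorProduct.add_tmul, hx, hy]
        | tmul b d => simp [W]
      exact this (comul b)
  have h2 : ∀ t : A ⊗[k] A, LinearMap.mul' k E (TensorProduct.map i
      (P ∘ₗ LinearMap.applyₗ x ∘ₗ (G * H).ofConv) t) = W (comul.lTensor A t) := by
    intro t
    induction t with
    | zero => simp
    | add x y hx hy => simp only [map_add, hx, hy]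
    | tmul b c => simp [W]
  exact (h1 (comul a)).trans ((congrArg W (coassoc_apply a)).trans (h2 (comul a)).symm)

end Dual

section Double

open WithConv

variable (k : Type u) [Field k] (A : Type u) [Ring A] [HopfAlgebra k A] [HasBijectiveAntipode k A]

/-- The action of `A` on `A*` with `(a p)(x) = p(S⁻¹(a) x)`. -/
def dualPreInvAct : A →ₐ[k] Module.End k (DualAlg k A) :=
  AlgHom.ofLinearMap (dualPre k A ∘ₗ antipodeInv k) (by ext; simp [antipodeInv_one])
    (fun a b => by ext; simp [antipodeInv_mul, mul_assoc])

variable {k A}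

@[simp] theorem dualPreInvAct_apply (a : A) (p : DualAlg k A) :
    dualPreInvAct k A a p = dualPre k A (antipodeInv k a) p := rfl

variable (k A)

theorem doubleLeft_aux (a b : A) : Commute (actL (DualAlg k A) (Algebra.lmul k A) a)
    (actR A (dualPreInvAct k A) b) := by
  apply TensorProduct.ext'
  intro p x
  simp

/-- The action `a (p ⊗ b) = ∑ p(S⁻¹(a₂) -) ⊗ a₁ b`. -/
def doubleLeft₂ : A →ₐ[k] Module.End k (DualAlg k A ⊗[k] A) :=
  convHom (actL (DualAlg k A) (Algebra.lmul k A)) (actR A (dualPreInvAct k A))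
    (doubleLeft_aux k A)

theorem doubleLeft_aux' (a b : A) : Commute (actR A (dualPostAct k A) a) (doubleLeft₂ k A b) := by
  have : ∀ t : A ⊗[k] A, Commute (actR A (dualPostAct k A) a)
      (Algebra.TensorProduct.lift _ _ (doubleLeft_aux k A) t) := by
    intro t
    induction t with
    | zero => simp
    | add x y hx hy => rw [map_add]; exact hx.add_right hy
    | tmul c d =>
      rw [Algebra.TensorProduct.lift_tmul]
      apply TensorProduct.ext'
      intro p x
      simp only [Module.End.mul_apply, actR_tmul, actL_tmul, dualPostAct_apply,
        dualPreInvAct_apply]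
      congr 1
      ext y
      simp [mul_assoc]
  exact this (comul b)

/-- The action `a (p ⊗ b) = ∑ p(S⁻¹(a₃) - a₁) ⊗ a₂ b`. -/
def doubleLeft : A →ₐ[k] Module.End k (DualAlg k A ⊗[k] A) :=
  convHom (actR A (dualPostAct k A)) (doubleLeft₂ k A) (doubleLeft_aux' k A)

theorem toConv_doubleLeft : toConv (doubleLeft k A).toLinearMap =
    toConv (actR A (dualPostAct k A)).toLinearMap *
      toConv (actL (DualAlg k A) (Algebra.lmul k A)).toLinearMap *
        toConv (actR A (dualPreInvAct k A)).toLinearMap := by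
  rw [doubleLeft, toConv_convHom, doubleLeft₂, toConv_convHom, mul_assoc]

variable {k A}

theorem dualPre_conv : toConv ((Module.End.rTensorAlgHom k (DualAlg k A) A).toLinearMap ∘ₗ
    dualPre k A) * toConv (actR A (dualPreInvAct k A)).toLinearMap = 1 := by
  have : toConv (dualPre k A) * toConv (dualPreInvAct k A).toLinearMap = 1 := by
    refine WithConv.ext (LinearMap.ext fun a => LinearMap.ext fun p => DualAlg.ext fun x => ?_)
    have : ∀ t : A ⊗[k] A, dualEv (LinearMap.mul' k _ (TensorProduct.map (dualPre k A)
        (dualPreInvAct k A).toLinearMap t) p) x = dualEv p (LinearMap.mul' k A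
        (TensorProduct.map (antipodeInv k) LinearMap.id (TensorProduct.comm k A A t)) * x) := by
      intro t
      induction t with
      | zero => simp
      | add x y hx hy =>
        simp only [map_add, LinearMap.add_apply, hx, hy, add_mul, ofConv_add]
      | tmul c d => simp [mul_assoc]
    refine (this (comul a)).trans ?_
    rw [antipodeInv_mul_comul]
    change _ = dualEv ((algebraMap k (Module.End k (DualAlg k A)) (counit a)) p) x
    simp [Module.algebraMap_end_apply, Algebra.algebraMap_eq_smul_one]
  have h := conv_comp (Module.End.rTensorAlgHom k (DualAlg k A) A) (dualPre k A)
    (dualPreInvAct k A).toLinearMap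
  rw [this, conv_one_comp] at h
  exact h.symm

theorem prodMap_linear {E : Type u} [Semiring E] [Algebra k E] (i : A →ₐ[k] E)
    (j : DualAlg k A →ₗ[k] E) (h : CrossRel i.toLinearMap j) (a : A) (x : DualAlg k A ⊗[k] A) :
    prodMap i.toLinearMap j (doubleLeft k A a x) = i a * prodMap i.toLinearMap j x := by
  have h1 := conv_transfer i.toLinearMap (prodMap i.toLinearMap j)
    (toConv (actR A (dualPostAct k A)).toLinearMap *
      toConv (actL (DualAlg k A) (Algebra.lmul k A)).toLinearMap)
    (toConv ((Module.End.rTensorAlgHom k (DualAlg k A) A).toLinearMap ∘ₗ dualPre k A))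
    (toConv (actR A (dualPreInvAct k A)).toLinearMap) (by
      intro a x
      induction x with
      | zero =>
        have : (prodMap i.toLinearMap j ∘ₗ LinearMap.applyₗ (0 : DualAlg k A ⊗[k] A) ∘ₗ
          (toConv ((Module.End.rTensorAlgHom k (DualAlg k A) A).toLinearMap ∘ₗ
            dualPre k A)).ofConv) = 0 := by ext; simp
        rw [this, map_zero, map_zero, toConv_zero, mul_zero]; rfl
      | add x y hx hy =>
        rw [map_add, map_add, hx, hy, map_add, LinearMap.add_comp, LinearMap.comp_add, toConv_add,
          mul_add]
        rfl
      | tmul p b =>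
        have e := congr(($(h p)).ofConv a * i b)
        have e1 : ∀ t : A ⊗[k] A, prodMap i.toLinearMap j (LinearMap.mul' k _ (TensorProduct.map
            (actR A (dualPostAct k A)).toLinearMap
            (actL (DualAlg k A) (Algebra.lmul k A)).toLinearMap t) (p ⊗ₜ b)) =
            LinearMap.mul' k E (TensorProduct.map (j ∘ₗ (dualPost k A).flip p) i.toLinearMap t) *
              i b := by
          intro t
          induction t with
          | zero => simp
          | add x y hx hy => simp only [map_add, LinearMap.add_apply, hx, hy, add_mul]
          | tmul c d => simp [mul_assoc]
        have e2 : ∀ t : A ⊗[k] A, LinearMap.mul' k E (TensorProduct.map i.toLinearMap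
            (prodMap i.toLinearMap j ∘ₗ LinearMap.applyₗ (p ⊗ₜ b) ∘ₗ
            (Module.End.rTensorAlgHom k (DualAlg k A) A).toLinearMap ∘ₗ dualPre k A) t) =
            LinearMap.mul' k E (TensorProduct.map i.toLinearMap (j ∘ₗ (dualPre k A).flip p) t) *
              i b := by
          intro t
          induction t with
          | zero => simp
          | add x y hx hy => simp only [map_add, hx, hy, add_mul]
          | tmul c d =>
            have : ∀ f : Module.End k (DualAlg k A),
              (Module.End.rTensorAlgHom k (DualAlg k A) A) f (p ⊗ₜ b) = f p ⊗ₜ b := fun _ => rfl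
            simp only [TensorProduct.map_tmul, LinearMap.comp_apply, LinearMap.mul'_apply,
              AlgHom.toLinearMap_apply, LinearMap.applyₗ_apply_apply, this, prodMap_tmul,
              LinearMap.flip_apply, mul_assoc]
        exact (e1 (comul a)).trans (e.symm.trans (e2 (comul a)).symm)) a x
  rw [← toConv_doubleLeft, dualPre_conv] at h1
  refine h1.trans ?_
  have : prodMap i.toLinearMap j ∘ₗ LinearMap.applyₗ x ∘ₗ
      (1 : WithConv (A →ₗ[k] Module.End k (DualAlg k A ⊗[k] A))).ofConv =
      convConst k A (prodMap i.toLinearMap j x) := by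
    ext b
    change prodMap i.toLinearMap j (algebraMap k (Module.End k _) (counit b) x) = _
    simp [Module.algebraMap_end_apply, convConst]
  rw [this, mul_convConst_apply]
  rfl

end Double
end HopfCat

namespace HopfCat
open Coalgebra Bialgebra HopfAlgebra

section DoubleAlgebra

open WithConv

section

variable {k : Type u} [Field k] {A : Type u} [Ring A] [Bialgebra k A]

theorem dualPost_conv (q : DualAlg k A) :
    toConv (dualPostAct k A).toLinearMap *
      toConv (convConst k A (Algebra.lmul k (DualAlg k A) q)) =
    toConv ((Algebra.lmul k (DualAlg k A)).toLinearMap ∘ₗ (dualPost k A).flip q) *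
      toConv (dualPostAct k A).toLinearMap := by
  apply WithConv.ext
  apply LinearMap.ext
  intro a
  rw [mul_convConst_apply]
  refine LinearMap.ext fun p => DualAlg.ext fun x => ?_
  have e0 : ∀ (c d : A) (s : A ⊗[k] A), LinearMap.mul' k k (TensorProduct.map
      (dualEv (dualPost k A c q)) (dualEv (dualPost k A d p)) s) = LinearMap.mul' k k
      (TensorProduct.map (dualEv q) (dualEv p) (s * (c ⊗ₜ d))) := by
    intro c d s
    induction s with
    | zero => simp
    | add x y hx hy => simp only [map_add, add_mul, hx, hy]
    | tmul c d => simp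
  have e1 : ∀ t : A ⊗[k] A, dualEv (LinearMap.mul' k _ (TensorProduct.map
      ((Algebra.lmul k (DualAlg k A)).toLinearMap ∘ₗ (dualPost k A).flip q)
      (dualPostAct k A).toLinearMap t) p) x =
      LinearMap.mul' k k (TensorProduct.map (dualEv q) (dualEv p) (comul x * t)) := by
    intro t
    induction t with
    | zero => simp
    | add x y hx hy => simp only [map_add, LinearMap.add_apply, mul_add, hx, hy]
    | tmul c d =>
      simp [e0, dualEv_mul]
  refine Eq.trans ?_ (e1 (comul a)).symm
  rw [← Bialgebra.comul_mul]
  rfl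

variable (k A) in
/-- The action of `A*` on `A* ⊗ A` by left multiplication on the first factor. -/
def doubleDual : DualAlg k A →ₐ[k] Module.End k (DualAlg k A ⊗[k] A) :=
  actR A (Algebra.lmul k (DualAlg k A))

@[simp] theorem doubleDual_tmul (p q : DualAlg k A) (a : A) :
    doubleDual k A p (q ⊗ₜ a) = (p * q) ⊗ₜ a := rfl

theorem convConst_actR (q : DualAlg k A) : convConst k A (doubleDual k A q) =
    (Module.End.rTensorAlgHom k (DualAlg k A) A).toLinearMap ∘ₗ
      convConst k A (Algebra.lmul k (DualAlg k A) q) := by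
  ext a : 1
  simp only [convConst, LinearMap.smulRight_apply, LinearMap.comp_apply, map_smul]
  rfl

theorem doubleDual_comp (f : A →ₗ[k] DualAlg k A) : (doubleDual k A).toLinearMap ∘ₗ f =
    (Module.End.rTensorAlgHom k (DualAlg k A) A).toLinearMap ∘ₗ
      ((Algebra.lmul k (DualAlg k A)).toLinearMap ∘ₗ f) := rfl

theorem actR_eq (f : A →ₐ[k] Module.End k (DualAlg k A)) : (actR A f).toLinearMap =
    (Module.End.rTensorAlgHom k (DualAlg k A) A).toLinearMap ∘ₗ f.toLinearMap := rfl

theorem doubleDual_lmul (q : DualAlg k A) :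
    toConv (actL (DualAlg k A) (Algebra.lmul k A)).toLinearMap *
      toConv (convConst k A (doubleDual k A q)) =
      toConv (convConst k A (doubleDual k A q)) *
        toConv (actL (DualAlg k A) (Algebra.lmul k A)).toLinearMap := by
  apply WithConv.ext
  apply LinearMap.ext
  intro a
  rw [mul_convConst_apply, convConst_mul_apply]
  apply TensorProduct.ext'
  intro p b
  rfl

theorem mul_five {M : Type u} [Monoid M] {a b c r s l : M} (h1 : c * r = l * c) (h2 : b * l = l * b)
    (h3 : a * l = s * a) : a * b * c * r = s * (a * b * c) := by
  rw [mul_assoc, h1, mul_assoc, ← mul_assoc b, h2, mul_assoc, ← mul_assoc, h3]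
  simp only [mul_assoc]

theorem doubleDual_post (q : DualAlg k A) : toConv (actR A (dualPostAct k A)).toLinearMap *
      toConv (convConst k A (doubleDual k A q)) =
      toConv ((doubleDual k A).toLinearMap ∘ₗ (dualPost k A).flip q) *
        toConv (actR A (dualPostAct k A)).toLinearMap := by
  rw [actR_eq, doubleDual_comp, convConst_actR, ← conv_comp, ← conv_comp, dualPost_conv]

end

variable {k : Type u} [Field k] {A : Type u} [Ring A] [HopfAlgebra k A] [HasBijectiveAntipode k A]

theorem dualPreInv_conv (q : DualAlg k A) :
    toConv (dualPreInvAct k A).toLinearMap *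
      toConv ((Algebra.lmul k (DualAlg k A)).toLinearMap ∘ₗ (dualPre k A).flip q) =
    toConv (convConst k A (Algebra.lmul k (DualAlg k A) q)) *
      toConv (dualPreInvAct k A).toLinearMap := by
  apply WithConv.ext
  apply LinearMap.ext
  intro a
  rw [convConst_mul_apply]
  refine LinearMap.ext fun p => DualAlg.ext fun x => ?_
  have e0 : ∀ (d : A) (s : A ⊗[k] A), LinearMap.mul' k k (TensorProduct.map
      (dualEv (dualPre k A d q)) (dualEv p) s) = LinearMap.mul' k k (TensorProduct.map
      (dualEv q) (dualEv p) ((d ⊗ₜ 1) * s)) := by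
    intro d s
    induction s with
    | zero => simp
    | add x y hx hy => simp only [map_add, mul_add, hx, hy]
    | tmul c d => simp
  have e1 : ∀ t : A ⊗[k] A, dualEv (LinearMap.mul' k _ (TensorProduct.map
      (dualPreInvAct k A).toLinearMap
      ((Algebra.lmul k (DualAlg k A)).toLinearMap ∘ₗ (dualPre k A).flip q) t) p) x =
      LinearMap.mul' k k (TensorProduct.map (dualEv q) (dualEv p) (LinearMap.mul' k (A ⊗[k] A)
    (TensorProduct.map
      (Algebra.TensorProduct.includeLeft (R := k) (S := k) (A := A) (B := A)).toLinearMap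
      (comul ∘ₗ antipodeInv k)
      (TensorProduct.comm k A A t)) * comul x)) := by
    intro t
    induction t with
    | zero => simp
    | add x y hx hy => simp only [map_add, LinearMap.add_apply, add_mul, hx, hy]
    | tmul c d =>
      simp [e0, dualEv_mul, mul_assoc]
  refine (e1 (comul a)).trans ?_
  rw [mul_comul_antipodeInv]
  change _ = LinearMap.mul' k k (TensorProduct.map (dualEv q) (dualEv (dualPre k A (antipodeInv k a) p))
    (comul x))
  generalize (comul x : A ⊗[k] A) = s
  induction s with
  | zero => simp
  | add x y hx hy => simp only [map_add, mul_add, hx, hy]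
  | tmul c d => simp

theorem doubleDual_preInv (q : DualAlg k A) : toConv (actR A (dualPreInvAct k A)).toLinearMap *
      toConv ((doubleDual k A).toLinearMap ∘ₗ (dualPre k A).flip q) =
      toConv (convConst k A (doubleDual k A q)) *
        toConv (actR A (dualPreInvAct k A)).toLinearMap := by
  rw [actR_eq, doubleDual_comp, convConst_actR, ← conv_comp, ← conv_comp, dualPreInv_conv]

theorem crossRel_doubleLeft :
    CrossRel (doubleLeft k A).toLinearMap (doubleDual k A).toLinearMap := by
  intro q
  rw [toConv_doubleLeft]
  exact mul_five (doubleDual_preInv q) (doubleDual_lmul q) (doubleDual_post q)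

theorem doubleLeft_one (a b : A) : doubleLeft k A a (1 ⊗ₜ b) = 1 ⊗ₜ (a * b) := by
  have h1 : ∀ a b : A, actR A (dualPreInvAct k A) a (1 ⊗ₜ b) =
      counit (R := k) a • ((1 : DualAlg k A) ⊗ₜ b) := by
    intro a b
    rw [actR_tmul, TensorProduct.smul_tmul']
    congr 1
    ext x
    have : counit (R := k) (antipodeInv k a) = counit a := by
      rw [← counit_antipode, antipode_antipodeInv]
    simp [LinearMap.convOne_apply, this]
  have h2 : ∀ a b : A, actR A (dualPostAct k A) a (1 ⊗ₜ b) =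
      counit (R := k) a • ((1 : DualAlg k A) ⊗ₜ b) := by
    intro a b
    rw [actR_tmul, TensorProduct.smul_tmul']
    congr 1
    ext x
    simp [mul_comm]
  have h3 : ∀ a b : A, doubleLeft₂ k A a (1 ⊗ₜ b) = 1 ⊗ₜ (a * b) := by
    intro a b
    have : ∀ t : A ⊗[k] A, Algebra.TensorProduct.lift _ _ (doubleLeft_aux k A) t (1 ⊗ₜ b) =
        1 ⊗ₜ[k] (TensorProduct.rid k A (counit.lTensor A t) * b) := by
      intro t
      induction t with
      | zero => simp
      | add x y hx hy =>
        simp only [map_add, LinearMap.add_apply, TensorProduct.tmul_add, add_mul, hx, hy]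
      | tmul c d =>
        rw [Algebra.TensorProduct.lift_tmul, Module.End.mul_apply, h1]
        simp
    refine (this (comul a)).trans ?_
    rw [lTensor_counit_comul]
    simp
  have : ∀ t : A ⊗[k] A, Algebra.TensorProduct.lift _ _ (doubleLeft_aux' k A) t (1 ⊗ₜ b) =
      1 ⊗ₜ[k] (TensorProduct.lid k A (counit.rTensor A t) * b) := by
    intro t
    induction t with
    | zero => simp
    | add x y hx hy =>
      simp only [map_add, LinearMap.add_apply, TensorProduct.tmul_add, add_mul, hx, hy]
    | tmul c d =>
      rw [Algebra.TensorProduct.lift_tmul, Module.End.mul_apply, h3, h2]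
      simp
  refine (this (comul a)).trans ?_
  rw [rTensor_counit_comul]
  simp

end DoubleAlgebra

section Double

open WithConv

/-- The underlying space `A* ⊗ A` of the Drinfel'd double of `A`. -/
def Double (k : Type u) [Field k] (A : Type u) [Ring A] [HopfAlgebra k A]
    [HasBijectiveAntipode k A] : Type u :=
  DualAlg k A ⊗[k] A

namespace Double

variable (k : Type u) [Field k] (A : Type u) [Ring A] [HopfAlgebra k A] [HasBijectiveAntipode k A]

instance : AddCommGroup (Double k A) := inferInstanceAs (AddCommGroup (DualAlg k A ⊗[k] A))
instance : Module k (Double k A) := inferInstanceAs (Module k (DualAlg k A ⊗[k] A))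

/-- The element `p ⊗ a` of the Drinfel'd double. -/
def mk : DualAlg k A →ₗ[k] A →ₗ[k] Double k A := TensorProduct.mk k (DualAlg k A) A

/-- Left multiplication in the Drinfel'd double: the product of `p ⊗ a` and `q ⊗ b` is
`∑ p q(S⁻¹(a₃) - a₁) ⊗ a₂ b`. -/
def mulLin : Double k A →ₗ[k] Module.End k (Double k A) :=
  prodMap (doubleLeft k A).toLinearMap (doubleDual k A).toLinearMap

instance : Mul (Double k A) := ⟨fun x y => mulLin k A x y⟩
instance : One (Double k A) := ⟨mk k A 1 1⟩

variable {k A}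

theorem mul_def (x y : Double k A) : x * y = mulLin k A x y := rfl
theorem one_def : (1 : Double k A) = mk k A 1 1 := rfl

theorem induction {motive : Double k A → Prop} (x : Double k A) (zero : motive 0)
    (add : ∀ x y, motive x → motive y → motive (x + y)) (mk : ∀ p a, motive (mk k A p a)) :
    motive x := by
  induction x using TensorProduct.induction_on with
  | zero => exact zero
  | add x y hx hy => exact add x y hx hy
  | tmul p a => exact mk p a

theorem mulLin_mk (p : DualAlg k A) (a : A) :
    mulLin k A (mk k A p a) = (doubleDual k A p * doubleLeft k A a : Module.End k (_ ⊗[k] A)) :=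
  prodMap_tmul _ _ p a

theorem mulLin_doubleDual (p : DualAlg k A) (x : DualAlg k A ⊗[k] A) :
    prodMap (doubleLeft k A).toLinearMap (doubleDual k A).toLinearMap (doubleDual k A p x) =
      doubleDual k A p * prodMap (doubleLeft k A).toLinearMap (doubleDual k A).toLinearMap x := by
  induction x with
  | zero => simp
  | add x y hx hy => simp only [map_add, mul_add, hx, hy]
  | tmul q a => simp [mul_assoc]

theorem mulLin_mul (x y : Double k A) : mulLin k A (mulLin k A x y) =
    mulLin k A x * mulLin k A y := by
  induction x using Double.induction with
  | zero => simp
  | add x y hx hy => simp only [map_add, LinearMap.add_apply, add_mul, hx, hy]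
  | mk p a =>
    rw [mulLin_mk]
    refine (mulLin_doubleDual p _).trans ?_
    have := prodMap_linear (doubleLeft k A) (doubleDual k A).toLinearMap crossRel_doubleLeft a y
    exact congrArg (doubleDual k A p * ·) this

theorem mulLin_mk_one (p : DualAlg k A) (a : A) (b : A) :
    mulLin k A (mk k A p a) (mk k A 1 b) = mk k A p (a * b) := by
  rw [mulLin_mk]
  refine (congrArg (doubleDual k A p) (doubleLeft_one a b)).trans ?_
  rw [doubleDual_tmul, mul_one]
  rfl

theorem mulLin_one (x : Double k A) : mulLin k A x 1 = x := by
  induction x using Double.induction with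
  | zero => simp
  | add x y hx hy => simp only [map_add, LinearMap.add_apply, hx, hy]
  | mk p a => rw [one_def, mulLin_mk_one, mul_one]

theorem one_mulLin : mulLin k A 1 = 1 := by
  rw [one_def, mulLin_mk, map_one, map_one, one_mul]
  rfl

instance : Ring (Double k A) where
  mul_assoc x y z := by simp only [mul_def, mulLin_mul]; rfl
  one_mul x := by rw [mul_def, one_mulLin]; rfl
  mul_one x := mulLin_one x
  left_distrib x y z := by simp only [mul_def, map_add]
  right_distrib x y z := by simp only [mul_def, map_add, LinearMap.add_apply]
  zero_mul x := by simp only [mul_def, map_zero, LinearMap.zero_apply]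
  mul_zero x := by simp only [mul_def, map_zero]
  zsmul := zsmulRec
  neg_add_cancel := neg_add_cancel

instance : Algebra k (Double k A) :=
  Algebra.ofModule (fun r x y => by simp only [mul_def, map_smul, LinearMap.smul_apply])
    (fun r x y => by simp only [mul_def, map_smul])

variable (k A) in
/-- The embedding `a ↦ ε ⊗ a` of `A` into its double. -/
def incl : A →ₐ[k] Double k A :=
  AlgHom.ofLinearMap (mk k A 1) rfl (fun a b => (mulLin_mk_one 1 a b).symm)

variable (k A) in
/-- The embedding `p ↦ p ⊗ 1` of `A*` into the double of `A`. -/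
def inclDual : DualAlg k A →ₐ[k] Double k A :=
  AlgHom.ofLinearMap ((mk k A).flip 1) rfl (fun p q => by
    refine Eq.symm ?_
    rw [mul_def]
    refine congr($(mulLin_mk p 1) (mk k A q 1)).trans ?_
    rw [map_one, mul_one]
    rfl)

theorem mk_eq (p : DualAlg k A) (a : A) : mk k A p a = inclDual k A p * incl k A a := by
  refine Eq.symm ?_
  rw [mul_def]
  refine (mulLin_mk_one p 1 a).trans ?_
  rw [one_mul]

variable (k A) in
/-- The defining relation between `A` and `A*` in the double. -/
theorem crossRel_incl : CrossRel (incl k A).toLinearMap (inclDual k A).toLinearMap := by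
  apply CrossRel.of_comp (Algebra.lmul k (Double k A))
  · intro x y h
    have := congr($h 1)
    simpa using this
  · have h1 : (Algebra.lmul k (Double k A)).toLinearMap ∘ₗ (incl k A).toLinearMap =
        (doubleLeft k A).toLinearMap := by
      ext a : 1
      refine (mulLin_mk 1 a).trans ?_
      rw [map_one, one_mul]
      rfl
    have h2 : (Algebra.lmul k (Double k A)).toLinearMap ∘ₗ (inclDual k A).toLinearMap =
        (doubleDual k A).toLinearMap := by
      ext p : 1
      refine (mulLin_mk p 1).trans ?_
      rw [map_one, mul_one]
      rfl
    rw [h1, h2]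
    exact crossRel_doubleLeft

/-- The homomorphism of algebras from the double which is given by `i` on `A` and `j` on `A*`. -/
def lift {E : Type u} [Semiring E] [Algebra k E] (i : A →ₐ[k] E) (j : DualAlg k A →ₐ[k] E)
    (h : CrossRel i.toLinearMap j.toLinearMap) : Double k A →ₐ[k] E :=
  AlgHom.ofLinearMap (prodMap i.toLinearMap j.toLinearMap : (DualAlg k A ⊗[k] A) →ₗ[k] E)
    (by
      refine (prodMap_tmul i.toLinearMap j.toLinearMap 1 1).trans ?_
      simp)
    (by
      intro (x : Double k A) (y : Double k A)
      induction x using Double.induction with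
      | zero => rw [zero_mul]; refine (map_zero (prodMap i.toLinearMap j.toLinearMap)).trans ?_
                refine Eq.symm ((congrArg (· * _)
                  (map_zero (prodMap i.toLinearMap j.toLinearMap))).trans (zero_mul _))
      | add x x' hx hy =>
        rw [add_mul]
        refine (map_add (prodMap i.toLinearMap j.toLinearMap) _ _).trans ?_
        refine Eq.trans (congrArg₂ (· + ·) hx hy) ?_
        refine Eq.symm ((congrArg (· * _)
                  (map_add (prodMap i.toLinearMap j.toLinearMap) _ _)).trans (add_mul _ _ _))
      | mk p a =>
        have h1 : ∀ y : DualAlg k A ⊗[k] A, prodMap i.toLinearMap j.toLinearMap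
            (doubleDual k A p y) = j p * prodMap i.toLinearMap j.toLinearMap y := by
          intro y
          induction y with
          | zero => simp
          | add x y hx hy => simp only [map_add, mul_add, hx, hy]
          | tmul q b => simp [mul_assoc]
        have h2 : mk k A p a * y = doubleDual k A p (doubleLeft k A a y) := by
          rw [mul_def, mulLin_mk]; rfl
        rw [h2]
        refine (h1 _).trans ?_
        have h3 : prodMap i.toLinearMap j.toLinearMap (mk k A p a) = j p * i a :=
          prodMap_tmul _ _ p a
        refine Eq.trans ?_ (congrArg (· * prodMap i.toLinearMap j.toLinearMap y) h3.symm)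
        exact (congrArg (j p * ·) (prodMap_linear i j.toLinearMap h a y)).trans
          (mul_assoc _ _ _).symm)

theorem lift_mk {E : Type u} [Semiring E] [Algebra k E] (i : A →ₐ[k] E) (j : DualAlg k A →ₐ[k] E)
    (h : CrossRel i.toLinearMap j.toLinearMap) (p : DualAlg k A) (a : A) :
    lift i j h (mk k A p a) = j p * i a :=
  prodMap_tmul i.toLinearMap j.toLinearMap p a

@[simp] theorem lift_incl {E : Type u} [Semiring E] [Algebra k E] (i : A →ₐ[k] E)
    (j : DualAlg k A →ₐ[k] E) (h : CrossRel i.toLinearMap j.toLinearMap) (a : A) :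
    lift i j h (incl k A a) = i a := (lift_mk i j h 1 a).trans (by simp)

@[simp] theorem lift_inclDual {E : Type u} [Semiring E] [Algebra k E] (i : A →ₐ[k] E)
    (j : DualAlg k A →ₐ[k] E) (h : CrossRel i.toLinearMap j.toLinearMap) (p : DualAlg k A) :
    lift i j h (inclDual k A p) = j p := (lift_mk i j h p 1).trans (by simp)

theorem algHom_ext {E : Type u} [Semiring E] [Algebra k E] {f g : Double k A →ₐ[k] E}
    (h1 : ∀ a, f (incl k A a) = g (incl k A a)) (h2 : ∀ p, f (inclDual k A p) = g (inclDual k A p)) :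
    f = g := by
  ext x
  induction x using Double.induction with
  | zero => simp
  | add x y hx hy => simp only [map_add, hx, hy]
  | mk p a => rw [mk_eq, map_mul, map_mul, h1, h2]

end Double
end Double
end HopfCat

namespace HopfCat
open Coalgebra Bialgebra HopfAlgebra

section Slice

open WithConv

variable {k : Type u} [Field k] {A : Type u} [Ring A] [Bialgebra k A] [FiniteDimensional k A]
  {W : Type u} [AddCommGroup W] [Module k W]

variable (k A W) in
/-- The isomorphism `A* ⊗ W ≃ Hom(A, W)` which sends `p ⊗ w` to `a ↦ p(a) w`. -/
def sliceEquiv : DualAlg k A ⊗[k] W ≃ₗ[k] (A →ₗ[k] W) :=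
  (TensorProduct.congr (dualEv (k := k) (A := A)) (LinearEquiv.refl k W)).trans
    (dualTensorHomEquiv k A W)

@[simp] theorem sliceEquiv_tmul (p : DualAlg k A) (w : W) (a : A) :
    sliceEquiv k A W (p ⊗ₜ w) a = dualEv p a • w := by
  simp [sliceEquiv]

theorem slice_ext {s t : DualAlg k A ⊗[k] W} (h : ∀ a, sliceEquiv k A W s a = sliceEquiv k A W t a) :
    s = t :=
  (sliceEquiv k A W).injective (LinearMap.ext h)

theorem slice_lTensor {W' : Type u} [AddCommGroup W'] [Module k W'] (f : W →ₗ[k] W')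
    (t : DualAlg k A ⊗[k] W) (a : A) :
    sliceEquiv k A W' (f.lTensor _ t) a = f (sliceEquiv k A W t a) := by
  induction t with
  | zero => simp
  | add x y hx hy => simp only [map_add, LinearMap.add_apply, hx, hy]
  | tmul p w => simp

theorem slice_dualPre (b : A) (t : DualAlg k A ⊗[k] W) (a : A) :
    sliceEquiv k A W ((dualPre k A b).rTensor W t) a = sliceEquiv k A W t (b * a) := by
  induction t with
  | zero => simp
  | add x y hx hy => simp only [map_add, LinearMap.add_apply, hx, hy]
  | tmul p w => simp

theorem slice_dualPost (b : A) (t : DualAlg k A ⊗[k] W) (a : A) :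
    sliceEquiv k A W ((dualPost k A b).rTensor W t) a = sliceEquiv k A W t (a * b) := by
  induction t with
  | zero => simp
  | add x y hx hy => simp only [map_add, LinearMap.add_apply, hx, hy]
  | tmul p w => simp

variable (k A) in
/-- The opposite comultiplication of `A*`: it sends `p` to `∑ p₂ ⊗ p₁`, where
`∑ p₁(a) p₂(b) = p(a b)`. -/
def dualCopComul : DualAlg k A →ₗ[k] DualAlg k A ⊗[k] DualAlg k A :=
  (sliceEquiv k A (DualAlg k A)).symm.toLinearMap ∘ₗ (dualPost k A).flip

@[simp] theorem slice_dualCopComul (p : DualAlg k A) (a : A) :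
    sliceEquiv k A (DualAlg k A) (dualCopComul k A p) a = dualPost k A a p := by
  simp [dualCopComul]

theorem dualCopComul_dualPre (a : A) (p : DualAlg k A) : dualCopComul k A (dualPre k A a p) =
    (dualPre k A a).lTensor _ (dualCopComul k A p) := by
  apply slice_ext
  intro b
  rw [slice_lTensor, slice_dualCopComul, slice_dualCopComul]
  refine DualAlg.ext fun x => ?_
  simp [mul_assoc]

theorem dualCopComul_dualPost (a : A) (p : DualAlg k A) : dualCopComul k A (dualPost k A a p) =
    (dualPost k A a).rTensor _ (dualCopComul k A p) := by
  apply slice_ext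
  intro b
  rw [slice_dualPost, slice_dualCopComul, slice_dualCopComul]
  refine DualAlg.ext fun x => ?_
  simp [mul_assoc]

theorem dualPost_lTensor_dualCopComul (a : A) (p : DualAlg k A) :
    (dualPost k A a).lTensor _ (dualCopComul k A p) =
    (dualPre k A a).rTensor _ (dualCopComul k A p) := by
  apply slice_ext
  intro b
  rw [slice_dualPre, slice_lTensor, slice_dualCopComul, slice_dualCopComul]
  refine DualAlg.ext fun x => ?_
  simp [mul_assoc]

theorem dualCopComul_coassoc (p : DualAlg k A) :
    TensorProduct.assoc k _ _ _ ((dualCopComul k A).rTensor _ (dualCopComul k A p)) =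
      (dualCopComul k A).lTensor _ (dualCopComul k A p) := by
  apply slice_ext
  intro a
  rw [slice_lTensor, slice_dualCopComul]
  have h : ∀ (t : DualAlg k A ⊗[k] DualAlg k A) (a : A), sliceEquiv k A _
      (TensorProduct.assoc k _ _ _ ((dualCopComul k A).rTensor _ t)) a =
      (dualPost k A a).rTensor _ t := by
    intro t a
    induction t with
    | zero => simp
    | add x y hx hy => simp only [map_add, LinearMap.add_apply, hx, hy]
    | tmul p q =>
      have : ∀ s : DualAlg k A ⊗[k] DualAlg k A, sliceEquiv k A _
          (TensorProduct.assoc k _ _ _ (s ⊗ₜ q)) a = (sliceEquiv k A _ s a) ⊗ₜ q := by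
        intro s
        induction s with
        | zero => simp
        | add x y hx hy =>
          simp only [map_add, TensorProduct.add_tmul, LinearMap.add_apply, hx, hy]
        | tmul p q => simp [TensorProduct.smul_tmul']
      rw [LinearMap.rTensor_tmul, this, slice_dualCopComul, LinearMap.rTensor_tmul]
  rw [h, dualCopComul_dualPost]

theorem slice_mul (s t : DualAlg k A ⊗[k] DualAlg k A) :
    toConv (sliceEquiv k A _ (s * t)) = toConv (sliceEquiv k A _ s) *
      toConv (sliceEquiv k A _ t) := by
  induction s with
  | zero => simp
  | add x y hx hy => rw [add_mul, map_add, toConv_add, hx, hy, map_add, toConv_add, add_mul]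
  | tmul p p' =>
    induction t with
    | zero => simp
    | add x y hx hy => rw [mul_add, map_add, toConv_add, hx, hy, map_add, toConv_add, mul_add]
    | tmul q q' =>
      apply WithConv.ext
      apply LinearMap.ext
      intro a
      rw [Algebra.TensorProduct.tmul_mul_tmul]
      refine (sliceEquiv_tmul (p * q) (p' * q') a).trans ?_
      change LinearMap.mul' k k (TensorProduct.map (dualEv p) (dualEv q) (comul a)) • (p' * q') =
        LinearMap.mul' k _ (TensorProduct.map (sliceEquiv k A _ (p ⊗ₜ p'))
          (sliceEquiv k A _ (q ⊗ₜ q')) (comul a))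
      generalize (comul a : A ⊗[k] A) = r
      induction r with
      | zero => simp
      | add x y hx hy => simp only [map_add, add_smul, hx, hy]
      | tmul c d =>
        simp only [TensorProduct.map_tmul, LinearMap.mul'_apply, sliceEquiv_tmul]
        rw [smul_mul_assoc, mul_smul_comm, smul_smul]

theorem slice_one (a : A) : sliceEquiv k A (DualAlg k A) 1 a = counit (R := k) a • 1 := by
  refine (sliceEquiv_tmul 1 1 a).trans ?_
  simp

variable (k A) in
/-- The opposite comultiplication of `A*` as a homomorphism of algebras. -/
def dualCopComulHom : DualAlg k A →ₐ[k] DualAlg k A ⊗[k] DualAlg k A :=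
  AlgHom.ofLinearMap (dualCopComul k A)
    (by
      apply slice_ext
      intro a
      rw [slice_one, slice_dualCopComul]
      refine DualAlg.ext fun x => ?_
      simp [mul_comm])
    (by
      intro p q
      apply (sliceEquiv k A _).injective
      apply toConv_injective
      rw [slice_mul]
      have h := dualPost_conv (A := A) p
      apply WithConv.ext
      apply LinearMap.ext
      intro a
      have h1 := congr(($h).ofConv a q)
      rw [mul_convConst_apply] at h1
      refine (slice_dualCopComul (p * q) a).trans (h1.trans ?_)
      have h2 : ∀ p : DualAlg k A, sliceEquiv k A _ (dualCopComul k A p) = (dualPost k A).flip p :=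
        fun p => by ext a : 1; simp
      rw [h2, h2]
      change LinearMap.mul' k (Module.End k (DualAlg k A)) (TensorProduct.map _ _ (comul a)) q =
        LinearMap.mul' k (DualAlg k A) (TensorProduct.map _ _ (comul a))
      generalize (comul a : A ⊗[k] A) = r
      induction r with
      | zero => simp
      | add x y hx hy => simp only [map_add, LinearMap.add_apply, hx, hy]
      | tmul c d => simp)

variable (k A) in
/-- The counit of `A*`, evaluation at `1`. -/
def dualCounit : DualAlg k A →ₐ[k] k :=
  AlgHom.ofLinearMap
    (LinearMap.applyₗ (1 : A) ∘ₗ dualEv.toLinearMap)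
    (by simp)
    (fun p q => by simp [dualEv_mul, Algebra.TensorProduct.one_def])

end Slice

section CrossTensor

open WithConv

variable {k : Type u} [Field k] {A : Type u} [Ring A] [Bialgebra k A] [FiniteDimensional k A]
  {E : Type u} [Semiring E] [Algebra k E]

/-- For `w = ∑ q ⊗ q'` and a map `d` which sends elements of `A` to endomorphisms of `A*`, the map
`a ↦ ∑ q ⊗ d(a) q'`. -/
def crossRight (d : A →ₗ[k] Module.End k (DualAlg k A)) :
    DualAlg k A ⊗[k] DualAlg k A →ₗ[k] A →ₗ[k] DualAlg k A ⊗[k] DualAlg k A :=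
  ((LinearMap.lTensorHom (DualAlg k A)).comp d).flip

/-- For `w = ∑ q ⊗ q'` and a map `d` which sends elements of `A` to endomorphisms of `A*`, the map
`a ↦ ∑ d(a) q ⊗ q'`. -/
def crossLeft (d : A →ₗ[k] Module.End k (DualAlg k A)) :
    DualAlg k A ⊗[k] DualAlg k A →ₗ[k] A →ₗ[k] DualAlg k A ⊗[k] DualAlg k A :=
  ((LinearMap.rTensorHom (DualAlg k A)).comp d).flip

theorem crossRight_rel (i : A →ₐ[k] E) (j₁ j₂ : DualAlg k A →ₐ[k] E)
    (m : DualAlg k A ⊗[k] DualAlg k A →ₗ[k] E) (hm : ∀ q q', m (q ⊗ₜ q') = j₁ q * j₂ q')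
    (hc : ∀ a q, i a * j₁ q = j₁ q * i a) (h : CrossRel i.toLinearMap j₂.toLinearMap)
    (w : DualAlg k A ⊗[k] DualAlg k A) :
    toConv i.toLinearMap * toConv (m ∘ₗ crossRight (dualPre k A) w) =
      toConv (m ∘ₗ crossRight (dualPost k A) w) * toConv i.toLinearMap := by
  induction w with
  | zero => simp
  | add x y hx hy =>
    rw [map_add, map_add, LinearMap.comp_add, LinearMap.comp_add, toConv_add, toConv_add, mul_add,
      add_mul, hx, hy]
  | tmul q q' =>
    have e : ∀ d : A →ₗ[k] Module.End k (DualAlg k A), toConv (m ∘ₗ crossRight d (q ⊗ₜ q')) =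
        toConv (convConst k A (j₁ q)) * toConv (j₂.toLinearMap ∘ₗ d.flip q') := by
      intro d
      apply WithConv.ext
      apply LinearMap.ext
      intro a
      rw [convConst_mul_apply]
      simp [crossRight, hm]
    have e' : toConv i.toLinearMap * toConv (convConst k A (j₁ q)) =
        toConv (convConst k A (j₁ q)) * toConv i.toLinearMap := by
      apply WithConv.ext
      apply LinearMap.ext
      intro a
      rw [convConst_mul_apply, mul_convConst_apply]
      simp [hc]
    rw [e, e, ← mul_assoc, e', mul_assoc, mul_assoc]
    exact congrArg (_ * ·) (h q')

theorem crossLeft_rel (i : A →ₐ[k] E) (j₁ j₂ : DualAlg k A →ₐ[k] E)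
    (m : DualAlg k A ⊗[k] DualAlg k A →ₗ[k] E) (hm : ∀ q q', m (q ⊗ₜ q') = j₁ q * j₂ q')
    (hc : ∀ a q, i a * j₂ q = j₂ q * i a) (h : CrossRel i.toLinearMap j₁.toLinearMap)
    (w : DualAlg k A ⊗[k] DualAlg k A) :
    toConv i.toLinearMap * toConv (m ∘ₗ crossLeft (dualPre k A) w) =
      toConv (m ∘ₗ crossLeft (dualPost k A) w) * toConv i.toLinearMap := by
  induction w with
  | zero => simp
  | add x y hx hy =>
    rw [map_add, map_add, LinearMap.comp_add, LinearMap.comp_add, toConv_add, toConv_add, mul_add,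
      add_mul, hx, hy]
  | tmul q q' =>
    have e : ∀ d : A →ₗ[k] Module.End k (DualAlg k A), toConv (m ∘ₗ crossLeft d (q ⊗ₜ q')) =
        toConv (j₁.toLinearMap ∘ₗ d.flip q) * toConv (convConst k A (j₂ q')) := by
      intro d
      apply WithConv.ext
      apply LinearMap.ext
      intro a
      rw [mul_convConst_apply]
      simp [crossLeft, hm]
    have e' : toConv i.toLinearMap * toConv (convConst k A (j₂ q')) =
        toConv (convConst k A (j₂ q')) * toConv i.toLinearMap := by
      apply WithConv.ext
      apply LinearMap.ext
      intro a
      rw [convConst_mul_apply, mul_convConst_apply]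
      simp [hc]
    rw [e, e, mul_assoc, ← e', ← mul_assoc, ← mul_assoc]
    exact congrArg (· * _) (h q)

/-- Suppose that `i = i₁ * i₂` for two homomorphisms which are compatible with `j₁` and `j₂`
respectively. Then it is compatible with `p ↦ ∑ j₁(p₂) j₂(p₁)`. -/
theorem crossRel_tensor (i₁ i₂ : A →ₐ[k] E) (j₁ j₂ : DualAlg k A →ₐ[k] E)
    (m : DualAlg k A ⊗[k] DualAlg k A →ₗ[k] E) (hm : ∀ q q', m (q ⊗ₜ q') = j₁ q * j₂ q')
    (h₁ : CrossRel i₁.toLinearMap j₁.toLinearMap) (h₂ : CrossRel i₂.toLinearMap j₂.toLinearMap)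
    (hc₁ : ∀ a q, i₁ a * j₂ q = j₂ q * i₁ a) (hc₂ : ∀ a q, i₂ a * j₁ q = j₁ q * i₂ a)
    (i : A →ₗ[k] E) (hi : toConv i = toConv i₁.toLinearMap * toConv i₂.toLinearMap) :
    CrossRel i (m ∘ₗ dualCopComul k A) := by
  intro p
  have e1 : (m ∘ₗ dualCopComul k A) ∘ₗ (dualPre k A).flip p =
      m ∘ₗ crossRight (dualPre k A) (dualCopComul k A p) := by
    ext a : 1
    exact congrArg m (dualCopComul_dualPre a p)
  have e2 : (m ∘ₗ dualCopComul k A) ∘ₗ (dualPost k A).flip p =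
      m ∘ₗ crossLeft (dualPost k A) (dualCopComul k A p) := by
    ext a : 1
    exact congrArg m (dualCopComul_dualPost a p)
  have e3 : m ∘ₗ crossRight (dualPost k A) (dualCopComul k A p) =
      m ∘ₗ crossLeft (dualPre k A) (dualCopComul k A p) := by
    ext a : 1
    exact congrArg m (dualPost_lTensor_dualCopComul a p)
  rw [e1, e2, hi, mul_assoc, crossRight_rel i₂ j₁ j₂ m hm hc₂ h₂, e3, ← mul_assoc,
    crossLeft_rel i₁ j₁ j₂ m hm hc₁ h₁, mul_assoc]

theorem tensor_conv {D : Type u} [Semiring D] [Algebra k D] (i : A →ₐ[k] D) :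
    toConv ((Algebra.TensorProduct.map i i).comp (comulAlgHom k A)).toLinearMap =
    toConv ((Algebra.TensorProduct.includeLeft (R := k) (S := k) (A := D)
      (B := D)).comp i).toLinearMap *
    toConv ((Algebra.TensorProduct.includeRight (R := k) (A := D)
      (B := D)).comp i).toLinearMap := by
  apply WithConv.ext
  apply LinearMap.ext
  intro a
  change Algebra.TensorProduct.map i i (comul a) =
    LinearMap.mul' k _ (TensorProduct.map _ _ (comul a))
  generalize (comul a : A ⊗[k] A) = t
  induction t with
  | zero => simp
  | add x y hx hy => rw [map_add, map_add, map_add, ← hx, ← hy]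
  | tmul a b => simp

theorem crossRel_comul {D : Type u} [Semiring D] [Algebra k D] (i : A →ₐ[k] D)
    (j : DualAlg k A →ₐ[k] D) (h : CrossRel i.toLinearMap j.toLinearMap) :
    CrossRel ((Algebra.TensorProduct.map i i).comp (comulAlgHom k A)).toLinearMap
      ((Algebra.TensorProduct.map j j).comp (dualCopComulHom k A)).toLinearMap := by
  have h1 := h.comp (Algebra.TensorProduct.includeLeft (R := k) (S := k) (A := D) (B := D))
  have h2 := h.comp (Algebra.TensorProduct.includeRight (R := k) (A := D) (B := D))
  refine crossRel_tensor
    ((Algebra.TensorProduct.includeLeft (R := k) (S := k) (A := D) (B := D)).comp i)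
    ((Algebra.TensorProduct.includeRight (R := k) (A := D) (B := D)).comp i)
    ((Algebra.TensorProduct.includeLeft (R := k) (S := k) (A := D) (B := D)).comp j)
    ((Algebra.TensorProduct.includeRight (R := k) (A := D) (B := D)).comp j)
    (Algebra.TensorProduct.map j j).toLinearMap ?_ h1 h2 ?_ ?_ _ (tensor_conv i)
  · intro q q'
    simp
  · intro a q
    simp
  · intro a q
    simp

theorem tensorMap_coassoc {C : Type u} [AddCommGroup C] [Module k C] (δ : C →ₗ[k] C ⊗[k] C)
    {D : Type u} [Semiring D] [Algebra k D] (i : C →ₗ[k] D) (Δ : D →ₗ[k] D ⊗[k] D)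
    (h : Δ ∘ₗ i = TensorProduct.map i i ∘ₗ δ)
    (hδ : ∀ c, TensorProduct.assoc k C C C (δ.rTensor C (δ c)) = δ.lTensor C (δ c)) (c : C) :
    TensorProduct.assoc k D D D (Δ.rTensor D (Δ (i c))) = Δ.lTensor D (Δ (i c)) := by
  have e : Δ (i c) = TensorProduct.map i i (δ c) := congr($h c)
  have e1 : ∀ t : C ⊗[k] C, TensorProduct.assoc k D D D (Δ.rTensor D (TensorProduct.map i i t)) =
      TensorProduct.map i (TensorProduct.map i i) (TensorProduct.assoc k C C C (δ.rTensor C t)) := by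
    intro t
    induction t with
    | zero => simp
    | add x y hx hy => simp only [map_add, hx, hy]
    | tmul a b =>
      have ea : Δ (i a) = TensorProduct.map i i (δ a) := congr($h a)
      simp only [TensorProduct.map_tmul, LinearMap.rTensor_tmul, ea]
      generalize δ a = s
      induction s with
      | zero => simp
      | add x y hx hy => simp only [map_add, TensorProduct.add_tmul, hx, hy]
      | tmul x y => simp
  have e2 : ∀ t : C ⊗[k] C, Δ.lTensor D (TensorProduct.map i i t) =
      TensorProduct.map i (TensorProduct.map i i) (δ.lTensor C t) := by
    intro t
    induction t with
    | zero => simp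
    | add x y hx hy => simp only [map_add, hx, hy]
    | tmul a b =>
      have ea : Δ (i b) = TensorProduct.map i i (δ b) := congr($h b)
      simp only [TensorProduct.map_tmul, LinearMap.lTensor_tmul, ea]
  rw [e, e1, e2, hδ]

theorem tensorMap_counit {C : Type u} [AddCommGroup C] [Module k C] (δ : C →ₗ[k] C ⊗[k] C)
    {D : Type u} [Semiring D] [Algebra k D] (i : C →ₗ[k] D) (Δ : D →ₗ[k] D ⊗[k] D)
    (h : Δ ∘ₗ i = TensorProduct.map i i ∘ₗ δ) (ε : C →ₗ[k] k) (η : D →ₗ[k] k) (h' : η ∘ₗ i = ε)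
    (hl : ∀ c, TensorProduct.lid k C (ε.rTensor C (δ c)) = c)
    (hr : ∀ c, TensorProduct.rid k C (ε.lTensor C (δ c)) = c) (c : C) :
    TensorProduct.lid k D (η.rTensor D (Δ (i c))) = i c ∧
      TensorProduct.rid k D (η.lTensor D (Δ (i c))) = i c := by
  have e : Δ (i c) = TensorProduct.map i i (δ c) := congr($h c)
  have e' : ∀ c, η (i c) = ε c := fun c => congr($h' c)
  have e1 : ∀ t : C ⊗[k] C, TensorProduct.lid k D (η.rTensor D (TensorProduct.map i i t)) =
      i (TensorProduct.lid k C (ε.rTensor C t)) := by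
    intro t
    induction t with
    | zero => simp
    | add x y hx hy => simp only [map_add, hx, hy]
    | tmul a b => simp [e']
  have e2 : ∀ t : C ⊗[k] C, TensorProduct.rid k D (η.lTensor D (TensorProduct.map i i t)) =
      i (TensorProduct.rid k C (ε.lTensor C t)) := by
    intro t
    induction t with
    | zero => simp
    | add x y hx hy => simp only [map_add, hx, hy]
    | tmul a b => simp [e']
  rw [e, e1, e2, hl, hr]
  exact ⟨rfl, rfl⟩

theorem dualCopComul_counit (p : DualAlg k A) :
    TensorProduct.lid k _ ((dualCounit k A).toLinearMap.rTensor _ (dualCopComul k A p)) = p ∧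
    TensorProduct.rid k _ ((dualCounit k A).toLinearMap.lTensor _ (dualCopComul k A p)) = p := by
  constructor
  · have h : ∀ t : DualAlg k A ⊗[k] DualAlg k A, TensorProduct.lid k _
        ((dualCounit k A).toLinearMap.rTensor _ t) = sliceEquiv k A _ t 1 := by
      intro t
      induction t with
      | zero => simp
      | add x y hx hy => simp only [map_add, LinearMap.add_apply, hx, hy]
      | tmul a b => simp [dualCounit]
    rw [h, slice_dualCopComul]
    refine DualAlg.ext fun x => ?_
    simp
  · have h : ∀ (t : DualAlg k A ⊗[k] DualAlg k A) (a : A), dualEv (TensorProduct.rid k _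
        ((dualCounit k A).toLinearMap.lTensor _ t)) a = dualCounit k A (sliceEquiv k A _ t a) := by
      intro t a
      induction t with
      | zero => simp
      | add x y hx hy => simp only [map_add, LinearMap.add_apply, hx, hy]
      | tmul a b => simp [dualCounit, mul_comm]
    refine DualAlg.ext fun x => ?_
    rw [h, slice_dualCopComul]
    simp [dualCounit]

theorem crossRel_counit :
    CrossRel (counitAlgHom k A).toLinearMap (dualCounit k A).toLinearMap := by
  intro p
  have h0 : (counitAlgHom k A).toLinearMap = convConst k A 1 := by
    ext a : 1
    simp [convConst]
  have h1 : (dualCounit k A).toLinearMap ∘ₗ (dualPre k A).flip p = dualEv p := by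
    ext a
    simp [dualCounit]
  have h2 : (dualCounit k A).toLinearMap ∘ₗ (dualPost k A).flip p = dualEv p := by
    ext a
    simp [dualCounit]
  apply WithConv.ext
  apply LinearMap.ext
  intro a
  rw [h0, h1, h2, mul_convConst_apply, convConst_mul_apply, mul_one, one_mul]

end CrossTensor

section DoubleBialgebra

open WithConv

namespace Double

variable {k : Type u} [Field k] {A : Type u} [Ring A] [HopfAlgebra k A] [HasBijectiveAntipode k A]
  [FiniteDimensional k A]

variable (k A) in
/-- The comultiplication `p ⊗ a ↦ ∑ (p₂ ⊗ a₁) ⊗ (p₁ ⊗ a₂)` of the double, as a homomorphism of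
algebras. -/
def comulHom : Double k A →ₐ[k] Double k A ⊗[k] Double k A :=
  lift ((Algebra.TensorProduct.map (incl k A) (incl k A)).comp (comulAlgHom k A))
    ((Algebra.TensorProduct.map (inclDual k A) (inclDual k A)).comp (dualCopComulHom k A))
    (crossRel_comul (incl k A) (inclDual k A) (crossRel_incl k A))

variable (k A) in
/-- The counit `p ⊗ a ↦ p(1) ε(a)` of the double, as a homomorphism of algebras. -/
def counitHom : Double k A →ₐ[k] k :=
  lift (counitAlgHom k A) (dualCounit k A) crossRel_counit

theorem comulHom_incl : (comulHom k A).toLinearMap ∘ₗ (incl k A).toLinearMap =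
    TensorProduct.map (incl k A).toLinearMap (incl k A).toLinearMap ∘ₗ comul := by
  ext a : 1
  exact lift_incl _ _ (crossRel_comul (incl k A) (inclDual k A) (crossRel_incl k A)) a

theorem comulHom_inclDual : (comulHom k A).toLinearMap ∘ₗ (inclDual k A).toLinearMap =
    TensorProduct.map (inclDual k A).toLinearMap (inclDual k A).toLinearMap ∘ₗ
      dualCopComul k A := by
  ext a : 1
  exact lift_inclDual _ _ (crossRel_comul (incl k A) (inclDual k A) (crossRel_incl k A)) a

theorem counitHom_incl : (counitHom k A).toLinearMap ∘ₗ (incl k A).toLinearMap = counit := by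
  ext a : 1
  exact lift_incl _ _ crossRel_counit a

theorem counitHom_inclDual : (counitHom k A).toLinearMap ∘ₗ (inclDual k A).toLinearMap =
    (dualCounit k A).toLinearMap := by
  ext a : 1
  exact lift_inclDual _ _ crossRel_counit a

theorem comulHom_counit_incl (a : A) :
    TensorProduct.lid k _ ((counitHom k A).toLinearMap.rTensor _ (comulHom k A (incl k A a))) =
        incl k A a ∧
      TensorProduct.rid k _ ((counitHom k A).toLinearMap.lTensor _ (comulHom k A (incl k A a))) =
        incl k A a :=
  tensorMap_counit comul (incl k A).toLinearMap (comulHom k A).toLinearMap comulHom_incl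
    counit (counitHom k A).toLinearMap counitHom_incl (by simp) (by simp) a

theorem comulHom_counit_inclDual (p : DualAlg k A) :
    TensorProduct.lid k _ ((counitHom k A).toLinearMap.rTensor _ (comulHom k A (inclDual k A p))) =
        inclDual k A p ∧
      TensorProduct.rid k _ ((counitHom k A).toLinearMap.lTensor _ (comulHom k A (inclDual k A p))) =
        inclDual k A p :=
  tensorMap_counit (dualCopComul k A) (inclDual k A).toLinearMap (comulHom k A).toLinearMap
    comulHom_inclDual (dualCounit k A).toLinearMap (counitHom k A).toLinearMap
    counitHom_inclDual (fun c => (dualCopComul_counit c).1) (fun c => (dualCopComul_counit c).2) p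

/-- The Drinfel'd double as a bialgebra. -/
instance : Bialgebra k (Double k A) :=
  Bialgebra.ofAlgHom (comulHom k A) (counitHom k A)
    (by
      apply algHom_ext
      · exact tensorMap_coassoc comul (incl k A).toLinearMap (comulHom k A).toLinearMap
          comulHom_incl coassoc_apply
      · exact tensorMap_coassoc (dualCopComul k A) (inclDual k A).toLinearMap
          (comulHom k A).toLinearMap comulHom_inclDual dualCopComul_coassoc)
    (by
      apply algHom_ext
      · exact fun a => (TensorProduct.lid k _).injective ((comulHom_counit_incl a).1.trans (by simp))
      · exact fun a => (TensorProduct.lid k _).injective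
          ((comulHom_counit_inclDual a).1.trans (by simp)))
    (by
      apply algHom_ext
      · exact fun a => (TensorProduct.rid k _).injective ((comulHom_counit_incl a).2.trans (by simp))
      · exact fun a => (TensorProduct.rid k _).injective
          ((comulHom_counit_inclDual a).2.trans (by simp)))

theorem comul_incl (a : A) : comul (R := k) (incl k A a) =
    TensorProduct.map (incl k A).toLinearMap (incl k A).toLinearMap (comul a) :=
  congr($(comulHom_incl (k := k)) a)

theorem comul_inclDual (p : DualAlg k A) : comul (R := k) (inclDual k A p) =
    TensorProduct.map (inclDual k A).toLinearMap (inclDual k A).toLinearMap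
      (dualCopComul k A p) :=
  congr($(comulHom_inclDual (k := k)) p)

theorem counit_incl (a : A) : counit (R := k) (incl k A a) = counit a :=
  congr($(counitHom_incl (k := k)) a)

theorem counit_inclDual (p : DualAlg k A) : counit (R := k) (inclDual k A p) = dualCounit k A p :=
  congr($(counitHom_inclDual (k := k)) p)

end Double

end DoubleBialgebra
end HopfCat

namespace HopfCat
open Coalgebra Bialgebra HopfAlgebra

section Coslice

open WithConv

variable {k : Type u} [Field k] {A : Type u} [Ring A] [Bialgebra k A]
  {V W : Type u} [AddCommGroup V] [Module k V] [AddCommGroup W] [Module k W]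

/-- The map `v ⊗ a ↦ p(a) v`. -/
def coslice (V : Type u) [AddCommGroup V] [Module k V] (p : DualAlg k A) : V ⊗[k] A →ₗ[k] V :=
  (TensorProduct.rid k V).toLinearMap ∘ₗ (dualEv p).lTensor V

@[simp] theorem coslice_tmul (p : DualAlg k A) (v : V) (a : A) :
    coslice V p (v ⊗ₜ a) = dualEv p a • v := by
  simp [coslice]

theorem coslice_rTensor (p : DualAlg k A) (φ : V →ₗ[k] W) (t : V ⊗[k] A) :
    coslice W p (φ.rTensor A t) = φ (coslice V p t) := by
  induction t with
  | zero => simp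
  | add x y hx hy => simp only [map_add, hx, hy]
  | tmul v a => simp

theorem coslice_ext {s t : V ⊗[k] A} (h : ∀ p : DualAlg k A, coslice V p s = coslice V p t) :
    s = t := by
  classical
  let b := Module.Basis.ofVectorSpace k A
  have key : ∀ (t : V ⊗[k] A) i, (TensorProduct.equivFinsuppOfBasisRight b t) i =
      coslice V (dualEv.symm (b.coord i)) t := by
    intro t i
    induction t with
    | zero => simp
    | add x y hx hy => simp only [map_add, Finsupp.add_apply, hx, hy]
    | tmul v a => simp
  apply (TensorProduct.equivFinsuppOfBasisRight b (M := V)).injective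
  ext i
  rw [key, key, h]

theorem coslice_coslice (p q : DualAlg k A) (t : (V ⊗[k] A) ⊗[k] A) (s : V ⊗[k] A)
    (h : TensorProduct.assoc k V A A t = comul.lTensor V s) :
    coslice V p (coslice (V ⊗[k] A) q t) = coslice V (p * q) s := by
  let f : V ⊗[k] (A ⊗[k] A) →ₗ[k] V := (TensorProduct.rid k V).toLinearMap ∘ₗ
    (LinearMap.mul' k k ∘ₗ TensorProduct.map (dualEv p) (dualEv q)).lTensor V
  have h1 : ∀ t : (V ⊗[k] A) ⊗[k] A,
      coslice V p (coslice (V ⊗[k] A) q t) = f (TensorProduct.assoc k V A A t) := by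
    intro t
    induction t with
    | zero => simp
    | add x y hx hy => simp only [map_add, hx, hy]
    | tmul s a =>
      induction s with
      | zero => simp
      | add x y hx hy => simp only [map_add, TensorProduct.add_tmul, hx, hy]
      | tmul v b => simp [f, smul_smul, mul_comm]
  have h2 : f (comul.lTensor V s) = coslice V (p * q) s := by
    clear h
    induction s with
    | zero => simp
    | add x y hx hy => simp only [map_add, hx, hy]
    | tmul v a => simp [f, dualEv_mul]
  rw [h1, h, h2]

/-- The action of `A*` which corresponds to a coaction, `p v = ∑ p(v₁) v₀`. -/
def dualOfCoact (ρ : V →ₗ[k] V ⊗[k] A) : DualAlg k A →ₗ[k] Module.End k V :=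
  LinearMap.mk₂ k (fun p v => coslice V p (ρ v))
    (fun p q v => by simp [coslice, LinearMap.lTensor_add])
    (fun c p v => by simp [coslice, LinearMap.lTensor_smul]) (fun p v w => by simp)
    (fun c p v => by simp)

@[simp] theorem dualOfCoact_apply (ρ : V →ₗ[k] V ⊗[k] A) (p : DualAlg k A) (v : V) :
    dualOfCoact ρ p v = coslice V p (ρ v) := rfl

/-- The action of `A*` which corresponds to a coaction, `p v = ∑ p(v₁) v₀`. -/
def dualActOfCoact (ρ : V →ₗ[k] V ⊗[k] A)
    (h : ∀ v, TensorProduct.assoc k V A A (ρ.rTensor A (ρ v)) = comul.lTensor V (ρ v))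
    (h' : ∀ v, counit.lTensor V (ρ v) = v ⊗ₜ[k] (1 : k)) : DualAlg k A →ₐ[k] Module.End k V :=
  AlgHom.ofLinearMap (dualOfCoact ρ)
    (by
      ext v
      refine (congrArg (TensorProduct.rid k V) (h' v)).trans ?_
      simp)
    (by
      intro p q
      ext v
      refine (coslice_coslice p q _ _ (h v)).symm.trans ?_
      rw [coslice_rTensor]
      rfl)

theorem crossRel_iff (f : A →ₐ[k] Module.End k V) (ρ : V →ₗ[k] V ⊗[k] A) :
    CrossRel f.toLinearMap (dualOfCoact ρ) ↔ ∀ (a : A) (v : V),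
      outerAct f (Algebra.lmul k A) (comul a) (ρ v) = coactAfter f ρ v (comul a) := by
  have h1 : ∀ (p : DualAlg k A) (t : A ⊗[k] A) (v : V), LinearMap.mul' k _ (TensorProduct.map
      f.toLinearMap (dualOfCoact ρ ∘ₗ (dualPre k A).flip p) t) v =
      coslice V p (outerAct f (Algebra.lmul k A) t (ρ v)) := by
    intro p t v
    induction t with
    | zero => simp
    | add x y hx hy => simp only [map_add, LinearMap.add_apply, hx, hy]
    | tmul a b =>
      rw [outerAct_tmul]
      simp only [TensorProduct.map_tmul, LinearMap.mul'_apply, Module.End.mul_apply,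
        LinearMap.comp_apply, dualOfCoact_apply, AlgHom.toLinearMap_apply, LinearMap.flip_apply]
      generalize ρ v = s
      induction s with
      | zero => simp
      | add x y hx hy => simp only [map_add, hx, hy]
      | tmul v a => simp
  have h2 : ∀ (p : DualAlg k A) (t : A ⊗[k] A) (v : V), LinearMap.mul' k _ (TensorProduct.map
      (dualOfCoact ρ ∘ₗ (dualPost k A).flip p) f.toLinearMap t) v =
      coslice V p (coactAfter f ρ v t) := by
    intro p t v
    induction t with
    | zero => simp
    | add x y hx hy => simp only [map_add, LinearMap.add_apply, hx, hy]
    | tmul a b =>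
      rw [coactAfter_tmul]
      simp only [TensorProduct.map_tmul, LinearMap.mul'_apply, Module.End.mul_apply,
        LinearMap.comp_apply, dualOfCoact_apply, AlgHom.toLinearMap_apply, LinearMap.flip_apply]
      generalize ρ (f b v) = s
      induction s with
      | zero => simp
      | add x y hx hy => simp only [map_add, hx, hy]
      | tmul v a => simp
  constructor
  · intro h a v
    refine coslice_ext fun p => ?_
    rw [← h1, ← h2]
    exact congr(($(h p)).ofConv a v)
  · intro h p
    apply WithConv.ext
    apply LinearMap.ext
    intro a
    apply LinearMap.ext
    intro v
    refine (h1 p (comul a) v).trans (Eq.trans ?_ (h2 p (comul a) v).symm)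
    rw [h]

section FiniteDimensional

variable [FiniteDimensional k A]

/-- The coaction which corresponds to an action `j` of `A*`: it is `v ↦ ∑ j(eᵢ*) v ⊗ eᵢ`, for a
basis `eᵢ` of `A`. -/
def coactOfDual (j : DualAlg k A →ₗ[k] Module.End k V) : V →ₗ[k] V ⊗[k] A :=
  ∑ i, (TensorProduct.mk k V A).flip (Module.finBasis k A i) ∘ₗ
    j (dualEv.symm ((Module.finBasis k A).coord i))

theorem coslice_coactOfDual (j : DualAlg k A →ₗ[k] Module.End k V) (p : DualAlg k A) (v : V) :
    coslice V p (coactOfDual j v) = j p v := by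
  have h : p = ∑ i, dualEv p (Module.finBasis k A i) •
      dualEv.symm ((Module.finBasis k A).coord i) := by
    apply dualEv.injective
    apply (Module.finBasis k A).ext
    intro i
    simp [LinearMap.sum_apply, Finsupp.single_apply]
  conv_rhs => rw [h]
  simp [coactOfDual, LinearMap.sum_apply]

theorem dualOfCoact_coactOfDual (j : DualAlg k A →ₗ[k] Module.End k V) :
    dualOfCoact (coactOfDual j) = j :=
  LinearMap.ext fun p => LinearMap.ext fun v => coslice_coactOfDual j p v

theorem coactOfDual_dualOfCoact (ρ : V →ₗ[k] V ⊗[k] A) : coactOfDual (dualOfCoact ρ) = ρ :=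
  LinearMap.ext fun v => coslice_ext fun p => coslice_coactOfDual _ p v

theorem coactOfDual_coassoc (j : DualAlg k A →ₐ[k] Module.End k V) (v : V) :
    TensorProduct.assoc k V A A ((coactOfDual j.toLinearMap).rTensor A
      (coactOfDual j.toLinearMap v)) = comul.lTensor V (coactOfDual j.toLinearMap v) := by
  obtain ⟨s, hs⟩ := (TensorProduct.assoc k V A A).surjective
    (comul.lTensor V (coactOfDual j.toLinearMap v))
  rw [← hs]
  congr 1
  refine coslice_ext fun q => coslice_ext fun p => ?_
  rw [coslice_coslice p q s _ hs, coslice_rTensor, coslice_coactOfDual, coslice_coactOfDual,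
    coslice_coactOfDual]
  exact congr($((map_mul j p q).symm) v)

theorem coactOfDual_counit (j : DualAlg k A →ₐ[k] Module.End k V) (v : V) :
    counit.lTensor V (coactOfDual j.toLinearMap v) = v ⊗ₜ[k] (1 : k) := by
  apply (TensorProduct.rid k V).injective
  refine (coslice_coactOfDual j.toLinearMap 1 v).trans ?_
  simp

end FiniteDimensional

end Coslice

section DoubleModules

open WithConv

variable {k : Type u} [Field k] {A : Type u} [Ring A] [HopfAlgebra k A] [HasBijectiveAntipode k A]

theorem YD.crossRel (M : YD k A) : CrossRel M.toLMod.act.toLinearMap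
    (dualActOfCoact M.coact M.coassoc M.counit_coact).toLinearMap :=
  (crossRel_iff M.toLMod.act M.coact).2 M.compat

/-- The action of the double on a Yetter-Drinfel'd module. -/
def YD.doubleAct (M : YD k A) : Double k A →ₐ[k] Module.End k M.toLMod.V :=
  Double.lift M.toLMod.act (dualActOfCoact M.coact M.coassoc M.counit_coact) M.crossRel

theorem YD.doubleAct_mk (M : YD k A) (p : DualAlg k A) (a : A) (m : M.toLMod.V) :
    M.doubleAct (Double.mk k A p a) m = coslice M.toLMod.V p (M.coact (M.toLMod.act a m)) :=
  congr($(Double.lift_mk M.toLMod.act (dualActOfCoact M.coact M.coassoc M.counit_coact)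
    M.crossRel p a) m)

theorem YD.doubleAct_natural {M N : YD k A} (f : M ⟶ N) (x : Double k A) (m : M.toLMod.V) :
    f.hom.hom (M.doubleAct x m) = N.doubleAct x (f.hom.hom m) := by
  induction x using Double.induction with
  | zero => simp only [map_zero, LinearMap.zero_apply]
  | add x y hx hy => simp only [map_add, LinearMap.add_apply, hx, hy]
  | mk p a =>
    rw [doubleAct_mk, doubleAct_mk]
    refine Eq.trans ?_ (congrArg (coslice N.toLMod.V p)
      ((f.comm (M.toLMod.act a m)).trans (congrArg N.coact (f.hom.comm a m))))
    exact (coslice_rTensor p f.hom.hom.hom _).symm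

variable (k A) in
/-- The functor from Yetter-Drinfel'd modules to modules over the Drinfel'd double. The element
`p ⊗ a` acts by `(p ⊗ a) v = ∑ p((a v)₁) (a v)₀`. -/
def YD.toDouble : YD k A ⥤ LMod k (Double k A) where
  obj M := ⟨M.toLMod.V, M.doubleAct⟩
  map f := ⟨f.hom.hom, doubleAct_natural f⟩

variable [FiniteDimensional k A]

/-- The coaction of `A` on a module over the double, `m ↦ ∑ eᵢ* m ⊗ eᵢ`, for a basis `eᵢ` of `A`. -/
def doubleCoact (M : LMod k (Double k A)) : M.V →ₗ[k] M.V ⊗[k] A :=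
  coactOfDual (M.act.comp (Double.inclDual k A)).toLinearMap

theorem coslice_doubleCoact (M : LMod k (Double k A)) (p : DualAlg k A) (m : M.V) :
    coslice M.V p (doubleCoact M m) = M.act (Double.inclDual k A p) m :=
  coslice_coactOfDual _ p m

variable (k A) in
/-- The functor from modules over the Drinfel'd double to Yetter-Drinfel'd modules, which is
inverse to `YD.toDouble`. -/
def YD.ofDouble : LMod k (Double k A) ⥤ YD k A where
  obj M :=
    { toLMod := (LMod.restrict (Double.incl k A)).obj M
      coact := doubleCoact M
      coassoc := coactOfDual_coassoc (M.act.comp (Double.inclDual k A))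
      counit_coact := coactOfDual_counit (M.act.comp (Double.inclDual k A))
      compat := (crossRel_iff (M.act.comp (Double.incl k A)) (doubleCoact M)).1 (by
        have := (Double.crossRel_incl k A).comp M.act
        rw [doubleCoact, dualOfCoact_coactOfDual]
        exact this) }
  map {M N} f :=
    { hom := (LMod.restrict (Double.incl k A)).map f
      comm := fun m => coslice_ext fun p => by
        refine (coslice_rTensor p f.hom.hom (doubleCoact M m)).trans ?_
        refine (congrArg f.hom.hom (coslice_doubleCoact M p m)).trans ?_
        refine Eq.trans ?_ (coslice_doubleCoact N p (f.hom.hom m)).symm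
        exact f.comm _ _ }

end DoubleModules
end HopfCat

namespace HopfCat
open Coalgebra Bialgebra HopfAlgebra

section Transport

variable {k : Type u} [Field k] {A : Type u} [Ring A] [Bialgebra k A]

/-- Yetter-Drinfel'd structures can be transported along surjective linear maps. -/
def YD.transport (M : YD k A) (N : LMod k A) (ρ : N.V →ₗ[k] N.V ⊗[k] A)
    (φ : M.toLMod.V →ₗ[k] N.V) (hφ : Function.Surjective φ)
    (h1 : ∀ a m, φ (M.toLMod.act a m) = N.act a (φ m))
    (h2 : ∀ m, ρ (φ m) = φ.rTensor A (M.coact m)) : YD k A where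
  toLMod := N
  coact := ρ
  coassoc n := by
    obtain ⟨m, rfl⟩ := hφ n
    have e1 : ∀ t : M.toLMod.V ⊗[k] A, TensorProduct.assoc k N.V A A
        (ρ.rTensor A (φ.rTensor A t)) = φ.rTensor (A ⊗[k] A)
          (TensorProduct.assoc k M.toLMod.V A A (M.coact.rTensor A t)) := by
      intro t
      induction t with
      | zero => simp
      | add x y hx hy => simp only [map_add, hx, hy]
      | tmul m a =>
        simp only [LinearMap.rTensor_tmul, h2]
        generalize M.coact m = s
        induction s with
        | zero => simp
        | add x y hx hy => simp only [map_add, TensorProduct.add_tmul, hx, hy]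
        | tmul m b => simp
    have e2 : ∀ t : M.toLMod.V ⊗[k] A, comul.lTensor N.V (φ.rTensor A t) =
        φ.rTensor (A ⊗[k] A) (comul.lTensor M.toLMod.V t) := by
      intro t
      induction t with
      | zero => simp
      | add x y hx hy => simp only [map_add, hx, hy]
      | tmul m a => simp
    rw [h2, e1, M.coassoc, e2]
  counit_coact n := by
    obtain ⟨m, rfl⟩ := hφ n
    have e2 : ∀ t : M.toLMod.V ⊗[k] A, counit.lTensor N.V (φ.rTensor A t) =
        φ.rTensor k (counit.lTensor M.toLMod.V t) := by
      intro t
      induction t with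
      | zero => simp
      | add x y hx hy => simp only [map_add, hx, hy]
      | tmul m a => simp
    rw [h2, e2, M.counit_coact, LinearMap.rTensor_tmul]
  compat a n := by
    obtain ⟨m, rfl⟩ := hφ n
    have e1 : ∀ (t : A ⊗[k] A) (s : M.toLMod.V ⊗[k] A),
        outerAct N.act (Algebra.lmul k A) t (φ.rTensor A s) =
        φ.rTensor A (outerAct M.toLMod.act (Algebra.lmul k A) t s) := fun t s =>
      (outerAct_comm (φ := φ) (ψ := LinearMap.id) h1 (fun _ _ => rfl) t s).symm
    have e2 : ∀ (t : A ⊗[k] A), coactAfter N.act ρ (φ m) t =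
        φ.rTensor A (coactAfter M.toLMod.act M.coact m t) := by
      intro t
      induction t with
      | zero => simp
      | add x y hx hy => simp only [map_add, hx, hy]
      | tmul a b =>
        rw [coactAfter_tmul, coactAfter_tmul, ← h1, h2]
        exact congr($((LinearMap.lTensor_comp_rTensor _ φ _).trans
          (LinearMap.rTensor_comp_lTensor _ φ _).symm) (M.coact (M.toLMod.act b m)))
    rw [h2, e1, M.compat, e2]

end Transport

section Schrodinger

variable (k : Type u) [Field k] (A : Type u) [Ring A] [HopfAlgebra k A]

/-- The antipode, as a homomorphism from `A` to the opposite algebra. -/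
def antipodeOp : A →ₐ[k] Aᵐᵒᵖ :=
  AlgHom.ofLinearMap ((MulOpposite.opLinearEquiv k).toLinearMap ∘ₗ antipode k)
    (by simp) (fun a b => by simp [antipode_mul_antidistrib])

/-- The action `h b = b S(h)`. -/
def rightAntipodeAct : A →ₐ[k] Module.End k A :=
  (Algebra.lsmul k k A : Aᵐᵒᵖ →ₐ[k] Module.End k A).comp (antipodeOp k A)

variable {k A} in
theorem rightAntipodeAct_apply (h b : A) :
    rightAntipodeAct k A h b = b * antipode k h := rfl

theorem adjoint_commute (a b : A) : Commute (Algebra.lmul k A a) (rightAntipodeAct k A b) := by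
  ext x
  simp [rightAntipodeAct_apply, mul_assoc]

/-- The adjoint action `h b = ∑ h₁ b S(h₂)` of `A` on itself. -/
def adjointAct : A →ₐ[k] Module.End k A :=
  convHom (Algebra.lmul k A) (rightAntipodeAct k A) (adjoint_commute k A)

variable [HasBijectiveAntipode k A]

/-- The coaction `b ↦ ∑ b₂ ⊗ S⁻¹(b₁)` of `A` on itself. -/
def schrodingerCoact : A →ₗ[k] A ⊗[k] A :=
  (antipodeInv k).lTensor A ∘ₗ (TensorProduct.comm k A A).toLinearMap ∘ₗ comul

/-- The vector space `A` as a Yetter-Drinfel'd module, with the adjoint action and the coaction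
`b ↦ ∑ b₂ ⊗ S⁻¹(b₁)`. -/
def schrodingerYD : YD k A :=
  YD.transport ((radford k A).obj (𝟙_ (LMod k A))) ⟨ModuleCat.of k A, adjointAct k A⟩
    (schrodingerCoact k A) (antipode k ∘ₗ (TensorProduct.lid k A).toLinearMap)
    (fun a => ⟨1 ⊗ₜ antipodeInv k a, (congrArg (antipode k) (TensorProduct.lid_tmul _ _)).trans
      (by simp)⟩)
    (fun h (t : k ⊗[k] A) => by
      let φ := antipode k ∘ₗ (TensorProduct.lid k A).toLinearMap
      have e1 : ∀ (h : A) (t : k ⊗[k] A), φ (rightInvAct k A k h t) = h * φ t := by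
        intro h t
        induction t with
        | zero => simp
        | add x y hx hy => simp only [map_add, mul_add, hx, hy]
        | tmul c a => simp [φ, rightInvAct_tmul, antipode_mul_antidistrib]
      have e2 : ∀ (h : A) (t : k ⊗[k] A), φ (diagAct (trivAct k A) (Algebra.lmul k A) h t) =
          φ t * antipode k h := by
        intro h t
        refine (congrArg (antipode k) (diagAct_lid (Algebra.lmul k A) h t)).trans ?_
        simp [φ, antipode_mul_antidistrib]
      have e3 : ∀ s : A ⊗[k] A, φ (Algebra.TensorProduct.lift _ _
          (rightInvAct_commute (trivAct k A)) s t) =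
          Algebra.TensorProduct.lift _ _ (adjoint_commute k A) s (φ t) := by
        intro s
        induction s with
        | zero => simp
        | add x y hx hy => simp only [map_add, LinearMap.add_apply, hx, hy]
        | tmul a b => simp [e1, e2, rightAntipodeAct_apply]
      exact e3 (comul h))
    (fun (t : k ⊗[k] A) => by
      let φ := antipode k ∘ₗ (TensorProduct.lid k A).toLinearMap
      change (antipodeInv k).lTensor A (TensorProduct.comm k A A (comul (φ t))) =
        φ.rTensor A (radfordCoact k A k t)
      induction t with
      | zero => simp
      | add x y hx hy => simp only [map_add, hx, hy]
      | tmul c a =>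
        rw [radfordCoact_tmul]
        have : φ (c ⊗ₜ a) = c • antipode k a := by simp [φ]
        rw [this, map_smul, comul_antipode]
        generalize (comul a : A ⊗[k] A) = s
        induction s with
        | zero => simp
        | add x y hx hy => simp only [map_add, smul_add, TensorProduct.tmul_add, hx, hy]
        | tmul a b => simp [φ, TensorProduct.smul_tmul'])

/-- The Schrödinger module over the Drinfel'd double: the vector space `A` with the action
`(p ⊗ a) b = ∑ p(S⁻¹(x₁)) x₂`, where `x = ∑ a₁ b S(a₂)`. -/
def schrodinger : LMod k (Double k A) := (YD.toDouble k A).obj (schrodingerYD k A)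

theorem schrodinger_act_mk (p : DualAlg k A) (a b : A) :
    (schrodinger k A).act (Double.mk k A p a) b =
      coslice A p (schrodingerCoact k A (adjointAct k A a b)) :=
  YD.doubleAct_mk (schrodingerYD k A) p a b

end Schrodinger

section Restriction

variable {k : Type u} [Field k] {A : Type u} [Ring A] [HopfAlgebra k A] [HasBijectiveAntipode k A]
  [FiniteDimensional k A]

variable (k A) in
/-- The restriction functor from modules over the double to modules over `A`. -/
abbrev restrictDouble : LMod k (Double k A) ⥤ LMod k A := LMod.restrict (Double.incl k A)

theorem restrict_diagAct (M N : LMod k (Double k A)) (a : A) (t : M.V ⊗[k] N.V) :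
    diagAct M.act N.act (Double.incl k A a) t =
      diagAct (M.act.comp (Double.incl k A)) (N.act.comp (Double.incl k A)) a t := by
  rw [diagAct_apply, diagAct_apply, Double.comul_incl]
  generalize (comul a : A ⊗[k] A) = s
  induction s with
  | zero => simp
  | add x y hx hy => simp only [map_add, LinearMap.add_apply, hx, hy]
  | tmul a b => simp

variable (k A) in
/-- The unit isomorphism of the restriction functor, the identity of `k`. -/
def restrictUnitIso : 𝟙_ (LMod k A) ≅ (restrictDouble k A).obj (𝟙_ (LMod k (Double k A))) :=
  LMod.isoMk (Iso.refl _) (fun a (c : k) => by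
    refine (trivAct_apply a c).trans ?_
    refine Eq.trans ?_ (trivAct_apply (Double.incl k A a) c).symm
    rw [Double.counit_incl])

/-- The tensor isomorphism of the restriction functor, the identity of `M ⊗ N`. -/
def restrictTensorIso (M N : LMod k (Double k A)) :
    (restrictDouble k A).obj M ⊗ (restrictDouble k A).obj N ≅ (restrictDouble k A).obj (M ⊗ N) :=
  LMod.isoMk (Iso.refl _) (fun a t => (restrict_diagAct M N a t).symm)

theorem restrictUnitIso_hom : (restrictUnitIso k A).hom.hom = 𝟙 (𝟙_ (ModuleCat.{u} k)) := rfl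

theorem restrictTensorIso_hom (M N : LMod k (Double k A)) :
    (restrictTensorIso M N).hom.hom = 𝟙 (M.V ⊗ N.V) := rfl

theorem restrict_map_hom {M N : LMod k (Double k A)} (f : M ⟶ N) :
    ((restrictDouble k A).map f).hom = f.hom := rfl

theorem restrict_obj_V (M : LMod k (Double k A)) : ((restrictDouble k A).obj M).V = M.V := rfl

theorem restrict_natural_left {M N : LMod k (Double k A)} (f : M ⟶ N) (P : LMod k (Double k A)) :
    (restrictDouble k A).map f ▷ (restrictDouble k A).obj P ≫ (restrictTensorIso N P).hom =
      (restrictTensorIso M P).hom ≫ (restrictDouble k A).map (f ▷ P) :=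
  LMod.hom_ext ((Category.comp_id (f.hom ▷ P.V)).trans (Category.id_comp (f.hom ▷ P.V)).symm)

theorem restrict_natural_right {M N : LMod k (Double k A)} (P : LMod k (Double k A)) (f : M ⟶ N) :
    (restrictDouble k A).obj P ◁ (restrictDouble k A).map f ≫ (restrictTensorIso P N).hom =
      (restrictTensorIso P M).hom ≫ (restrictDouble k A).map (P ◁ f) :=
  LMod.hom_ext ((Category.comp_id (P.V ◁ f.hom)).trans (Category.id_comp (P.V ◁ f.hom)).symm)

theorem restrict_assoc (M N P : LMod k (Double k A)) :
    (restrictTensorIso M N).hom ▷ (restrictDouble k A).obj P ≫ (restrictTensorIso (M ⊗ N) P).hom ≫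
        (restrictDouble k A).map (α_ M N P).hom =
      (α_ ((restrictDouble k A).obj M) ((restrictDouble k A).obj N)
        ((restrictDouble k A).obj P)).hom ≫
        (restrictDouble k A).obj M ◁ (restrictTensorIso N P).hom ≫
          (restrictTensorIso M (N ⊗ P)).hom := by
  have h : 𝟙 (M.V ⊗ N.V) ▷ P.V ≫ 𝟙 ((M.V ⊗ N.V) ⊗ P.V) ≫ (α_ M.V N.V P.V).hom =
      (α_ M.V N.V P.V).hom ≫ M.V ◁ 𝟙 (N.V ⊗ P.V) ≫ 𝟙 (M.V ⊗ (N.V ⊗ P.V)) := by simp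
  exact LMod.hom_ext h

theorem restrict_left_unit (M : LMod k (Double k A)) :
    (λ_ ((restrictDouble k A).obj M)).hom =
      (restrictUnitIso k A).hom ▷ (restrictDouble k A).obj M ≫
        (restrictTensorIso (𝟙_ (LMod k (Double k A))) M).hom ≫ (restrictDouble k A).map (λ_ M).hom := by
  have h : (λ_ M.V).hom = 𝟙 (𝟙_ (ModuleCat.{u} k)) ▷ M.V ≫ 𝟙 (𝟙_ (ModuleCat.{u} k) ⊗ M.V) ≫
      (λ_ M.V).hom := by simp
  exact LMod.hom_ext h

theorem restrict_right_unit (M : LMod k (Double k A)) :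
    (ρ_ ((restrictDouble k A).obj M)).hom =
      (restrictDouble k A).obj M ◁ (restrictUnitIso k A).hom ≫
        (restrictTensorIso M (𝟙_ (LMod k (Double k A)))).hom ≫ (restrictDouble k A).map (ρ_ M).hom := by
  have h : (ρ_ M.V).hom = M.V ◁ 𝟙 (𝟙_ (ModuleCat.{u} k)) ≫ 𝟙 (M.V ⊗ 𝟙_ (ModuleCat.{u} k)) ≫
      (ρ_ M.V).hom := by simp
  exact LMod.hom_ext h

/-- The restriction functor is monoidal, with the identity maps as its structure maps. -/
instance : (restrictDouble k A).Monoidal :=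
  Functor.CoreMonoidal.toMonoidal
    { εIso := restrictUnitIso k A
      μIso := restrictTensorIso
      μIso_hom_natural_left := restrict_natural_left
      μIso_hom_natural_right := restrict_natural_right
      associativity := restrict_assoc
      left_unitality := restrict_left_unit
      right_unitality := restrict_right_unit }

end Restriction

section Braiding

variable {k : Type u} [Field k] {A : Type u} [Ring A] [HopfAlgebra k A] [HasBijectiveAntipode k A]
  [FiniteDimensional k A]

variable (k A) in
/-- The map `coslice`, as a linear map in the linear form. -/
def cosliceLin (V : Type u) [AddCommGroup V] [Module k V] :
    DualAlg k A →ₗ[k] (V ⊗[k] A →ₗ[k] V) :=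
  (TensorProduct.rid k V).toLinearMap.compRight k ∘ₗ LinearMap.lTensorHom V ∘ₗ
    dualEv.toLinearMap

theorem cosliceLin_apply (V : Type u) [AddCommGroup V] [Module k V] (p : DualAlg k A) :
    cosliceLin k A V p = coslice V p := rfl

theorem coslice_tensorCoact {V W : Type u} [AddCommGroup V] [Module k V] [AddCommGroup W]
    [Module k W] (ρ : V →ₗ[k] V ⊗[k] A) (σ : W →ₗ[k] W ⊗[k] A) (p : DualAlg k A) (v : V) (w : W) :
    coslice (V ⊗[k] W) p (tensorCoact ρ σ (v ⊗ₜ w)) = TensorProduct.homTensorHomMap (RingHom.id k) _ _ _ _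
      (TensorProduct.map (cosliceLin k A V) (cosliceLin k A W) (dualCopComul k A p))
        (ρ v ⊗ₜ σ w) := by
  have h0 : ∀ (t : DualAlg k A ⊗[k] DualAlg k A) (v : V) (w : W) (a b : A),
      TensorProduct.homTensorHomMap (RingHom.id k) _ _ _ _
        (TensorProduct.map (cosliceLin k A V) (cosliceLin k A W) t) ((v ⊗ₜ a) ⊗ₜ (w ⊗ₜ b)) =
      dualEv (sliceEquiv k A _ t a) b • (v ⊗ₜ[k] w) := by
    intro t v w a b
    induction t with
    | zero => simp
    | add x y hx hy => simp only [map_add, LinearMap.add_apply, add_smul, hx, hy]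
    | tmul p q =>
      simp [cosliceLin_apply, TensorProduct.smul_tmul', TensorProduct.tmul_smul, smul_smul,
        mul_comm]
  change coslice (V ⊗[k] W) p (TensorProduct.map LinearMap.id
    (LinearMap.mul' k A ∘ₗ (TensorProduct.comm k A A).toLinearMap)
    (TensorProduct.tensorTensorTensorComm k V A W A (ρ v ⊗ₜ σ w))) = _
  generalize ρ v = s
  generalize σ w = t
  induction s with
  | zero => simp
  | add x y hx hy => simp only [map_add, TensorProduct.add_tmul, hx, hy]
  | tmul v a =>
    induction t with
    | zero => simp
    | add x y hx hy => simp only [map_add, TensorProduct.tmul_add, hx, hy]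
    | tmul w b =>
      rw [h0, slice_dualCopComul]
      simp

theorem doubleCoact_tensor (M N : LMod k (Double k A)) :
    doubleCoact (M ⊗ N) = tensorCoact (doubleCoact M) (doubleCoact N) := by
  apply TensorProduct.ext'
  intro m n
  refine coslice_ext fun p => ?_
  refine Eq.trans ?_ (coslice_tensorCoact (doubleCoact M) (doubleCoact N) p m n).symm
  refine (coslice_doubleCoact (M ⊗ N) p _).trans ?_
  change outerAct M.act N.act (comul (Double.inclDual k A p)) (m ⊗ₜ n) = _
  rw [Double.comul_inclDual]
  generalize dualCopComul k A p = t
  induction t with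
  | zero => simp
  | add x y hx hy => simp only [map_add, LinearMap.add_apply, hx, hy]
  | tmul p q => simp [cosliceLin_apply, coslice_doubleCoact]

theorem double_braid_linear (M N : LMod k (Double k A)) (x : Double k A) (t : M.V ⊗[k] N.V) :
    coactBraid (M.act.comp (Double.incl k A)) (doubleCoact N) (diagAct M.act N.act x t) =
      diagAct N.act M.act x (coactBraid (M.act.comp (Double.incl k A)) (doubleCoact N) t) := by
  induction x using Double.induction generalizing t with
  | zero => simp
  | add x y hx hy => simp only [map_add, LinearMap.add_apply, hx, hy]
  | mk p a =>
    have h1 : ∀ t, coactBraid (M.act.comp (Double.incl k A)) (doubleCoact N)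
        (diagAct M.act N.act (Double.incl k A a) t) = diagAct N.act M.act (Double.incl k A a)
          (coactBraid (M.act.comp (Double.incl k A)) (doubleCoact N) t) := by
      intro t
      rw [restrict_diagAct, restrict_diagAct]
      exact coactBraid_linear ((YD.ofDouble k A).obj N).compat _ a t
    have h2 : ∀ t, coactBraid (M.act.comp (Double.incl k A)) (doubleCoact N)
        (diagAct M.act N.act (Double.inclDual k A p) t) =
          diagAct N.act M.act (Double.inclDual k A p)
          (coactBraid (M.act.comp (Double.incl k A)) (doubleCoact N) t) := by
      intro t
      refine (congrArg (coactBraid (M.act.comp (Double.incl k A)) (doubleCoact N))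
        (coslice_doubleCoact (M ⊗ N) p t).symm).trans ?_
      refine Eq.trans ?_ (coslice_doubleCoact (N ⊗ M) p _)
      rw [doubleCoact_tensor, doubleCoact_tensor]
      refine (coslice_rTensor p _ _).symm.trans (congrArg (coslice _ p) ?_)
      exact coactBraid_colinear ((YD.ofDouble k A).obj M).compat
        ((YD.ofDouble k A).obj N).coassoc t
    rw [Double.mk_eq, map_mul, map_mul, Module.End.mul_apply, Module.End.mul_apply, h2, h1]

/-- The braiding of two modules over the double. -/
def doubleBraiding (M N : LMod k (Double k A)) : M ⊗ N ≅ N ⊗ M :=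
  LMod.isoMk
    { hom := ModuleCat.ofHom (coactBraid (M.act.comp (Double.incl k A)) (doubleCoact N))
      inv := ModuleCat.ofHom (coactBraidInv (M.act.comp (Double.incl k A)) (doubleCoact N))
      hom_inv_id := ModuleCat.hom_ext (LinearMap.ext
        (coactBraidInv_coactBraid ((YD.ofDouble k A).obj N).coassoc
          ((YD.ofDouble k A).obj N).counit_coact _))
      inv_hom_id := ModuleCat.hom_ext (LinearMap.ext
        (coactBraid_inv ((YD.ofDouble k A).obj N).coassoc
          ((YD.ofDouble k A).obj N).counit_coact _)) }
    (double_braid_linear M N)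

/-- The braiding `m ⊗ n ↦ ∑ eᵢ* n ⊗ eᵢ m` of modules over the double, which is given by the
universal `R`-matrix `∑ (ε ⊗ eᵢ) ⊗ (eᵢ* ⊗ 1)`. -/
theorem doubleBraiding_tmul (M N : LMod k (Double k A)) (m : M.V) (n : N.V) :
    (doubleBraiding M N).hom.hom (m ⊗ₜ[k] n) = ∑ i,
      N.act (Double.inclDual k A (dualEv.symm ((Module.finBasis k A).coord i))) n ⊗ₜ[k]
        M.act (Double.incl k A (Module.finBasis k A i)) m := by
  refine (coactBraid_tmul (M.act.comp (Double.incl k A)) (doubleCoact N) m n).trans ?_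
  simp [doubleCoact, coactOfDual, LinearMap.sum_apply]

instance : BraidedCategory (LMod k (Double k A)) where
  braiding := doubleBraiding
  braiding_naturality_right M N P f := LMod.hom_ext (ModuleCat.hom_ext (LinearMap.ext
    (coactBraid_natural' (M.act.comp (Double.incl k A)) f.hom.hom
      ((YD.ofDouble k A).map f).comm)))
  braiding_naturality_left {M N} f P := LMod.hom_ext (ModuleCat.hom_ext (LinearMap.ext
    (coactBraid_natural (doubleCoact P) f.hom.hom (fun a m => f.comm _ m))))
  hexagon_forward M N P := LMod.hom_ext (ModuleCat.hom_ext (LinearMap.ext fun t => by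
    have := (LinearEquiv.eq_symm_apply _).1 (coactBraid_tensorCoact (doubleCoact N)
      (doubleCoact P) (M.act.comp (Double.incl k A)) t)
    rw [← doubleCoact_tensor] at this
    exact this))
  hexagon_reverse M N P := LMod.hom_ext (ModuleCat.hom_ext (LinearMap.ext
    fun (t : M.V ⊗[k] (N.V ⊗[k] P.V)) => by
    have h := coactBraid_tensor (ρ := doubleCoact P) ((YD.ofDouble k A).obj P).coassoc
      (M.act.comp (Double.incl k A)) (N.act.comp (Double.incl k A))
      ((TensorProduct.assoc k _ _ _).symm t)
    rw [LinearEquiv.apply_symm_apply] at h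
    have e : (M ⊗ N).act.comp (Double.incl k A) =
        diagAct (M.act.comp (Double.incl k A)) (N.act.comp (Double.incl k A)) :=
      AlgHom.ext fun a => LinearMap.ext (restrict_diagAct M N a)
    rw [← e] at h
    exact (LinearEquiv.symm_apply_eq _).2 h))

end Braiding
end HopfCat

namespace HopfCat
open Coalgebra Bialgebra HopfAlgebra

section MonoidalFunctors

universe v₁ v₂ v₃ v₁' v₂' u₁ u₂ u₃ u₁' u₂'

/-- A (strong) monoidal functor, bundled with its structure maps. -/
structure MonFunctor (C : Type u₁) [Category.{v₁} C] [MonoidalCategory C] (D : Type u₂)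
    [Category.{v₂} D] [MonoidalCategory D] where
  functor : C ⥤ D
  monoidal : functor.Monoidal

namespace MonFunctor

attribute [instance] MonFunctor.monoidal

variable {C : Type u₁} [Category.{v₁} C] [MonoidalCategory C] {D : Type u₂}
    [Category.{v₂} D] [MonoidalCategory D] {E : Type u₃} [Category.{v₃} E] [MonoidalCategory E]

/-- A functor with a monoidal structure, as a bundled monoidal functor. -/
def of (F : C ⥤ D) [F.Monoidal] : MonFunctor C D := ⟨F, inferInstance⟩

/-- The composition of monoidal functors: first `F`, then `G`. -/
def comp (F : MonFunctor C D) (G : MonFunctor D E) : MonFunctor C E :=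
  ⟨F.functor ⋙ G.functor, inferInstance⟩

/-- A monoidal functor is braided if it takes the braiding to the braiding. -/
def IsBraided [BraidedCategory C] [BraidedCategory D] (F : MonFunctor C D) : Prop :=
  ∀ X Y : C, Functor.LaxMonoidal.μ F.functor X Y ≫ F.functor.map (β_ X Y).hom =
    (β_ (F.functor.obj X) (F.functor.obj Y)).hom ≫ Functor.LaxMonoidal.μ F.functor Y X

/-- A monoidal functor is an equivalence of `k`-linear monoidal categories if it is `k`-linear and
an equivalence of categories. -/
structure IsLinearEquivalence (k : Type u) [Field k] [Preadditive C] [Linear k C] [Preadditive D]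
    [Linear k D] (F : MonFunctor C D) : Prop where
  additive : F.functor.Additive
  linear : F.functor.Linear k
  isEquivalence : F.functor.IsEquivalence

/-- Let `F : C ⥤ D` be a monoidal functor, and let `C'` and `D'` be braided monoidal categories with
monoidal functors `R : C' ⥤ C` and `R' : D' ⥤ D`. The equivalence `G : C' ⥤ D'` of `k`-linear
braided monoidal categories lifts `F` if `R' ∘ G = F ∘ R` as monoidal functors. -/
structure IsBraidedLift (k : Type u) [Field k] {C' : Type u₁'} [Category.{v₁'} C']
    [MonoidalCategory C'] [BraidedCategory C'] [Preadditive C'] [Linear k C']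
    {D' : Type u₂'} [Category.{v₂'} D'] [MonoidalCategory D'] [BraidedCategory D'] [Preadditive D']
    [Linear k D'] (R : MonFunctor C' C) (R' : MonFunctor D' D) (F : MonFunctor C D)
    (G : MonFunctor C' D') : Prop where
  isLinearEquivalence : G.IsLinearEquivalence k
  isBraided : G.IsBraided
  comp_eq : G.comp R' = R.comp F

end MonFunctor

/-- An object `S` of the center of `C` is a Schrödinger object if there is a bijection, natural in
`X`, between the morphisms `X ⟶ S` in the center and the morphisms `Π(X) ⟶ 𝟙` in `C`, for the
forgetful functor `Π`. -/
def IsSchrodingerObject {C : Type u₁} [Category.{v₁} C] [MonoidalCategory C] (S : Center C) :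
    Prop :=
  Nonempty (((Center.forget C).op ⋙ yoneda.obj (𝟙_ C)).RepresentableBy S)

end MonoidalFunctors

section Center

variable {k : Type u} [Field k] {A : Type u} [Ring A] [HopfAlgebra k A]

theorem YD.halfBraid_tensor (V : YD k A) (X Y : LMod k A) :
    (YD.halfBraid (X ⊗ Y) V).hom = (α_ X Y V.toLMod).hom ≫ X ◁ (YD.halfBraid Y V).hom ≫
      (α_ X V.toLMod Y).inv ≫ (YD.halfBraid X V).hom ▷ Y ≫ (α_ V.toLMod X Y).hom :=
  LMod.hom_ext (ModuleCat.hom_ext (LinearMap.ext (coactBraid_tensor V.coassoc X.act Y.act)))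

theorem YD.halfBraid_natural (V : YD k A) {X Y : LMod k A} (f : X ⟶ Y) :
    f ▷ V.toLMod ≫ (YD.halfBraid Y V).hom = (YD.halfBraid X V).hom ≫ V.toLMod ◁ f :=
  LMod.hom_ext (ModuleCat.hom_ext (LinearMap.ext (coactBraid_natural V.coact f.hom.hom f.comm)))

theorem YD.halfBraid_natural_right {V W : YD k A} (f : V ⟶ W) (X : LMod k A) :
    X ◁ f.hom ≫ (YD.halfBraid X W).hom = (YD.halfBraid X V).hom ≫ f.hom ▷ X :=
  LMod.hom_ext (ModuleCat.hom_ext (LinearMap.ext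
    (coactBraid_natural' X.act f.hom.hom.hom f.comm)))

/-- The half-braiding `V ⊗ X ≅ X ⊗ V` of a Yetter-Drinfel'd module: it is inverse to
`x ⊗ v ↦ ∑ v₀ ⊗ v₁ x`. -/
def YD.halfBraiding (V : YD k A) : HalfBraiding V.toLMod where
  β X := (YD.halfBraid X V).symm
  monoidal X Y := by
    change (YD.halfBraid (X ⊗ Y) V).inv = (α_ _ _ _).inv ≫ (YD.halfBraid X V).inv ▷ Y ≫
      (α_ _ _ _).hom ≫ X ◁ (YD.halfBraid Y V).inv ≫ (α_ _ _ _).inv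
    rw [← cancel_epi (YD.halfBraid (X ⊗ Y) V).hom, Iso.hom_inv_id, YD.halfBraid_tensor]
    simp [← comp_whiskerRight_assoc, ← MonoidalCategory.whiskerLeft_comp_assoc]
  naturality {X Y} f := by
    rw [Iso.symm_hom, Iso.symm_hom, Iso.comp_inv_eq, Category.assoc, YD.halfBraid_natural,
      Iso.inv_hom_id_assoc]

variable (k A) in
/-- The functor from Yetter-Drinfel'd modules to the center of the category of modules. -/
def YD.toCenter : YD k A ⥤ Center (LMod k A) where
  obj V := ⟨V.toLMod, V.halfBraiding⟩
  map {V W} f := ⟨f.hom, fun X => by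
    change f.hom ▷ X ≫ (YD.halfBraid X W).inv = (YD.halfBraid X V).inv ≫ X ◁ f.hom
    rw [Iso.comp_inv_eq, Category.assoc, YD.halfBraid_natural_right, Iso.inv_hom_id_assoc]⟩

/-- The coaction can be recovered from the half-braiding, as the image of `1 ⊗ v`. -/
theorem YD.coact_eq_halfBraiding (V : YD k A) (v : V.toLMod.V) :
    (V.halfBraiding.β ⟨ModuleCat.of k A, Algebra.lmul k A⟩).inv.hom ((1 : A) ⊗ₜ[k] v) =
      V.coact v :=
  coactBraid_one V.coact v

variable (k A) in
/-- The functor from modules over the double to the center of the category of `A`-modules. A module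
`M` over the double is sent to its restriction to `A`, with the half-braiding which is inverse to
`x ⊗ m ↦ ∑ eᵢ* m ⊗ eᵢ x`. -/
def doubleToCenter [HasBijectiveAntipode k A] [FiniteDimensional k A] :
    LMod k (Double k A) ⥤ Center (LMod k A) :=
  YD.ofDouble k A ⋙ YD.toCenter k A

variable (k A) in
/-- Radford's induction functor from `A`-modules to modules over the double. -/
def inductionDouble [HasBijectiveAntipode k A] : LMod k A ⥤ LMod k (Double k A) :=
  radford k A ⋙ YD.toDouble k A

end Center

end HopfCat

namespace HopfCat
open Coalgebra Bialgebra HopfAlgebra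

/-! The antipode of a finite-dimensional Hopf algebra is bijective. -/

section Integral

variable {k : Type u} [Field k] {A : Type u} [Ring A] [HopfAlgebra k A]

variable (k A) in
/-- The right action `(p a)(x) = p(x S(a))` of `A` on `A*`. -/
def dualRight : A →ₗ[k] Module.End k (DualAlg k A) := dualPost k A ∘ₗ antipode k

theorem dualRight_apply (a : A) (p : DualAlg k A) (x : A) :
    dualEv (dualRight k A a p) x = dualEv p (x * antipode k a) := rfl

theorem dualRight_mul (a b : A) (p : DualAlg k A) :
    dualRight k A (a * b) p = dualRight k A b (dualRight k A a p) := by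
  refine DualAlg.ext fun x => ?_
  simp [dualRight_apply, antipode_mul_antidistrib, mul_assoc]

theorem dualRight_one (p : DualAlg k A) : dualRight k A 1 p = p := by
  refine DualAlg.ext fun x => ?_
  simp [dualRight_apply]

/-- The map `x ⊗ y ↦ p(y) x`. -/
def evalRight (p : DualAlg k A) : A ⊗[k] A →ₗ[k] A :=
  (TensorProduct.rid k A).toLinearMap ∘ₗ (dualEv p).lTensor A

@[simp] theorem evalRight_tmul (p : DualAlg k A) (x y : A) :
    evalRight p (x ⊗ₜ y) = dualEv p y • x := by
  simp [evalRight]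

theorem evalRight_comul_antipode (p : DualAlg k A) (u : A ⊗[k] A) (a : A) :
    TensorProduct.lift ((LinearMap.mul k A ∘ₗ evalRight p ∘ₗ LinearMap.mulLeft k u ∘ₗ comul ∘ₗ
      antipode k)) (comul a) = evalRight p (u * (1 ⊗ₜ antipode k a)) := by
  let Y : A ⊗[k] (A ⊗[k] A) →ₗ[k] A := evalRight p ∘ₗ LinearMap.mulLeft k u ∘ₗ
    (TensorProduct.comm k A A).toLinearMap ∘ₗ
    TensorProduct.map (antipode k) (LinearMap.mul' k A ∘ₗ (antipode k).rTensor A)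
  have h0 : ∀ (x d c : A), evalRight p (u * (d ⊗ₜ x)) * c = evalRight p (u * ((d * c) ⊗ₜ x)) := by
    intro x d c
    induction u with
    | zero => simp
    | add x y hx hy => simp only [add_mul, map_add, hx, hy]
    | tmul y z => simp [mul_assoc]
  have h1 : ∀ t : A ⊗[k] A, TensorProduct.lift ((LinearMap.mul k A ∘ₗ evalRight p ∘ₗ
      LinearMap.mulLeft k u ∘ₗ comul ∘ₗ antipode k)) t =
      Y (TensorProduct.assoc k A A A (comul.rTensor A t)) := by
    intro t
    induction t with
    | zero => simp
    | add x y hx hy => simp only [map_add, hx, hy]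
    | tmul b c =>
      simp only [TensorProduct.lift.tmul, LinearMap.comp_apply, LinearMap.mul_apply',
        LinearMap.mulLeft_apply, comul_antipode, LinearMap.rTensor_tmul]
      generalize (comul b : A ⊗[k] A) = s
      induction s with
      | zero => simp
      | add x y hx hy => simp only [map_add, mul_add, add_mul, TensorProduct.add_tmul, hx, hy]
      | tmul b d => simp [Y, h0]
  have h2 : ∀ t : A ⊗[k] A, Y (comul.lTensor A t) =
      evalRight p (u * (1 ⊗ₜ antipode k (TensorProduct.rid k A (counit.lTensor A t)))) := by
    intro t
    induction t with
    | zero => simp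
    | add x y hx hy => simp only [map_add, TensorProduct.tmul_add, mul_add, hx, hy]
    | tmul b c =>
      simp [Y, mul_antipode_rTensor_comul_apply, Algebra.algebraMap_eq_smul_one,
        TensorProduct.smul_tmul']
  rw [h1, coassoc_apply, h2, lTensor_counit_comul]
  simp

variable [FiniteDimensional k A]

variable (k A) in
/-- The coaction of `A` on `A*` with `∑ p₀(x) p₁ = ∑ p(x₂) x₁`. -/
def dualCoaction : DualAlg k A →ₗ[k] DualAlg k A ⊗[k] A :=
  (sliceEquiv k A A).symm.toLinearMap ∘ₗ LinearMap.lcomp k A comul ∘ₗ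
    ((TensorProduct.rid k A).toLinearMap.compRight k ∘ₗ LinearMap.lTensorHom A ∘ₗ
      dualEv.toLinearMap)

theorem slice_dualCoaction (p : DualAlg k A) (x : A) :
    sliceEquiv k A A (dualCoaction k A p) x = evalRight p (comul x) := by
  simp only [dualCoaction, LinearMap.comp_apply, LinearEquiv.coe_coe, LinearEquiv.apply_symm_apply]
  rfl

theorem dualCoaction_coassoc (p : DualAlg k A) :
    TensorProduct.assoc k _ A A ((dualCoaction k A).rTensor A (dualCoaction k A p)) =
      comul.lTensor _ (dualCoaction k A p) := by
  apply slice_ext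
  intro x
  have h1 : ∀ t : DualAlg k A ⊗[k] A, sliceEquiv k A (A ⊗[k] A)
      (TensorProduct.assoc k _ A A ((dualCoaction k A).rTensor A t)) x =
      (sliceEquiv k A A t).lTensor A (comul x) := by
    intro t
    induction t with
    | zero => simp
    | add y z hy hz => simp only [map_add, LinearMap.add_apply, LinearMap.lTensor_add, hy, hz]
    | tmul q a =>
      have h2 : ∀ s : DualAlg k A ⊗[k] A, sliceEquiv k A (A ⊗[k] A)
          (TensorProduct.assoc k _ A A (s ⊗ₜ a)) x = sliceEquiv k A A s x ⊗ₜ a := by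
        intro s
        induction s with
        | zero => simp
        | add y z hy hz => simp only [map_add, TensorProduct.add_tmul, LinearMap.add_apply, hy, hz]
        | tmul q b => simp [TensorProduct.smul_tmul']
      rw [LinearMap.rTensor_tmul, h2, slice_dualCoaction]
      generalize (comul x : A ⊗[k] A) = s
      induction s with
      | zero => simp
      | add y z hy hz => simp only [map_add, TensorProduct.add_tmul, hy, hz]
      | tmul y z => simp [TensorProduct.smul_tmul']
  have h3 : ∀ t : A ⊗[k] A, (sliceEquiv k A A (dualCoaction k A p)).lTensor A t =
      (TensorProduct.rid k (A ⊗[k] A)) ((dualEv p).lTensor (A ⊗[k] A)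
        ((TensorProduct.assoc k A A A).symm (comul.lTensor A t))) := by
    intro t
    induction t with
    | zero => simp
    | add y z hy hz => simp only [map_add, hy, hz]
    | tmul y z =>
      simp only [LinearMap.lTensor_tmul, slice_dualCoaction]
      generalize (comul z : A ⊗[k] A) = s
      induction s with
      | zero => simp
      | add y z hy hz => simp only [map_add, TensorProduct.tmul_add, hy, hz]
      | tmul y z => simp
  have h4 : ∀ t : A ⊗[k] A, (TensorProduct.rid k (A ⊗[k] A)) ((dualEv p).lTensor (A ⊗[k] A)
        (comul.rTensor A t)) = comul (evalRight p t) := by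
    intro t
    induction t with
    | zero => simp
    | add y z hy hz => simp only [map_add, hy, hz]
    | tmul y z => simp
  rw [h1, slice_lTensor, slice_dualCoaction, h3, coassoc_symm_apply, h4]

theorem dualCoaction_counit (p : DualAlg k A) :
    TensorProduct.rid k _ (counit.lTensor _ (dualCoaction k A p)) = p := by
  refine DualAlg.ext fun x => ?_
  have h1 : ∀ t : DualAlg k A ⊗[k] A, dualEv (TensorProduct.rid k _ (counit.lTensor _ t)) x =
      counit (R := k) (sliceEquiv k A A t x) := by
    intro t
    induction t with
    | zero => simp
    | add y z hy hz => simp only [map_add, LinearMap.add_apply, hy, hz]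
    | tmul q a => simp [mul_comm]
  have h2 : ∀ t : A ⊗[k] A, counit (R := k) (evalRight p t) =
      dualEv p (TensorProduct.lid k A (counit.rTensor A t)) := by
    intro t
    induction t with
    | zero => simp
    | add y z hy hz => simp only [map_add, hy, hz]
    | tmul y z => simp [mul_comm]
  rw [h1, slice_dualCoaction, h2, rTensor_counit_comul]
  simp

variable (k A) in
/-- The map which sends `p ⊗ a` and `b ⊗ c` to `p b ⊗ a c`. -/
def dualTwist : DualAlg k A ⊗[k] A →ₗ[k] A ⊗[k] A →ₗ[k] DualAlg k A ⊗[k] A :=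
  (TensorProduct.homTensorHomMap (RingHom.id k) _ _ _ _ ∘ₗ
    TensorProduct.map (dualRight k A) (LinearMap.mul k A).flip).flip

theorem dualTwist_tmul (s : DualAlg k A ⊗[k] A) (b c : A) :
    dualTwist k A s (b ⊗ₜ c) = TensorProduct.map (dualRight k A b) (LinearMap.mulRight k c) s := rfl

theorem dualTwist_tmul_tmul (p : DualAlg k A) (a b c : A) :
    dualTwist k A (p ⊗ₜ[k] a) (b ⊗ₜ c) = dualRight k A b p ⊗ₜ (a * c) := rfl

theorem dualCoaction_dualRight (p : DualAlg k A) (a : A) :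
    dualCoaction k A (dualRight k A a p) = dualTwist k A (dualCoaction k A p) (comul a) := by
  apply slice_ext
  intro x
  have h1 : ∀ (s : DualAlg k A ⊗[k] A) (b c : A), sliceEquiv k A A (dualTwist k A s (b ⊗ₜ c)) x =
      sliceEquiv k A A s (x * antipode k b) * c := by
    intro s b c
    induction s with
    | zero => simp [dualTwist_tmul]
    | add y z hy hz =>
      simp only [dualTwist_tmul] at hy hz ⊢
      simp only [map_add, LinearMap.add_apply, add_mul, hy, hz]
    | tmul q d => simp [dualTwist_tmul_tmul, dualRight_apply]
  have h2 : ∀ t : A ⊗[k] A, sliceEquiv k A A (dualTwist k A (dualCoaction k A p) t) x =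
      TensorProduct.lift ((LinearMap.mul k A ∘ₗ evalRight p ∘ₗ LinearMap.mulLeft k (comul x) ∘ₗ
      comul ∘ₗ antipode k)) t := by
    intro t
    induction t with
    | zero => simp
    | add y z hy hz => simp only [map_add, LinearMap.add_apply, hy, hz]
    | tmul b c => simp [h1, slice_dualCoaction]
  rw [h2, evalRight_comul_antipode, slice_dualCoaction]
  generalize (comul x : A ⊗[k] A) = t
  induction t with
  | zero => simp
  | add y z hy hz => simp only [map_add, add_mul, hy, hz]
  | tmul y z => simp [dualRight_apply]

variable (k A) in
/-- The map `p ⊗ b ↦ p S(b)`. -/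
def dualProjAux : DualAlg k A ⊗[k] A →ₗ[k] DualAlg k A :=
  TensorProduct.lift (dualRight k A ∘ₗ antipode k).flip

@[simp] theorem dualProjAux_tmul (p : DualAlg k A) (b : A) :
    dualProjAux k A (p ⊗ₜ b) = dualRight k A (antipode k b) p := rfl

variable (k A) in
/-- The projection `p ↦ ∑ p₀ S(p₁)` to the coinvariants of `A*`. -/
def dualProj : DualAlg k A →ₗ[k] DualAlg k A := dualProjAux k A ∘ₗ dualCoaction k A

theorem dualCoaction_dualProj (p : DualAlg k A) :
    dualCoaction k A (dualProj k A p) = dualProj k A p ⊗ₜ 1 := by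
  let Ξ : (DualAlg k A ⊗[k] A) ⊗[k] A →ₗ[k] DualAlg k A ⊗[k] A :=
    TensorProduct.lift ((dualTwist k A).compl₂ (comul ∘ₗ antipode k))
  have h1 : ∀ t : DualAlg k A ⊗[k] A, dualCoaction k A (dualProjAux k A t) =
      Ξ ((dualCoaction k A).rTensor A t) := by
    intro t
    induction t with
    | zero => simp
    | add y z hy hz => simp only [map_add, hy, hz]
    | tmul q b => simp [Ξ, dualCoaction_dualRight]
  have h2 : ∀ t : DualAlg k A ⊗[k] A, Ξ ((TensorProduct.assoc k _ A A).symm (comul.lTensor _ t)) =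
      dualProjAux k A t ⊗ₜ 1 := by
    intro t
    induction t with
    | zero => simp
    | add y z hy hz => simp only [map_add, TensorProduct.add_tmul, hy, hz]
    | tmul q b =>
      let J : A ⊗[k] (A ⊗[k] A) →ₗ[k] DualAlg k A ⊗[k] A :=
        (TensorProduct.comm k A (DualAlg k A)).toLinearMap ∘ₗ TensorProduct.map
          (LinearMap.mul' k A ∘ₗ (antipode k).lTensor A) ((dualRight k A ∘ₗ antipode k).flip q) ∘ₗ
          (TensorProduct.assoc k A A A).symm.toLinearMap
      have h3 : ∀ s : A ⊗[k] A, Ξ ((TensorProduct.assoc k _ A A).symm (q ⊗ₜ s)) =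
          J (comul.lTensor A s) := by
        intro s
        induction s with
        | zero => simp
        | add y z hy hz => simp only [map_add, TensorProduct.tmul_add, hy, hz]
        | tmul c d =>
          simp only [Ξ, TensorProduct.assoc_symm_tmul, TensorProduct.lift.tmul,
            LinearMap.compl₂_apply, LinearMap.comp_apply, comul_antipode, LinearMap.lTensor_tmul]
          generalize (comul d : A ⊗[k] A) = s
          induction s with
          | zero => simp
          | add y z hy hz => simp only [map_add, TensorProduct.tmul_add, hy, hz]
          | tmul d e => simp [J, dualTwist_tmul_tmul]
      have h4 : ∀ s : A ⊗[k] A, J (TensorProduct.assoc k A A A (comul.rTensor A s)) =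
          dualRight k A (antipode k (TensorProduct.lid k A (counit.rTensor A s))) q ⊗ₜ 1 := by
        intro s
        induction s with
        | zero => simp
        | add y z hy hz =>
          simp only [map_add, LinearMap.add_apply, TensorProduct.add_tmul, hy, hz]
        | tmul c d =>
          simp [J, mul_antipode_lTensor_comul_apply, Algebra.algebraMap_eq_smul_one,
            TensorProduct.smul_tmul']
      rw [LinearMap.lTensor_tmul, h3, ← coassoc_apply, h4, rTensor_counit_comul]
      simp
  refine (h1 _).trans ?_
  have h5 := (LinearEquiv.eq_symm_apply _).2 (dualCoaction_coassoc p)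
  rw [h5, h2]
  rfl

theorem dualProj_recover (p : DualAlg k A) : TensorProduct.lift (dualRight k A).flip
    ((dualProj k A).rTensor A (dualCoaction k A p)) = p := by
  have h1 : ∀ t : DualAlg k A ⊗[k] A, TensorProduct.lift (dualRight k A).flip
      ((dualProjAux k A).rTensor A ((TensorProduct.assoc k _ A A).symm (comul.lTensor _ t))) =
      TensorProduct.rid k _ (counit.lTensor _ t) := by
    intro t
    induction t with
    | zero => simp
    | add y z hy hz => simp only [map_add, hy, hz]
    | tmul q b =>
      have h2 : ∀ s : A ⊗[k] A, TensorProduct.lift (dualRight k A).flip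
          ((dualProjAux k A).rTensor A ((TensorProduct.assoc k _ A A).symm (q ⊗ₜ s))) =
          dualRight k A (LinearMap.mul' k A ((antipode k).rTensor A s)) q := by
        intro s
        induction s with
        | zero => simp
        | add y z hy hz =>
          simp only [map_add, TensorProduct.tmul_add, LinearMap.add_apply, hy, hz]
        | tmul c d => simp [dualRight_mul]
      rw [LinearMap.lTensor_tmul, h2, mul_antipode_rTensor_comul_apply,
        Algebra.algebraMap_eq_smul_one]
      simp [dualRight_one]
  have h5 := (LinearEquiv.eq_symm_apply _).2 (dualCoaction_coassoc p)
  rw [dualProj, LinearMap.rTensor_comp_apply, h5, h1, dualCoaction_counit]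

theorem antipode_injective_aux (q : DualAlg k A) (hq : dualCoaction k A q = q ⊗ₜ 1) (hq0 : q ≠ 0)
    (a : A) (ha : antipode k a = 0) : a = 0 := by
  have h0 : dualCoaction k A (dualRight k A a q) = 0 := by
    have : dualRight k A a = 0 := by simp [dualRight, ha]
    simp [this]
  rw [dualCoaction_dualRight, hq] at h0
  have h1 : ∀ t : A ⊗[k] A, dualTwist k A (q ⊗ₜ 1) t = ((dualRight k A).flip q).rTensor A t := by
    intro t
    induction t with
    | zero => simp
    | add y z hy hz => simp only [map_add, hy, hz]
    | tmul b c => simp [dualTwist_tmul_tmul]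
  rw [h1] at h0
  have h2 : ∀ t : A ⊗[k] A, (dualProjAux k A).rTensor A ((TensorProduct.assoc k _ A A).symm
      (comul.lTensor _ (((dualRight k A).flip q).rTensor A t))) =
      ((dualRight k A).flip q ∘ₗ LinearMap.mul' k A ∘ₗ (antipode k).lTensor A).rTensor A
        ((TensorProduct.assoc k A A A).symm (comul.lTensor A t)) := by
    intro t
    induction t with
    | zero => simp
    | add y z hy hz => simp only [map_add, hy, hz]
    | tmul b c =>
      simp only [LinearMap.rTensor_tmul, LinearMap.lTensor_tmul]
      generalize (comul c : A ⊗[k] A) = s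
      induction s with
      | zero => simp
      | add y z hy hz => simp only [map_add, TensorProduct.tmul_add, hy, hz]
      | tmul c d => simp [dualRight_mul]
  have h3 : ∀ t : A ⊗[k] A,
      ((dualRight k A).flip q ∘ₗ LinearMap.mul' k A ∘ₗ (antipode k).lTensor A).rTensor A
        (comul.rTensor A t) = q ⊗ₜ (TensorProduct.lid k A (counit.rTensor A t)) := by
    intro t
    induction t with
    | zero => simp
    | add y z hy hz => simp only [map_add, TensorProduct.tmul_add, hy, hz]
    | tmul b c =>
      simp [mul_antipode_lTensor_comul_apply, Algebra.algebraMap_eq_smul_one, dualRight_one,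
        TensorProduct.smul_tmul]
  have h4 := h2 (comul a)
  rw [h0, coassoc_symm_apply, h3, rTensor_counit_comul] at h4
  have h5 : q ⊗ₜ[k] a = 0 := by simpa using h4.symm
  obtain ⟨x, hx⟩ : ∃ x, dualEv q x ≠ 0 := by
    by_contra! h
    exact hq0 (DualAlg.ext fun x => by simp [h])
  have h6 := congr(sliceEquiv k A A $h5 x)
  rw [sliceEquiv_tmul] at h6
  exact (smul_eq_zero.1 (h6.trans (by simp))).resolve_left hx

variable (k A) in
theorem antipode_bijective_of_finiteDimensional : Function.Bijective (antipode k (A := A)) := by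
  have hinj : Function.Injective (antipode k (A := A)) := by
    rw [injective_iff_map_eq_zero]
    intro a ha
    by_cases h : dualProj k A = 0
    · have h1 : ∀ p : DualAlg k A, p = 0 := fun p => by
        rw [← dualProj_recover p, h]
        simp
      have h2 : dualEv (1 : DualAlg k A) (1 : A) = 0 := by rw [h1 1]; simp
      simp at h2
    · obtain ⟨p, hp⟩ : ∃ p, dualProj k A p ≠ 0 := by
        by_contra! h'
        exact h (LinearMap.ext h')
      exact antipode_injective_aux _ (dualCoaction_dualProj p) hp a ha
  exact ⟨hinj, LinearMap.surjective_of_injective hinj⟩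

/-- The antipode of a finite-dimensional Hopf algebra is bijective. -/
instance : HasBijectiveAntipode k A := ⟨antipode_bijective_of_finiteDimensional k A⟩

end Integral
end HopfCat

end

/-!
A Yetter-Drinfel'd module over `A` is a module `V` together with natural isomorphisms
`X ⊗ V ≅ V ⊗ X`, `x ⊗ v ↦ ∑ v₀ ⊗ v₁ x`, for all modules `X`: the coaction is the image of `1 ⊗ v`
for the regular module `X = A`, and naturality along `a ↦ a x` gives back all components from this one
(`HopfCat.YD.ofHalfBraiding`, `HopfCat.YD.toCenter_isEquivalence`). This description only refers to
the monoidal category of modules, so an equivalence `F` of monoidal categories can be applied to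
it: the half-braiding at `F X` is the conjugate of the image under `F` of the half-braiding at `X`,
and every module is isomorphic to some `F X`. This defines the lift `HopfCat.YD.liftMon F`, with
the structure maps of `F`.

The lift is unique for the following reason. A functor `G` which lifts `F` has the underlying
modules and maps of `F`, and only the half-braiding of `G W` is to be determined. If `G` is
braided, then the half-braiding of `G W` at `F V` is known for each Yetter-Drinfel'd module `V`.
Every module `L` is a quotient of a module of this kind, namely of Radford's induced module `L ⊗ A`
by `l ⊗ a ↦ ε(a) l`, and compatibility with half-braidings passes to quotients
(`HopfCat.YD.halfBraid_eqToHom`, `HopfCat.YD.eq_of_comp_forget_eq`).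

Radford's induction is right adjoint to the forgetful functor, with the coaction as the unit and
`l ⊗ a ↦ ε(a) l` as the counit (`HopfCat.radfordAdjunction`). Thus the induced module of the unit
object represents `Hom(Π(-), 𝟙)`, and induction is compatible with `F` and its lift by uniqueness
of right adjoints (`HopfCat.rightAdjointCompIso`).

The version for the double follows from the version for Yetter-Drinfel'd modules. The functors
`HopfCat.YD.ofDouble` and `HopfCat.YD.toDouble` are braided monoidal with the identity maps as
structure maps, they are compatible with the restriction functors, and the composition of the first
with the second is the identity as a monoidal functor (`HopfCat.YD.ofDoubleMon_comp_toDoubleMon`),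
so lifts for the doubles correspond to lifts for Yetter-Drinfel'd modules. The Schrödinger module
is the induced module of the unit object, by `c ⊗ a ↦ c S(a)` (`HopfCat.YD.radfordUnitIso`), so it
is preserved because `F` preserves the unit object.
-/

noncomputable section

/-! ### Half-braidings under monoidal equivalences -/

namespace CategoryTheory.HalfBraiding

open CategoryTheory.Functor CategoryTheory.Functor.LaxMonoidal
  CategoryTheory.Functor.OplaxMonoidal

universe v₁ v₂ u₁ u₂

variable {C : Type u₁} [Category.{v₁} C] [MonoidalCategory C] {D : Type u₂} [Category.{v₂} D]
  [MonoidalCategory D]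

protected theorem ext {V : C} {b b' : HalfBraiding V} (h : b.β = b'.β) : b = b' := by
  obtain ⟨β, _, _⟩ := b
  obtain rfl : β = b'.β := h
  rfl

/-- The naturality and the hexagon axiom determine a half-braiding at the unit object. -/
theorem β_unit {V : C} (b : HalfBraiding V) :
    (b.β (𝟙_ C)).hom = (ρ_ V).hom ≫ (λ_ V).inv := by
  have h1 := b.naturality (λ_ (𝟙_ C)).hom
  rw [b.monoidal] at h1
  have h2 : V ◁ (λ_ (𝟙_ C)).hom = (α_ _ _ _).inv ≫ (ρ_ V).hom ▷ 𝟙_ C := by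
    rw [← MonoidalCategory.triangle, Iso.inv_hom_id_assoc]
  rw [h2, Category.assoc, Category.assoc, cancel_epi] at h1
  -- The hexagon says that the endomorphism of `V` given by `b.β (𝟙_ C)` is idempotent.
  let c : V ≅ V := (ρ_ V).symm ≪≫ b.β (𝟙_ C) ≪≫ λ_ V
  have hb : (b.β (𝟙_ C)).hom = (ρ_ V).hom ≫ c.hom ≫ (λ_ V).inv := by simp [c]
  have h3 : c.hom = c.hom ≫ c.hom := by
    rw [hb] at h1
    have h4 := congr((ρ_ V).inv ≫ (ρ_ V).inv ▷ 𝟙_ C ≫ $h1 ≫ (λ_ V).hom)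
    simpa [← unitors_equal, ← comp_whiskerRight_assoc] using h4
  have h5 : c.hom = 𝟙 V := by
    rw [← cancel_epi c.hom, ← h3, Category.comp_id]
  rw [hb, h5, Category.id_comp]

variable (F : C ⥤ D) [F.Monoidal]

/-- The image of a half-braiding under a monoidal functor, at an object in the image of the
functor. -/
def mapImage {V : C} (b : HalfBraiding V) (X : C) : F.obj V ⊗ F.obj X ≅ F.obj X ⊗ F.obj V :=
  Monoidal.μIso F V X ≪≫ F.mapIso (b.β X) ≪≫ (Monoidal.μIso F X V).symm

theorem mapImage_hom {V : C} (b : HalfBraiding V) (X : C) :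
    (b.mapImage F X).hom = μ F V X ≫ F.map (b.β X).hom ≫ δ F X V := rfl

theorem mapImage_natural {V : C} (b : HalfBraiding V) {X Y : C} (f : X ⟶ Y) :
    F.obj V ◁ F.map f ≫ (b.mapImage F Y).hom = (b.mapImage F X).hom ≫ F.map f ▷ F.obj V := by
  simp only [mapImage_hom, Category.assoc, μ_natural_right_assoc, δ_natural_left,
    ← F.map_comp_assoc, b.naturality]

theorem mapImage_tensor {V : C} (b : HalfBraiding V) (X Y : C) :
    F.obj V ◁ μ F X Y ≫ (b.mapImage F (X ⊗ Y)).hom =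
      (α_ _ _ _).inv ≫ (b.mapImage F X).hom ▷ F.obj Y ≫ (α_ _ _ _).hom ≫
        F.obj X ◁ (b.mapImage F Y).hom ≫ (α_ _ _ _).inv ≫ μ F X Y ▷ F.obj V := by
  simp only [mapImage_hom, b.monoidal, F.map_comp, Category.assoc, Monoidal.map_associator,
    Monoidal.map_associator_inv, Monoidal.map_whiskerLeft, Monoidal.map_whiskerRight,
    comp_whiskerRight, MonoidalCategory.whiskerLeft_comp, Monoidal.μ_δ_assoc,
    Monoidal.μ_δ, Monoidal.whiskerLeft_μ_δ_assoc, Category.comp_id]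

variable [F.IsEquivalence]

/-- The half-braiding on `F.obj V` which is induced by a half-braiding on `V`, at an object `Y`, for
an equivalence `F` of monoidal categories. It is transported from the image of `F` along the
isomorphism of `Y` with an object in the image. -/
def mapβ {V : C} (b : HalfBraiding V) (Y : D) : F.obj V ⊗ Y ≅ Y ⊗ F.obj V :=
  whiskerLeftIso (F.obj V) (F.objObjPreimageIso Y).symm ≪≫ b.mapImage F (F.objPreimage Y) ≪≫
    whiskerRightIso (F.objObjPreimageIso Y) (F.obj V)

/-- Naturality of `mapβ`, for morphisms whose source is in the image of the functor. All properties
of `mapβ` follow from this, and the choice of preimages is irrelevant. -/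
theorem whiskerLeft_mapβ {V : C} (b : HalfBraiding V) {X : C} {Y : D} (g : F.obj X ⟶ Y) :
    F.obj V ◁ g ≫ (b.mapβ F Y).hom = (b.mapImage F X).hom ≫ g ▷ F.obj V := by
  have h := b.mapImage_natural F (F.preimage (g ≫ (F.objObjPreimageIso Y).inv))
  rw [F.map_preimage] at h
  simp only [mapβ, Iso.trans_hom, whiskerLeftIso_hom, Iso.symm_hom, whiskerRightIso_hom,
    ← MonoidalCategory.whiskerLeft_comp_assoc, reassoc_of% h, ← comp_whiskerRight,
    Category.assoc, Iso.inv_hom_id, Category.comp_id]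

@[simp]
theorem mapβ_obj {V : C} (b : HalfBraiding V) (X : C) :
    (b.mapβ F (F.obj X)).hom = (b.mapImage F X).hom := by
  simpa using b.whiskerLeft_mapβ F (𝟙 (F.obj X))

/-- The half-braiding on `F.obj V` which is induced by a half-braiding on `V`, for an equivalence
`F` of monoidal categories. -/
@[simps]
def map {V : C} (b : HalfBraiding V) : HalfBraiding (F.obj V) where
  β := b.mapβ F
  naturality {U U'} f := by
    rw [← cancel_epi (F.obj V ◁ (F.objObjPreimageIso U).hom),
      ← MonoidalCategory.whiskerLeft_comp_assoc, whiskerLeft_mapβ, reassoc_of% b.whiskerLeft_mapβ F,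
      comp_whiskerRight]
  monoidal U U' := by
    let e := (F.objObjPreimageIso U).hom
    let e' := (F.objObjPreimageIso U').hom
    have h1 := b.whiskerLeft_mapβ F (δ F _ _ ≫ (e ⊗ₘ e'))
    have h2 := b.mapImage_tensor F (F.objPreimage U) (F.objPreimage U')
    rw [← cancel_epi (F.obj V ◁ μ F _ _ ≫ F.obj V ◁ (δ F _ _ ≫ (e ⊗ₘ e'))), Category.assoc, h1,
      reassoc_of% h2]
    have h3 := b.whiskerLeft_mapβ F e
    have h4 := b.whiskerLeft_mapβ F e'
    rw [comp_whiskerRight, Monoidal.whiskerRight_μ_δ_assoc, ← MonoidalCategory.whiskerLeft_comp,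
      Monoidal.μ_δ_assoc, tensorHom_def']
    simp only [MonoidalCategory.whiskerLeft_comp, comp_whiskerRight, Category.assoc]
    symm
    rw [associator_inv_naturality_middle_assoc, associator_inv_naturality_right_assoc,
      ← comp_whiskerRight_assoc, h3, comp_whiskerRight_assoc, associator_naturality_left_assoc,
      ← whisker_exchange_assoc, whisker_exchange_assoc,
      associator_naturality_right_assoc, ← MonoidalCategory.whiskerLeft_comp_assoc, h4,
      MonoidalCategory.whiskerLeft_comp_assoc, associator_inv_naturality_left,
      associator_inv_naturality_middle_assoc]

/-- The half-braiding on `V` which is induced by a half-braiding on an object isomorphic to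
`F.obj V`, for an equivalence `F` of monoidal categories. -/
def comap {V : C} {W : D} (e : F.obj V ≅ W) (b : HalfBraiding W) : HalfBraiding V where
  β X := F.preimageIso ((Monoidal.μIso F V X).symm ≪≫ whiskerRightIso e (F.obj X) ≪≫
    b.β (F.obj X) ≪≫ whiskerLeftIso (F.obj X) e.symm ≪≫ Monoidal.μIso F X V)
  naturality {X Y} f := F.map_injective (by
    simp only [F.map_comp, preimageIso_hom, map_preimage, Iso.trans_hom, Iso.symm_hom,
      Monoidal.μIso_hom, Monoidal.μIso_inv, whiskerRightIso_hom, whiskerLeftIso_hom,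
      Category.assoc, ← δ_natural_right_assoc, ← μ_natural_left]
    rw [whisker_exchange_assoc, reassoc_of% b.naturality (F.map f), whisker_exchange_assoc])
  monoidal X Y := F.map_injective (by
    have h := b.naturality (μ F X Y)
    rw [b.monoidal] at h
    have h' : (b.β (F.obj (X ⊗ Y))).hom = W ◁ δ F X Y ≫ ((α_ _ _ _).inv ≫
        ((b.β _).hom ▷ _) ≫ (α_ _ _ _).hom ≫ (_ ◁ (b.β _).hom) ≫ (α_ _ _ _).inv) ≫
        μ F X Y ▷ W := by
      rw [← h, Monoidal.whiskerLeft_δ_μ_assoc]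
    simp only [F.map_comp, preimageIso_hom, map_preimage, Iso.trans_hom, Iso.symm_hom,
      Monoidal.μIso_hom, Monoidal.μIso_inv, whiskerRightIso_hom, whiskerLeftIso_hom,
      Category.assoc, Monoidal.map_associator, Monoidal.map_associator_inv,
      Monoidal.map_whiskerLeft, Monoidal.map_whiskerRight, comp_whiskerRight,
      MonoidalCategory.whiskerLeft_comp, Monoidal.μ_δ_assoc, h']
    rw [← whisker_exchange_assoc, ← whisker_exchange_assoc]
    simp)

theorem map_comap_β_inv {V : C} {W : D} (e : F.obj V ≅ W) (b : HalfBraiding W) (X : C) :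
    F.map ((b.comap F e).β X).inv = δ F X V ≫ F.obj X ◁ e.hom ≫ (b.β (F.obj X)).inv ≫
      e.inv ▷ F.obj X ≫ μ F V X := by
  simp [comap]

end CategoryTheory.HalfBraiding

/-! ### Composition and equality of monoidal functors -/

namespace HopfCat.MonFunctor

open CategoryTheory.Functor CategoryTheory.Functor.LaxMonoidal
  CategoryTheory.Functor.OplaxMonoidal

universe v₁ v₂ v₃ v₄ u₁ u₂ u₃ u₄

variable {C : Type u₁} [Category.{v₁} C] [MonoidalCategory C] {D : Type u₂}
  [Category.{v₂} D] [MonoidalCategory D] {E : Type u₃} [Category.{v₃} E] [MonoidalCategory E]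
  {E' : Type u₄} [Category.{v₄} E'] [MonoidalCategory E']

theorem congr_obj {P Q : MonFunctor C D} (h : P = Q) (X : C) :
    P.functor.obj X = Q.functor.obj X := by
  rw [h]

theorem congr_map {P Q : MonFunctor C D} (h : P = Q) {X Y : C} (f : X ⟶ Y) :
    P.functor.map f ≫ eqToHom (congr_obj h Y) = eqToHom (congr_obj h X) ≫ Q.functor.map f := by
  subst h
  simp

theorem congr_μ {P Q : MonFunctor C D} (h : P = Q) (X Y : C) :
    μ P.functor X Y ≫ eqToHom (congr_obj h (X ⊗ Y)) =
      (eqToHom (congr_obj h X) ⊗ₘ eqToHom (congr_obj h Y)) ≫ μ Q.functor X Y := by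
  subst h
  simp

theorem congr_ε {P Q : MonFunctor C D} (h : P = Q) :
    ε P.functor ≫ eqToHom (congr_obj h (𝟙_ C)) = ε Q.functor := by
  subst h
  simp

/-- Two monoidal functors with the same underlying functor are equal if they have the same structure
maps. -/
theorem mk_eq_mk {F : C ⥤ D} {m m' : F.Monoidal} (hμ : ∀ X Y, m.μ X Y = m'.μ X Y)
    (hε : m.ε = m'.ε) : MonFunctor.mk F m = MonFunctor.mk F m' := by
  congr 1
  apply Functor.Monoidal.toLaxMonoidal_injective
  exact LaxMonoidal.ext hε (funext₂ hμ)

/-- Two monoidal functors are equal if they agree on objects, and if the resulting identifications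
of objects are compatible with morphisms and with the structure maps. -/
theorem ext_of_eqToHom {P Q : MonFunctor C D} (h : ∀ X, P.functor.obj X = Q.functor.obj X)
    (hmap : ∀ {X Y : C} (f : X ⟶ Y),
      P.functor.map f ≫ eqToHom (h Y) = eqToHom (h X) ≫ Q.functor.map f)
    (hμ : ∀ X Y, μ P.functor X Y ≫ eqToHom (h (X ⊗ Y)) =
      (eqToHom (h X) ⊗ₘ eqToHom (h Y)) ≫ μ Q.functor X Y)
    (hε : ε P.functor ≫ eqToHom (h (𝟙_ C)) = ε Q.functor) : P = Q := by
  obtain ⟨F, mF⟩ := P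
  obtain ⟨G, mG⟩ := Q
  obtain rfl : F = G := CategoryTheory.Functor.ext h fun X Y f => by
    rw [← reassoc_of% hmap f]
    simp
  exact mk_eq_mk (fun X Y => by simpa using hμ X Y) (by simpa using hε)

theorem comp_μ (P : MonFunctor C D) (Q : MonFunctor D E) (X Y : C) :
    μ (P.comp Q).functor X Y = μ Q.functor _ _ ≫ Q.functor.map (μ P.functor X Y) := rfl

theorem comp_ε (P : MonFunctor C D) (Q : MonFunctor D E) :
    ε (P.comp Q).functor = ε Q.functor ≫ Q.functor.map (ε P.functor) := rfl

variable (C) in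
/-- The identity functor as a monoidal functor. -/
protected def id : MonFunctor C C := .of (𝟭 C)

theorem comp_assoc (P : MonFunctor C D) (Q : MonFunctor D E) (T : MonFunctor E E') :
    (P.comp Q).comp T = P.comp (Q.comp T) :=
  mk_eq_mk (fun X Y => by
    change μ T.functor _ _ ≫ T.functor.map (μ Q.functor _ _ ≫ Q.functor.map (μ P.functor X Y)) =
      (μ T.functor _ _ ≫ T.functor.map (μ Q.functor _ _)) ≫
        T.functor.map (Q.functor.map (μ P.functor X Y))
    simp) (by
    change ε T.functor ≫ T.functor.map (ε Q.functor ≫ Q.functor.map (ε P.functor)) =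
      (ε T.functor ≫ T.functor.map (ε Q.functor)) ≫
        T.functor.map (Q.functor.map (ε P.functor))
    simp)

theorem id_comp (P : MonFunctor C D) : (MonFunctor.id C).comp P = P :=
  mk_eq_mk (fun X Y => by
    change μ P.functor X Y ≫ P.functor.map (𝟙 _) = μ P.functor X Y
    simp) (by
    change ε P.functor ≫ P.functor.map (𝟙 _) = ε P.functor
    simp)

theorem comp_id (P : MonFunctor C D) : P.comp (MonFunctor.id D) = P :=
  mk_eq_mk (fun _ _ => Category.id_comp _) (Category.id_comp _)

theorem IsBraided.comp [BraidedCategory C] [BraidedCategory D] [BraidedCategory E]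
    {P : MonFunctor C D} {Q : MonFunctor D E} (hP : P.IsBraided) (hQ : Q.IsBraided) :
    (P.comp Q).IsBraided := fun X Y => by
  change (μ Q.functor _ _ ≫ Q.functor.map (μ P.functor X Y)) ≫
      Q.functor.map (P.functor.map (β_ X Y).hom) =
    (β_ (Q.functor.obj (P.functor.obj X)) (Q.functor.obj (P.functor.obj Y))).hom ≫
      μ Q.functor _ _ ≫ Q.functor.map (μ P.functor Y X)
  rw [Category.assoc, ← Functor.map_comp, hP, Functor.map_comp, ← Category.assoc, hQ,
    Category.assoc]

theorem IsLinearEquivalence.comp {k : Type u} [Field k] [Preadditive C] [Linear k C]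
    [Preadditive D] [Linear k D] [Preadditive E] [Linear k E]
    {P : MonFunctor C D} {Q : MonFunctor D E} (hP : P.IsLinearEquivalence k)
    (hQ : Q.IsLinearEquivalence k) : (P.comp Q).IsLinearEquivalence k := by
  obtain ⟨_, _, _⟩ := hP
  obtain ⟨_, _, _⟩ := hQ
  exact ⟨by unfold MonFunctor.comp; infer_instance, by unfold MonFunctor.comp; infer_instance,
    by unfold MonFunctor.comp; infer_instance⟩

end HopfCat.MonFunctor

/-! ### Yetter-Drinfel'd modules from half-braidings -/

namespace HopfCat
open Coalgebra Bialgebra HopfAlgebra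

variable {k : Type u} [Field k] {A : Type u} [Ring A]

section Regular

variable (k A) in
/-- The left regular module. -/
def LMod.regular [Algebra k A] : LMod k A := ⟨ModuleCat.of k A, Algebra.lmul k A⟩

/-- The homomorphism `a ↦ a x` from the regular module. -/
def LMod.ofRegular [Algebra k A] (X : LMod k A) (x : X.V) : LMod.regular k A ⟶ X where
  hom := ModuleCat.ofHom (X.act.toLinearMap.flip x)
  comm a b := (congr($(map_mul X.act a b) x) :)

theorem coactBraid_rTensor_one [Bialgebra k A] {V W : Type u} [AddCommGroup V] [Module k V]
    [AddCommGroup W] [Module k W] (ρ : V →ₗ[k] V ⊗[k] A) (t : V ⊗[k] W) :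
    (coactBraid (Algebra.lmul k A) ρ).rTensor W ((TensorProduct.assoc k A V W).symm (1 ⊗ₜ t)) =
      ρ.rTensor W t := by
  induction t with
  | zero => simp
  | add x y hx hy => simp only [map_add, TensorProduct.tmul_add, hx, hy]
  | tmul v w => simp [coactBraid_one]

end Regular

variable [HopfAlgebra k A]

namespace LMod

variable {M : LMod k A} (b : HalfBraiding M)

/-- The coaction `v ↦ β⁻¹(1 ⊗ v)` which is given by the component `β` of a half-braiding at the
regular module. -/
def coactOfHalfBraiding : M.V →ₗ[k] M.V ⊗[k] A :=
  (b.β (regular k A)).inv.hom.hom ∘ₗ TensorProduct.mk k A M.V 1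

theorem coactBraid_coactOfHalfBraiding (X : LMod k A) (t : X.V ⊗[k] M.V) :
    coactBraid X.act (coactOfHalfBraiding b) t = (b.β X).inv.hom t := by
  induction t with
  | zero => simp
  | add x y hx hy => rw [map_add, hx, hy, map_add]
  | tmul x v =>
    have h := b.naturality (X.ofRegular x)
    rw [← Iso.eq_comp_inv, Category.assoc, ← Iso.inv_comp_eq] at h
    have h1 := congr(($h).hom.hom ((1 : A) ⊗ₜ v))
    have h2 : (X.ofRegular x).hom.hom (1 : A) = x :=
      congr($(map_one X.act) x)
    refine Eq.trans h1 (Eq.trans ?_ congr((b.β X).inv.hom ($h2 ⊗ₜ v)))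
    rfl

end LMod

namespace YD

/-- A half-braiding on a module defines a Yetter-Drinfel'd module. -/
abbrev ofHalfBraiding {M : LMod k A} (b : HalfBraiding M) : YD k A where
  toLMod := M
  coact := LMod.coactOfHalfBraiding b
  coassoc v := by
    let ρ := LMod.coactOfHalfBraiding b
    have h1 : (b.β (LMod.regular k A ⊗ LMod.regular k A)).inv = (α_ _ _ _).hom ≫
        _ ◁ (b.β (LMod.regular k A)).inv ≫ (α_ _ _ _).inv ≫
        (b.β (LMod.regular k A)).inv ▷ _ ≫ (α_ _ _ _).hom := by
      rw [← cancel_epi (b.β _).hom, Iso.hom_inv_id, b.monoidal]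
      simp [← comp_whiskerRight_assoc, ← MonoidalCategory.whiskerLeft_comp_assoc]
    have h2 := (LMod.coactBraid_coactOfHalfBraiding b (LMod.regular k A ⊗ LMod.regular k A)
      (((1 : A) ⊗ₜ (1 : A)) ⊗ₜ v)).trans congr(($h1).hom.hom (((1 : A) ⊗ₜ (1 : A)) ⊗ₜ v))
    have h3 : (b.β (LMod.regular k A)).inv.hom.hom = coactBraid (Algebra.lmul k A) ρ :=
      LinearMap.ext fun t => (LMod.coactBraid_coactOfHalfBraiding b (LMod.regular k A) t).symm
    have h4 : coactBraid (diagAct (Algebra.lmul k A) (Algebra.lmul k A)) ρ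
        (((1 : A) ⊗ₜ (1 : A)) ⊗ₜ v) = comul.lTensor M.V (ρ v) := by
      have h5 : (Algebra.lmul k A).toLinearMap.flip 1 = LinearMap.id := by ext; simp
      rw [coactBraid_tmul, flip_diagAct, h5, TensorProduct.map_id, LinearMap.id_comp]
    refine Eq.trans ?_ (h2.symm.trans h4)
    have h6 : ((b.β (LMod.regular k A)).inv.hom.hom).rTensor A
        ((TensorProduct.assoc k A M.V A).symm ((1 : A) ⊗ₜ ρ v)) = ρ.rTensor A (ρ v) := by
      rw [h3]
      exact coactBraid_rTensor_one ρ (ρ v)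
    exact congr(TensorProduct.assoc k M.V A A $(h6.symm))
  counit_coact v := by
    have h1 : (b.β (𝟙_ (LMod k A))).inv = (λ_ M).hom ≫ (ρ_ M).inv := by
      rw [← cancel_epi (b.β _).hom, Iso.hom_inv_id, b.β_unit]
      simp
    have h2 := (LMod.coactBraid_coactOfHalfBraiding b (𝟙_ (LMod k A)) ((1 : k) ⊗ₜ v)).trans
      congr(($h1).hom.hom ((1 : k) ⊗ₜ v))
    have h3 : (trivAct k A).toLinearMap.flip 1 = counit := by
      ext a
      exact (trivAct_apply a 1).trans (mul_one _)
    refine Eq.trans congr(($(h3.symm)).lTensor M.V (LMod.coactOfHalfBraiding b v)) (h2.trans ?_)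
    exact congr($(one_smul k v) ⊗ₜ[k] (1 : k))
  compat := yd_of_linear fun a t => by
    have h := LMod.coactBraid_coactOfHalfBraiding b (LMod.regular k A)
    refine (h _).trans (Eq.trans ((b.β (LMod.regular k A)).inv.comm a t) ?_)
    exact congr(diagAct M.act (Algebra.lmul k A) a $((h t).symm))

theorem halfBraid_ofHalfBraiding {M : LMod k A} (b : HalfBraiding M) (X : LMod k A) :
    halfBraid X (ofHalfBraiding b) = (b.β X).symm :=
  Iso.ext (LMod.hom_ext (ModuleCat.hom_ext (LinearMap.ext
    (LMod.coactBraid_coactOfHalfBraiding b X))))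

theorem coact_eq_halfBraid (M : YD k A) (m : M.toLMod.V) :
    M.coact m = (halfBraid (LMod.regular k A) M).hom.hom ((1 : A) ⊗ₜ[k] m) :=
  (coactBraid_one M.coact m).symm

/-- A homomorphism of modules which is compatible with the half-braidings at the regular module is
a homomorphism of Yetter-Drinfel'd modules. -/
def homMk {M N : YD k A} (f : M.toLMod ⟶ N.toLMod)
    (h : LMod.regular k A ◁ f ≫ (halfBraid (LMod.regular k A) N).hom =
      (halfBraid (LMod.regular k A) M).hom ≫ f ▷ LMod.regular k A) : M ⟶ N where
  hom := f
  comm m := by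
    rw [coact_eq_halfBraid, coact_eq_halfBraid]
    exact congr(($h).hom.hom ((1 : A) ⊗ₜ[k] m)).symm

theorem ext_of_halfBraid {M N : YD k A} (h : M.toLMod = N.toLMod)
    (h' : LMod.regular k A ◁ eqToHom h ≫ (halfBraid (LMod.regular k A) N).hom =
      (halfBraid (LMod.regular k A) M).hom ≫ eqToHom h ▷ LMod.regular k A) : M = N := by
  obtain ⟨M, ρ, h1, h2, h3⟩ := M
  obtain ⟨N, σ, h4, h5, h6⟩ := N
  obtain rfl : M = N := h
  have : ρ = σ := LinearMap.ext fun m => by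
    have e1 := coact_eq_halfBraid ⟨M, ρ, h1, h2, h3⟩ m
    have e2 := coact_eq_halfBraid ⟨M, σ, h4, h5, h6⟩ m
    simp only [eqToHom_refl, MonoidalCategory.whiskerLeft_id, MonoidalCategory.id_whiskerRight,
      Category.id_comp, Category.comp_id] at h'
    rw [h'] at e2
    exact e1.trans e2.symm
  subst this
  rfl

end YD
end HopfCat

/-! ### The center, and the adjunction of Radford's induction -/

namespace HopfCat
open Coalgebra Bialgebra HopfAlgebra

variable {k : Type u} [Field k] {A : Type u} [Ring A] [HopfAlgebra k A]

namespace YD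

theorem halfBraid_tensor_right (X : LMod k A) (M N : YD k A) :
    (halfBraid X (M ⊗ N)).hom = (α_ X M.toLMod N.toLMod).inv ≫
      (halfBraid X M).hom ▷ N.toLMod ≫ (α_ M.toLMod X N.toLMod).hom ≫
        M.toLMod ◁ (halfBraid X N).hom ≫ (α_ M.toLMod N.toLMod X).inv :=
  (Iso.eq_inv_comp _).2 (LMod.hom_ext (ModuleCat.hom_ext (LinearMap.ext
    (coactBraid_tensorCoact M.coact N.coact X.act))))

theorem halfBraid_unit_right (X : LMod k A) :
    (halfBraid X (𝟙_ (YD k A))).hom = (ρ_ X).hom ≫ (λ_ X).inv :=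
  (Iso.eq_comp_inv (λ_ X)).2 (LMod.hom_ext (ModuleCat.hom_ext (TensorProduct.ext' fun x (c : k) =>
    by
    change TensorProduct.lid k X.V ((X.act.toLinearMap.flip x).lTensor k (c ⊗ₜ[k] (1 : A))) =
      TensorProduct.rid k X.V (x ⊗ₜ[k] c)
    simp)))

theorem toCenter_faithful : (toCenter k A).Faithful where
  map_injective h := hom_ext congr(($h).f)

theorem toCenter_full : (toCenter k A).Full where
  map_surjective {M N} := fun ⟨(f : M.toLMod ⟶ N.toLMod), hf⟩ =>
    ⟨homMk f (by
      have h : f ▷ _ ≫ (halfBraid (LMod.regular k A) N).inv =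
        (halfBraid (LMod.regular k A) M).inv ≫ _ ◁ f := hf (LMod.regular k A)
      rw [← Iso.inv_comp_eq, ← Category.assoc, ← h, Category.assoc, Iso.inv_hom_id,
        Category.comp_id]), rfl⟩

theorem toCenter_essSurj : (toCenter k A).EssSurj where
  mem_essImage X := by
    refine ⟨ofHalfBraiding X.2, ⟨eqToIso (congrArg (Sigma.mk X.1) (HalfBraiding.ext ?_))⟩⟩
    funext U
    exact congr(Iso.symm $(halfBraid_ofHalfBraiding X.2 U))

/-- The category of Yetter-Drinfel'd modules is equivalent to the center of the category of
modules. -/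
theorem toCenter_isEquivalence : (toCenter k A).IsEquivalence where
  faithful := toCenter_faithful
  full := toCenter_full
  essSurj := toCenter_essSurj

end YD

section Adjunction

variable [HasBijectiveAntipode k A]

theorem counit_antipodeInv (a : A) : counit (R := k) (antipodeInv k a) = counit a := by
  conv_rhs => rw [← antipode_antipodeInv k a, counit_antipode]

/-- The coaction of a Yetter-Drinfel'd module `V` is a map of modules from `V` to `V ⊗ A`, with the
action on `V ⊗ A` given by Radford's induction. -/
theorem YD.coact_act (V : YD k A) (a : A) (v : V.toLMod.V) :
    V.coact (V.toLMod.act a v) = radfordAct V.toLMod.act a (V.coact v) := by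
  let K : A ⊗[k] (A ⊗[k] A) →ₗ[k] V.toLMod.V ⊗[k] A :=
    TensorProduct.lift ((LinearMap.lTensorHom V.toLMod.V ∘ₗ (LinearMap.mul k A).flip ∘ₗ
      LinearMap.mul' k A ∘ₗ (antipodeInv k).lTensor A ∘ₗ
        (TensorProduct.comm k A A).toLinearMap).compl₂
          (V.coact ∘ₗ V.toLMod.act.toLinearMap.flip v)) ∘ₗ
      (TensorProduct.assoc k A A A).symm.toLinearMap
  have hK : ∀ b c d : A, K (b ⊗ₜ (c ⊗ₜ d)) =
      (LinearMap.mulRight k (c * antipodeInv k b)).lTensor _ (V.coact (V.toLMod.act d v)) :=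
    fun b c d => rfl
  have h1 : ∀ t : A ⊗[k] A, Algebra.TensorProduct.lift _ _
      (rightInvAct_commute V.toLMod.act) t (V.coact v) = K (comul.lTensor A t) := by
    intro t
    induction t with
    | zero => simp
    | add x y hx hy => simp only [map_add, LinearMap.add_apply, hx, hy]
    | tmul b c =>
      rw [Algebra.TensorProduct.lift_tmul, Module.End.mul_apply, diagAct_apply, V.compat,
        LinearMap.lTensor_tmul]
      generalize (comul c : A ⊗[k] A) = s
      induction s with
      | zero => simp
      | add x y hx hy => simp only [map_add, TensorProduct.tmul_add, hx, hy]
      | tmul c d =>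
        rw [hK, coactAfter_tmul]
        generalize V.coact (V.toLMod.act d v) = r
        induction r with
        | zero => simp
        | add x y hx hy => simp only [map_add, hx, hy]
        | tmul w e => simp [rightInvAct_tmul, mul_assoc]
  have h2 : ∀ t : A ⊗[k] A, K (TensorProduct.assoc k A A A (comul.rTensor A t)) =
      V.coact (V.toLMod.act (TensorProduct.lid k A (counit.rTensor A t)) v) := by
    intro t
    induction t with
    | zero => simp
    | add x y hx hy => simp only [map_add, LinearMap.add_apply, hx, hy]
    | tmul b d =>
      have h3 : ∀ s : A ⊗[k] A, K (TensorProduct.assoc k A A A (s ⊗ₜ d)) =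
          (LinearMap.mulRight k (LinearMap.mul' k A (TensorProduct.map LinearMap.id
            (antipodeInv k) (TensorProduct.comm k A A s)))).lTensor _
              (V.coact (V.toLMod.act d v)) := fun s => by
        simp only [K, LinearMap.comp_apply, LinearEquiv.coe_coe, LinearEquiv.symm_apply_apply]
        rfl
      rw [LinearMap.rTensor_tmul, h3, mul_antipodeInv_comul, LinearMap.rTensor_tmul,
        TensorProduct.lid_tmul, map_smul, LinearMap.smul_apply, map_smul]
      generalize V.coact (V.toLMod.act d v) = r
      induction r with
      | zero => simp
      | add x y hx hy => simp only [map_add, smul_add, hx, hy]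
      | tmul w e => simp [Algebra.algebraMap_eq_smul_one]
  refine Eq.trans ?_ (h1 (comul a)).symm
  rw [← coassoc_apply, h2, rTensor_counit_comul]
  simp

theorem rid_counit_radfordAct {L : Type u} [AddCommGroup L] [Module k L]
    (f : A →ₐ[k] Module.End k L) (h : A) (t : L ⊗[k] A) :
    TensorProduct.rid k L (counit.lTensor L (radfordAct f h t)) =
      f h (TensorProduct.rid k L (counit.lTensor L t)) := by
  have e1 : ∀ (c : A) (t : L ⊗[k] A),
      TensorProduct.rid k L (counit.lTensor L (diagAct f (Algebra.lmul k A) c t)) =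
        f c (TensorProduct.rid k L (counit.lTensor L t)) := by
    intro c t
    rw [← diagAct_rid f c (counit.lTensor L t)]
    have e0 := outerAct_comm (f := f) (g := Algebra.lmul k A) (f' := f) (g' := trivAct k A)
      (φ := LinearMap.id) (ψ := counit) (fun _ _ => rfl)
      (fun a b => (counit_mul a b).trans (trivAct_apply a (counit b)).symm) (comul c) t
    exact congrArg (TensorProduct.rid k L) e0
  have e2 : ∀ (b : A) (t : L ⊗[k] A),
      TensorProduct.rid k L (counit.lTensor L (rightInvAct k A L b t)) =
        counit (R := k) b • TensorProduct.rid k L (counit.lTensor L t) := by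
    intro b t
    induction t with
    | zero => simp
    | add x y hx hy => simp only [map_add, smul_add, hx, hy]
    | tmul l a => simp [rightInvAct_tmul, counit_antipodeInv, smul_smul, mul_comm]
  have e3 : ∀ s : A ⊗[k] A, TensorProduct.rid k L (counit.lTensor L
      (Algebra.TensorProduct.lift _ _ (rightInvAct_commute f) s t)) =
      f (TensorProduct.lid k A (counit.rTensor A s))
        (TensorProduct.rid k L (counit.lTensor L t)) := by
    intro s
    induction s with
    | zero => simp
    | add x y hx hy => simp only [map_add, LinearMap.add_apply, hx, hy]
    | tmul b c => simp [e1, e2]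
  refine (e3 (comul h)).trans ?_
  rw [rTensor_counit_comul]
  simp

theorem radfordCounit_natural {L M : Type u} [AddCommGroup L] [Module k L] [AddCommGroup M]
    [Module k M] (f : L →ₗ[k] M) :
    ((TensorProduct.rid k M).toLinearMap ∘ₗ counit.lTensor M) ∘ₗ f.rTensor A =
      f ∘ₗ (TensorProduct.rid k L).toLinearMap ∘ₗ counit.lTensor L :=
  TensorProduct.ext' fun l a => by simp

/-- The map `l ⊗ a ↦ ε(a) l`. -/
def radfordCounit (L : LMod k A) : (radford k A ⋙ YD.forget k A).obj L ⟶ L where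
  hom := ModuleCat.ofHom ((TensorProduct.rid k L.V).toLinearMap ∘ₗ counit.lTensor L.V)
  comm h t := rid_counit_radfordAct L.act h t

variable (k A) in
/-- Radford's induction functor is right adjoint to the forgetful functor. -/
def radfordAdjunction : YD.forget k A ⊣ radford k A :=
  Adjunction.mkOfUnitCounit
    { unit :=
        { app := fun V =>
            { hom := ⟨ModuleCat.ofHom V.coact, V.coact_act⟩
              comm := fun v => (LinearEquiv.eq_symm_apply _).2 (V.coassoc v) }
          naturality := fun V W f => YD.hom_ext (LMod.hom_ext (ModuleCat.hom_ext
            (LinearMap.ext fun v => (f.comm v).symm))) }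
      counit :=
        { app := radfordCounit
          naturality := fun (L M : LMod k A) f => LMod.hom_ext (ModuleCat.hom_ext
            (radfordCounit_natural f.hom.hom)) }
      left_triangle := by
        ext V (v : V.toLMod.V)
        change TensorProduct.rid k V.toLMod.V (counit.lTensor V.toLMod.V (V.coact v)) = v
        rw [V.counit_coact]
        simp
      right_triangle := by
        ext L (t : L.V ⊗[k] A)
        change ((TensorProduct.rid k L.V).toLinearMap ∘ₗ counit.lTensor L.V).rTensor A
          (radfordCoact k A L.V t) = t
        induction t with
        | zero => simp
        | add x y hx hy => rw [map_add, map_add, hx, hy]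
        | tmul l a =>
        rw [radfordCoact_tmul]
        have h : ∀ t : A ⊗[k] A,
            ((TensorProduct.rid k L.V).toLinearMap ∘ₗ counit.lTensor L.V).rTensor A
              ((TensorProduct.assoc k L.V A A).symm (l ⊗ₜ t)) =
            l ⊗ₜ TensorProduct.lid k A (counit.rTensor A t) := by
          intro t
          induction t with
          | zero => simp
          | add x y hx hy => simp only [map_add, TensorProduct.tmul_add, hx, hy]
          | tmul b c => simp [TensorProduct.smul_tmul]
        rw [h, rTensor_counit_comul]
        simp }

theorem radfordCounit_surjective (L : LMod k A) :
    Function.Surjective (radfordCounit L).hom := fun l =>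
  ⟨(l ⊗ₜ 1 : L.V ⊗[k] A), by
    change TensorProduct.rid k L.V (l ⊗ₜ counit 1) = l
    simp⟩

variable (k A) in
/-- The forgetful functor from the center of the category of modules is left adjoint to Radford's
induction, followed by the equivalence of Yetter-Drinfel'd modules with the center. -/
def centerForgetAdjunction : Center.forget (LMod k A) ⊣ radford k A ⋙ YD.toCenter k A :=
  haveI := YD.toCenter_isEquivalence (k := k) (A := A)
  let E := (YD.toCenter k A).asEquivalence
  (E.symm.toAdjunction.comp (radfordAdjunction k A)).ofNatIsoLeft
    (Functor.isoWhiskerRight E.counitIso (Center.forget (LMod k A)))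

variable (k A) in
theorem isSchrodingerObject_radford :
    IsSchrodingerObject ((YD.toCenter k A).obj ((radford k A).obj (𝟙_ (LMod k A)))) :=
  ⟨(centerForgetAdjunction k A).representableBy (𝟙_ (LMod k A))⟩

end Adjunction

end HopfCat

/-! ### The lift to Yetter-Drinfel'd modules -/

namespace HopfCat.YD
open CategoryTheory.Functor CategoryTheory.Functor.LaxMonoidal
  CategoryTheory.Functor.OplaxMonoidal

section Criterion

variable {k : Type u} [Field k] {A : Type u} [Ring A] [HopfAlgebra k A]

/-- Compatibility with the half-braidings at an object `X` passes to a quotient `Y` of `X`. -/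
theorem halfBraid_comm_of_epi {M N : YD k A} (f : M.toLMod ⟶ N.toLMod) {X Y : LMod k A}
    (e : X ⟶ Y) [Epi (e ▷ M.toLMod)]
    (h : X ◁ f ≫ (halfBraid X N).hom = (halfBraid X M).hom ≫ f ▷ X) :
    Y ◁ f ≫ (halfBraid Y N).hom = (halfBraid Y M).hom ≫ f ▷ Y := by
  rw [← cancel_epi (e ▷ M.toLMod), ← whisker_exchange_assoc, halfBraid_natural, reassoc_of% h,
    ← whisker_exchange, ← Category.assoc, ← halfBraid_natural, Category.assoc]

end Criterion

variable {k : Type u} [Field k] {A B : Type u} [Ring A] [HopfAlgebra k A] [Ring B]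
  [HopfAlgebra k B] (F : LMod k A ⥤ LMod k B) [F.Monoidal] [F.IsEquivalence]

section Image

variable {F}

theorem halfBraid_comm_of_image {M N : YD k B} {f : M.toLMod ⟶ N.toLMod}
    (h : ∀ X : LMod k A, F.obj X ◁ f ≫ (halfBraid (F.obj X) N).hom =
      (halfBraid (F.obj X) M).hom ≫ f ▷ F.obj X) (Y : LMod k B) :
    Y ◁ f ≫ (halfBraid Y N).hom = (halfBraid Y M).hom ≫ f ▷ Y :=
  halfBraid_comm_of_epi f (F.objObjPreimageIso Y).hom (h _)

variable (F) in
/-- A homomorphism of modules which is compatible with the half-braidings at all objects in the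
image of an equivalence is a homomorphism of Yetter-Drinfel'd modules. -/
def homMkOfImage (M N : YD k B) (f : M.toLMod ⟶ N.toLMod)
    (h : ∀ X : LMod k A, F.obj X ◁ f ≫ (halfBraid (F.obj X) N).hom =
      (halfBraid (F.obj X) M).hom ≫ f ▷ F.obj X) : M ⟶ N :=
  homMk f (halfBraid_comm_of_image h _)

variable (F) in
/-- An isomorphism of modules which is compatible with the half-braidings at all objects in the
image of an equivalence is an isomorphism of Yetter-Drinfel'd modules. -/
def isoMkOfImage (M N : YD k B) (e : M.toLMod ≅ N.toLMod)
    (h : ∀ X : LMod k A, F.obj X ◁ e.hom ≫ (halfBraid (F.obj X) N).hom =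
      (halfBraid (F.obj X) M).hom ≫ e.hom ▷ F.obj X) : M ≅ N :=
  isoMk e (homMkOfImage F M N e.hom h).comm

end Image

/-- The image of a Yetter-Drinfel'd module under an equivalence `F` of monoidal categories of
modules: the underlying module is the image of the underlying module under `F`. -/
abbrev liftObj (V : YD k A) : YD k B := ofHalfBraiding (V.halfBraiding.map F)

theorem halfBraid_liftObj (X : LMod k A) (V : YD k A) :
    (halfBraid (F.obj X) (liftObj F V)).hom =
      μ F X V.toLMod ≫ F.map (halfBraid X V).hom ≫ δ F V.toLMod X := by
  have h : V.halfBraiding.mapβ F (F.obj X) = V.halfBraiding.mapImage F X :=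
    Iso.ext (V.halfBraiding.mapβ_obj F X)
  rw [halfBraid_ofHalfBraiding, HalfBraiding.map_β, h]
  simp only [HalfBraiding.mapImage, Iso.symm_hom, Iso.trans_inv, Iso.symm_inv, mapIso_inv,
    Monoidal.μIso_hom, Monoidal.μIso_inv, Category.assoc]
  rfl

/-- A homomorphism of modules is compatible with the half-braidings at `X` if and only if its image
under `F` is compatible with the half-braidings at `F.obj X`. -/
theorem map_halfBraid_comm {V W : YD k A} (f : V.toLMod ⟶ W.toLMod) (X : LMod k A) :
    F.obj X ◁ F.map f ≫ (halfBraid (F.obj X) (liftObj F W)).hom =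
        (halfBraid (F.obj X) (liftObj F V)).hom ≫ F.map f ▷ F.obj X ↔
      X ◁ f ≫ (halfBraid X W).hom = (halfBraid X V).hom ≫ f ▷ X := by
  rw [halfBraid_liftObj, halfBraid_liftObj, μ_natural_right_assoc, Category.assoc, Category.assoc,
    δ_natural_left, ← F.map_comp_assoc, ← F.map_comp_assoc, cancel_epi, cancel_mono,
    F.map_injective.eq_iff]

/-- The functor between categories of Yetter-Drinfel'd modules which is induced by an equivalence
of monoidal categories of modules. -/
@[simps]
def lift : YD k A ⥤ YD k B where
  obj := liftObj F
  map f := homMkOfImage F (liftObj F _) (liftObj F _) (F.map f.hom) fun X =>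
    (map_halfBraid_comm F f.hom X).2 (halfBraid_natural_right f X)
  map_id _ := hom_ext (F.map_id _)
  map_comp _ _ := hom_ext (F.map_comp _ _)

/-- Conjugation by the structure maps of a monoidal functor is compatible with the expression of the
half-braiding of a tensor product by the half-braidings of the factors. -/
theorem map_tensor_right {X V W : LMod k A} (f : X ⊗ V ⟶ V ⊗ X) (g : X ⊗ W ⟶ W ⊗ X) :
    F.obj X ◁ μ F V W ≫ μ F X (V ⊗ W) ≫
        F.map ((α_ _ _ _).inv ≫ f ▷ W ≫ (α_ _ _ _).hom ≫ V ◁ g ≫ (α_ _ _ _).inv) ≫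
          δ F (V ⊗ W) X =
      ((α_ _ _ _).inv ≫ (μ F X V ≫ F.map f ≫ δ F V X) ▷ F.obj W ≫ (α_ _ _ _).hom ≫
        F.obj V ◁ (μ F X W ≫ F.map g ≫ δ F W X) ≫ (α_ _ _ _).inv) ≫ μ F V W ▷ F.obj X := by
  simp only [F.map_comp, Category.assoc, Monoidal.map_associator,
    Monoidal.map_associator_inv, Monoidal.map_whiskerLeft, Monoidal.map_whiskerRight,
    comp_whiskerRight, MonoidalCategory.whiskerLeft_comp, Monoidal.μ_δ_assoc,
    Monoidal.μ_δ, Monoidal.whiskerLeft_μ_δ_assoc, Category.comp_id]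

theorem μ_halfBraid_comm (V W : YD k A) (X : LMod k A) :
    F.obj X ◁ μ F V.toLMod W.toLMod ≫ (halfBraid (F.obj X) (liftObj F (V ⊗ W))).hom =
      (halfBraid (F.obj X) (liftObj F V ⊗ liftObj F W)).hom ≫
        μ F V.toLMod W.toLMod ▷ F.obj X := by
  rw [halfBraid_liftObj, halfBraid_tensor_right, halfBraid_tensor_right, halfBraid_liftObj,
    halfBraid_liftObj]
  exact map_tensor_right F _ _

theorem ε_halfBraid_comm (X : LMod k A) :
    F.obj X ◁ ε F ≫ (halfBraid (F.obj X) (liftObj F (𝟙_ (YD k A)))).hom =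
      (halfBraid (F.obj X) (𝟙_ (YD k B))).hom ≫ ε F ▷ F.obj X := by
  rw [halfBraid_liftObj, halfBraid_unit_right, halfBraid_unit_right]
  have h : F.obj X ◁ ε F ≫ μ F X (𝟙_ (LMod k A)) ≫ F.map ((ρ_ X).hom ≫ (λ_ X).inv) ≫
      δ F (𝟙_ (LMod k A)) X = ((ρ_ (F.obj X)).hom ≫ (λ_ (F.obj X)).inv) ≫ ε F ▷ F.obj X := by
    simp
  exact h

/-- The isomorphism of the tensor product of the images with the image of the tensor product. -/
def liftμIso (V W : YD k A) : liftObj F V ⊗ liftObj F W ≅ liftObj F (V ⊗ W) :=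
  isoMkOfImage F (liftObj F V ⊗ liftObj F W) (liftObj F (V ⊗ W))
    (Monoidal.μIso F V.toLMod W.toLMod) (μ_halfBraid_comm F V W)

/-- The isomorphism of the unit object with its image. -/
def liftεIso : 𝟙_ (YD k B) ≅ liftObj F (𝟙_ (YD k A)) :=
  isoMkOfImage F (𝟙_ (YD k B)) (liftObj F (𝟙_ (YD k A))) (Monoidal.εIso F)
    (ε_halfBraid_comm F)

instance : (lift F).Monoidal :=
  Functor.CoreMonoidal.toMonoidal
    { εIso := liftεIso F
      μIso := liftμIso F
      μIso_hom_natural_left := fun f V => hom_ext (μ_natural_left F f.hom V.toLMod)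
      μIso_hom_natural_right := fun V f => hom_ext (μ_natural_right F V.toLMod f.hom)
      associativity := fun U V W => hom_ext (associativity F U.toLMod V.toLMod W.toLMod)
      left_unitality := fun V => hom_ext (left_unitality F V.toLMod)
      right_unitality := fun V => hom_ext (right_unitality F V.toLMod) }

instance : (lift F).Faithful where
  map_injective h := hom_ext (F.map_injective congr(($h).hom))

instance : (lift F).Full where
  map_surjective {V W} := fun g => by
    let f : V.toLMod ⟶ W.toLMod := F.preimage g.hom
    have hf : F.map f = g.hom := F.map_preimage _
    refine ⟨homMk f ((map_halfBraid_comm F f _).1 ?_), hom_ext hf⟩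
    rw [hf]
    exact halfBraid_natural_right g _

theorem comap_halfBraid_comm {V : LMod k A} (N : YD k B) (e : F.obj V ≅ N.toLMod) (X : LMod k A) :
    F.obj X ◁ e.hom ≫ (halfBraid (F.obj X) N).hom =
      (halfBraid (F.obj X) (liftObj F (ofHalfBraiding (N.halfBraiding.comap F e)))).hom ≫
        e.hom ▷ F.obj X := by
  have h : (halfBraid (F.obj X) (liftObj F (ofHalfBraiding (N.halfBraiding.comap F e)))).hom =
      μ F X V ≫ F.map ((N.halfBraiding.comap F e).β X).inv ≫ δ F V X := by
    rw [halfBraid_liftObj, halfBraid_ofHalfBraiding, Iso.symm_hom]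
  rw [h, HalfBraiding.map_comap_β_inv]
  simp only [Category.assoc, Monoidal.μ_δ_assoc, ← comp_whiskerRight, Iso.inv_hom_id,
    MonoidalCategory.id_whiskerRight, Category.comp_id]
  rfl

instance : (lift F).EssSurj where
  mem_essImage N :=
    let e := F.objObjPreimageIso N.toLMod
    let V := ofHalfBraiding (N.halfBraiding.comap F e)
    ⟨V, ⟨isoMkOfImage F (liftObj F V) N e (comap_halfBraid_comm F N e)⟩⟩

instance : (lift F).IsEquivalence where

/-- The equivalence of categories of Yetter-Drinfel'd modules which is induced by an equivalence of
monoidal categories of modules, as a monoidal functor. -/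
def liftMon : MonFunctor (YD k A) (YD k B) := .of (lift F)

theorem liftMon_isBraided : (liftMon F).IsBraided := fun V W => hom_ext (by
  have h : μ F V.toLMod W.toLMod ≫ F.map (halfBraid V.toLMod W).hom =
      (halfBraid (F.obj V.toLMod) (liftObj F W)).hom ≫ μ F W.toLMod V.toLMod := by
    rw [halfBraid_liftObj]
    simp
  exact h)

theorem liftMon_comp_forget :
    (liftMon F).comp (.of (forget k B)) = (MonFunctor.of (forget k A)).comp (.of F) :=
  MonFunctor.mk_eq_mk
    (fun V W => (Category.id_comp (μ F V.toLMod W.toLMod)).trans (by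
      have h : μ F V.toLMod W.toLMod = μ F V.toLMod W.toLMod ≫ F.map (𝟙 _) := by simp
      exact h))
    ((Category.id_comp (ε F)).trans (by
      have h : ε F = ε F ≫ F.map (𝟙 _) := by simp
      exact h))

theorem liftMon_isLinearEquivalence (hF : (MonFunctor.of F).IsLinearEquivalence k) :
    (liftMon F).IsLinearEquivalence k where
  additive := ⟨fun {_ _ _ _} => hom_ext (hF.additive.map_add)⟩
  linear := ⟨fun _ _ => hom_ext (hF.linear.map_smul _ _)⟩
  isEquivalence := inferInstanceAs (lift F).IsEquivalence

theorem liftMon_isBraidedLift (hF : (MonFunctor.of F).IsLinearEquivalence k) :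
    MonFunctor.IsBraidedLift k (.of (forget k A)) (.of (forget k B)) (.of F) (liftMon F) where
  isLinearEquivalence := liftMon_isLinearEquivalence F hF
  isBraided := liftMon_isBraided F
  comp_eq := liftMon_comp_forget F

end HopfCat.YD

/-! ### Uniqueness of the lift, and compatibility with right adjoints -/

namespace HopfCat
open CategoryTheory.Functor CategoryTheory.Functor.LaxMonoidal
  CategoryTheory.Functor.OplaxMonoidal

theorem LMod.eqToHom_hom {k : Type u} [Field k] {A : Type u} [Ring A] [Algebra k A]
    {M N : LMod k A} (h : M = N) : (eqToHom h).hom = eqToHom (congrArg LMod.V h) := by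
  subst h
  rfl

theorem LMod.epi_of_surjective {k : Type u} [Field k] {A : Type u} [Ring A] [Algebra k A]
    {M N : LMod k A} (f : M ⟶ N) (hf : Function.Surjective f.hom) : Epi f :=
  have : Epi (LMod.toVect.map f) := (ModuleCat.epi_iff_surjective f.hom).2 hf
  LMod.toVect.epi_of_epi_map this

theorem YD.eqToHom_hom {k : Type u} [Field k] {A : Type u} [Ring A] [Bialgebra k A]
    {M N : YD k A} (h : M = N) : (eqToHom h).hom = eqToHom (congrArg YD.toLMod h) := by
  subst h
  rfl

variable {k : Type u} [Field k] {A B : Type u} [Ring A] [HopfAlgebra k A] [Ring B]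
  [HopfAlgebra k B]

instance epi_radfordCounit_whiskerRight [HasBijectiveAntipode k A] (L M : LMod k A) :
    Epi (radfordCounit L ▷ M) :=
  LMod.epi_of_surjective _ (LinearMap.rTensor_surjective M.V (radfordCounit_surjective L))

theorem epi_map_whiskerRight {C D : Type*} [Category* C] [MonoidalCategory C] [Category* D]
    [MonoidalCategory D] (F : C ⥤ D) [F.Monoidal] [F.IsEquivalence] {X Y Z : C} (f : X ⟶ Y)
    [Epi (f ▷ Z)] : Epi (F.map f ▷ F.obj Z) := by
  have h : F.map f ▷ F.obj Z = μ F X Z ≫ F.map (f ▷ Z) ≫ δ F Y Z := by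
    rw [← Functor.LaxMonoidal.μ_natural_left_assoc, Functor.Monoidal.μ_δ, Category.comp_id]
  rw [h]
  infer_instance

/-- Let `m ≫ f = b ≫ n` and `m' ≫ f' = b' ≫ n'`, for a monomorphism `n'`. If the first square
is mapped to the second one at three of its corners and along `m`, `n`, `f`, then along `b`. -/
theorem comm_of_comp_mono {C : Type*} [Category* C] {X X' Y Y' Z Z' T T' : C}
    {m : X ⟶ Y} {n : Z ⟶ T} {b : X ⟶ Z} {f : Y ⟶ T} (h : m ≫ f = b ≫ n)
    {m' : X' ⟶ Y'} {n' : Z' ⟶ T'} {b' : X' ⟶ Z'} {f' : Y' ⟶ T'} (h' : m' ≫ f' = b' ≫ n')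
    {x : X ⟶ X'} {y : Y ⟶ Y'} {z : Z ⟶ Z'} {t : T ⟶ T'} (hm : m ≫ y = x ≫ m')
    (hn : n ≫ t = z ≫ n') (hf : f ≫ t = y ≫ f') [Mono n'] : b ≫ z = x ≫ b' := by
  rw [← cancel_mono n', Category.assoc, ← hn, ← reassoc_of% h, hf, reassoc_of% hm, h',
    Category.assoc]

namespace YD

section

variable {P Q : MonFunctor (YD k A) (YD k B)}
  (h : P.comp (.of (forget k B)) = Q.comp (.of (forget k B)))

include h

theorem toLMod_eq (V : YD k A) : (P.functor.obj V).toLMod = (Q.functor.obj V).toLMod :=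
  MonFunctor.congr_obj h V

theorem map_eqToHom {V W : YD k A} (f : V ⟶ W) :
    (P.functor.map f).hom ≫ eqToHom (toLMod_eq h W) =
      eqToHom (toLMod_eq h V) ≫ (Q.functor.map f).hom :=
  MonFunctor.congr_map h f

theorem μ_eqToHom (V W : YD k A) :
    (μ P.functor V W).hom ≫ eqToHom (toLMod_eq h (V ⊗ W)) =
      (eqToHom (toLMod_eq h V) ⊗ₘ eqToHom (toLMod_eq h W)) ≫ (μ Q.functor V W).hom := by
  have h1 := MonFunctor.congr_μ h V W
  rw [MonFunctor.comp_μ, MonFunctor.comp_μ] at h1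
  have h2 : (𝟙 _ ≫ (μ P.functor V W).hom) ≫ eqToHom (toLMod_eq h (V ⊗ W)) =
      (eqToHom (toLMod_eq h V) ⊗ₘ eqToHom (toLMod_eq h W)) ≫ 𝟙 _ ≫ (μ Q.functor V W).hom := h1
  rw [Category.id_comp] at h2
  exact h2.trans (congrArg _ (Category.id_comp _))

theorem ε_eqToHom : (ε P.functor).hom ≫ eqToHom (toLMod_eq h (𝟙_ _)) = (ε Q.functor).hom := by
  have h1 := MonFunctor.congr_ε h
  rw [MonFunctor.comp_ε, MonFunctor.comp_ε] at h1
  have h2 : (𝟙 _ ≫ (ε P.functor).hom) ≫ eqToHom (toLMod_eq h (𝟙_ _)) =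
    𝟙 _ ≫ (ε Q.functor).hom := h1
  rw [Category.id_comp] at h2
  exact h2.trans (Category.id_comp _)

/-- If two braided functors agree after forgetting the coactions, then the identification of the
values at `W` is compatible with the half-braidings at all values of the functors. -/
theorem halfBraid_eqToHom (hP : P.IsBraided) (hQ : Q.IsBraided) (V W : YD k A) :
    (Q.functor.obj V).toLMod ◁ eqToHom (toLMod_eq h W) ≫
        (halfBraid (Q.functor.obj V).toLMod (Q.functor.obj W)).hom =
      (halfBraid (Q.functor.obj V).toLMod (P.functor.obj W)).hom ≫
        eqToHom (toLMod_eq h W) ▷ (Q.functor.obj V).toLMod := by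
  have hP' : (μ P.functor V W).hom ≫ (P.functor.map (β_ V W).hom).hom =
      (halfBraid (P.functor.obj V).toLMod (P.functor.obj W)).hom ≫ (μ P.functor W V).hom :=
    congr(($(hP V W)).hom)
  have hQ' : (μ Q.functor V W).hom ≫ (Q.functor.map (β_ V W).hom).hom =
      (halfBraid (Q.functor.obj V).toLMod (Q.functor.obj W)).hom ≫ (μ Q.functor W V).hom :=
    congr(($(hQ V W)).hom)
  let m : (Q.functor.obj W).toLMod ⊗ (Q.functor.obj V).toLMod ⟶ (Q.functor.obj (W ⊗ V)).toLMod :=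
    (μ Q.functor W V).hom
  have : Mono m := inferInstanceAs (Mono ((forget k B).map (μ Q.functor W V)))
  have h1 : (halfBraid (P.functor.obj V).toLMod (P.functor.obj W)).hom ≫
      (eqToHom (toLMod_eq h W) ⊗ₘ eqToHom (toLMod_eq h V)) =
        (eqToHom (toLMod_eq h V) ⊗ₘ eqToHom (toLMod_eq h W)) ≫
          (halfBraid (Q.functor.obj V).toLMod (Q.functor.obj W)).hom :=
    comm_of_comp_mono hP' (n' := m) hQ' (μ_eqToHom h V W) (μ_eqToHom h W V)
      (map_eqToHom h (β_ V W).hom)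
  rw [← cancel_epi (eqToHom (toLMod_eq h V) ▷ (P.functor.obj W).toLMod)]
  rw [MonoidalCategory.tensorHom_def', MonoidalCategory.tensorHom_def,
    ← reassoc_of% halfBraid_natural, Category.assoc] at h1
  exact h1.symm

end

variable (F : LMod k A ⥤ LMod k B) [F.Monoidal] [F.IsEquivalence] [HasBijectiveAntipode k A]

/-- A braided functor which lifts `F` is determined by its composition with the forgetful functor.
The braiding with the values of the functor determines the half-braidings at all modules, since
every module is a quotient of a module which underlies a Yetter-Drinfel'd module. -/
theorem eq_of_comp_forget_eq {P Q : MonFunctor (YD k A) (YD k B)} (hP : P.IsBraided)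
    (hQ : Q.IsBraided)
    (hPF : P.comp (.of (forget k B)) = (MonFunctor.of (forget k A)).comp (.of F))
    (hQF : Q.comp (.of (forget k B)) = (MonFunctor.of (forget k A)).comp (.of F)) : P = Q := by
  have h := hPF.trans hQF.symm
  have hobj : ∀ W, P.functor.obj W = Q.functor.obj W := by
    intro W
    refine ext_of_halfBraid (toLMod_eq h W) (halfBraid_comm_of_image (F := F) (fun L => ?_) _)
    -- The counit `V ⟶ L` is an epimorphism, so it suffices to consider the half-braidings at `F V`.
    let V := (radford k A).obj L
    have hV : (Q.functor.obj V).toLMod = F.obj V.toLMod := MonFunctor.congr_obj hQF V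
    have hW : (P.functor.obj W).toLMod = F.obj W.toLMod := MonFunctor.congr_obj hPF W
    let c : V.toLMod ⟶ L := radfordCounit L
    have : Epi (c ▷ W.toLMod) := epi_radfordCounit_whiskerRight L _
    have h1 : Epi (F.map c ▷ F.obj W.toLMod) := epi_map_whiskerRight F c
    have h2 : Epi (F.map c ▷ (P.functor.obj W).toLMod) := by rwa [hW]
    have h3 : Epi ((eqToHom hV ≫ F.map c) ▷ (P.functor.obj W).toLMod) := by
      rw [comp_whiskerRight]
      infer_instance
    exact halfBraid_comm_of_epi _ (eqToHom hV ≫ F.map c) (halfBraid_eqToHom h hP hQ V W)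
  refine MonFunctor.ext_of_eqToHom hobj (fun f => ?_) (fun V W => ?_) ?_
  · apply hom_ext
    rw [comp_hom, comp_hom, eqToHom_hom, eqToHom_hom]
    exact map_eqToHom h f
  · apply hom_ext
    have e : Hom.hom (eqToHom (hobj V) ⊗ₘ eqToHom (hobj W)) =
      eqToHom (toLMod_eq h V) ⊗ₘ eqToHom (toLMod_eq h W) := by
      rw [← eqToHom_hom (hobj V), ← eqToHom_hom (hobj W)]
      rfl
    rw [comp_hom, comp_hom, eqToHom_hom]
    exact (μ_eqToHom h V W).trans (congrArg (· ≫ _) e.symm)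
  · apply hom_ext
    rw [comp_hom, eqToHom_hom]
    exact ε_eqToHom h

end YD

section RightAdjoint

universe v₁ v₂ v₃ v₄ u₁ u₂ u₃ u₄

variable {C : Type u₁} [Category.{v₁} C] {D : Type u₂} [Category.{v₂} D] {C' : Type u₃}
  [Category.{v₃} C'] {D' : Type u₄} [Category.{v₄} D']

/-- Suppose that the equivalence `G` lifts the equivalence `F` along the functors `R` and `R'`. Then
`F` and `G` are compatible with the right adjoints of `R` and `R'`. -/
def rightAdjointCompIso {F : C ⥤ D} {G : C' ⥤ D'} [F.IsEquivalence] [G.IsEquivalence]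
    {R : C' ⥤ C} {R' : D' ⥤ D} {I : C ⥤ C'} {I' : D ⥤ D'} (adj : R ⊣ I) (adj' : R' ⊣ I')
    (h : G ⋙ R' = R ⋙ F) : F ⋙ I' ≅ I ⋙ G :=
  -- Both sides are right adjoint to the functor `G ⋙ R' = R ⋙ F`.
  let e : I' ⋙ G.asEquivalence.inverse ≅ F.asEquivalence.inverse ⋙ I :=
    ((G.asEquivalence.toAdjunction.comp adj').ofNatIsoLeft (eqToIso h)).rightAdjointUniq
      (adj.comp F.asEquivalence.toAdjunction)
  isoWhiskerLeft (F ⋙ I') G.asEquivalence.counitIso.symm ≪≫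
    isoWhiskerRight (isoWhiskerLeft F e) G ≪≫
      isoWhiskerRight F.asEquivalence.unitIso.symm (I ⋙ G)

end RightAdjoint

end HopfCat

/-! ### Modules over the double as Yetter-Drinfel'd modules -/

namespace HopfCat
open CategoryTheory.Functor CategoryTheory.Functor.LaxMonoidal
  CategoryTheory.Functor.OplaxMonoidal
open Coalgebra

/-- Two monoidal functors to a category of modules are equal if they agree on objects, and if the
resulting identifications of the underlying vector spaces are compatible with morphisms and with the
structure maps. -/
theorem MonFunctor.ext_of_eqToHom_hom {k : Type u} [Field k] {A : Type u} [Ring A] [Bialgebra k A]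
    {C : Type*} [Category* C] [MonoidalCategory C] {P Q : MonFunctor C (LMod k A)}
    (h : ∀ X, P.functor.obj X = Q.functor.obj X)
    (hmap : ∀ {X Y : C} (f : X ⟶ Y), (P.functor.map f).hom ≫ eqToHom (congrArg LMod.V (h Y)) =
      eqToHom (congrArg LMod.V (h X)) ≫ (Q.functor.map f).hom)
    (hμ : ∀ X Y, (μ P.functor X Y).hom ≫ eqToHom (congrArg LMod.V (h (X ⊗ Y))) =
      (eqToHom (congrArg LMod.V (h X)) ⊗ₘ eqToHom (congrArg LMod.V (h Y))) ≫
        (μ Q.functor X Y).hom)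
    (hε : (ε P.functor).hom ≫ eqToHom (congrArg LMod.V (h (𝟙_ C))) = (ε Q.functor).hom) : P = Q :=
  ext_of_eqToHom h
    (fun f => LMod.hom_ext (by
      rw [LMod.comp_hom, LMod.comp_hom, LMod.eqToHom_hom, LMod.eqToHom_hom]
      exact hmap f))
    (fun X Y => LMod.hom_ext (by
      rw [LMod.comp_hom, LMod.comp_hom, LMod.tensorHom_hom, LMod.eqToHom_hom, LMod.eqToHom_hom,
        LMod.eqToHom_hom]
      exact hμ X Y))
    (LMod.hom_ext (by
      rw [LMod.comp_hom, LMod.eqToHom_hom]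
      exact hε))

variable {k : Type u} [Field k] {A : Type u} [Ring A] [HopfAlgebra k A] [HasBijectiveAntipode k A]
  [FiniteDimensional k A]

theorem doubleCoact_unit (c : k) :
    doubleCoact (𝟙_ (LMod k (Double k A))) c = c ⊗ₜ[k] (1 : A) := by
  refine coslice_ext fun p => (coslice_doubleCoact (𝟙_ (LMod k (Double k A))) p c).trans ?_
  refine (trivAct_apply _ _).trans ?_
  refine (congrArg (· * c) (Double.counit_inclDual p)).trans ?_
  exact (coslice_tmul p c (1 : A)).symm

namespace YD

theorem doubleAct_incl (M : YD k A) (a : A) :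
    M.doubleAct (Double.incl k A a) = M.toLMod.act a := Double.lift_incl _ _ _ a

theorem doubleAct_inclDual (M : YD k A) (p : DualAlg k A) :
    M.doubleAct (Double.inclDual k A p) = dualOfCoact M.coact p := Double.lift_inclDual _ _ _ p

theorem doubleAct_comp_incl (M : YD k A) :
    M.doubleAct.comp (Double.incl k A) = M.toLMod.act := AlgHom.ext M.doubleAct_incl

theorem doubleCoact_toDouble (M : YD k A) : doubleCoact ((toDouble k A).obj M) = M.coact := by
  have h : (M.doubleAct.comp (Double.inclDual k A)).toLinearMap = dualOfCoact M.coact :=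
    LinearMap.ext M.doubleAct_inclDual
  exact (congrArg coactOfDual h).trans (coactOfDual_dualOfCoact M.coact)

theorem doubleAct_ofDouble (M : LMod k (Double k A)) : ((ofDouble k A).obj M).doubleAct = M.act :=
  Double.algHom_ext (fun a => doubleAct_incl ((ofDouble k A).obj M) a) fun p => by
    refine (doubleAct_inclDual ((ofDouble k A).obj M) p).trans ?_
    exact congr($(dualOfCoact_coactOfDual (M.act.comp (Double.inclDual k A)).toLinearMap) p)

theorem toDouble_ofDouble (M : LMod k (Double k A)) :
    (toDouble k A).obj ((ofDouble k A).obj M) = M :=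
  congrArg (LMod.mk M.V) (doubleAct_ofDouble M)

/-- The identity of `M`, as an isomorphism. -/
def ofDoubleToDoubleIso (M : YD k A) : (ofDouble k A).obj ((toDouble k A).obj M) ≅ M :=
  isoMk (LMod.isoMk (Iso.refl _) fun a m => congr($(M.doubleAct_incl a) m)) fun m =>
    (congr($(LinearMap.rTensor_id A M.toLMod.V) _)).trans congr($(M.doubleCoact_toDouble) m)

variable (k A) in
/-- The category of Yetter-Drinfel'd modules is equivalent to the category of modules over the
double. -/
def doubleEquivalence : YD k A ≌ LMod k (Double k A) :=
  CategoryTheory.Equivalence.mk (toDouble k A) (ofDouble k A)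
    (NatIso.ofComponents (fun M => (ofDoubleToDoubleIso M).symm) fun f => by
      apply hom_ext
      apply LMod.hom_ext
      exact (Category.comp_id f.hom.hom).trans (Category.id_comp f.hom.hom).symm)
    (NatIso.ofComponents (fun M => LMod.isoMk (Iso.refl _) fun x m =>
        congr($(doubleAct_ofDouble M) x m)) fun f => by
      apply LMod.hom_ext
      exact (Category.comp_id f.hom).trans (Category.id_comp f.hom).symm)

instance : (toDouble k A).IsEquivalence := (doubleEquivalence k A).isEquivalence_functor

instance : (ofDouble k A).IsEquivalence := (doubleEquivalence k A).isEquivalence_inverse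

/-- `YD.ofDouble` is monoidal, with the identity maps as its structure maps. -/
instance : (ofDouble k A).Monoidal :=
  Functor.CoreMonoidal.toMonoidal
    { εIso := isoMk (restrictUnitIso k A) fun (c : k) =>
        (congr($(LinearMap.rTensor_id A k) _)).trans (doubleCoact_unit c).symm
      μIso := fun M N => isoMk (restrictTensorIso M N) fun t =>
        (congr($(LinearMap.rTensor_id A (M.V ⊗[k] N.V)) _)).trans
          congr($((doubleCoact_tensor M N).symm) t)
      μIso_hom_natural_left := fun f P => hom_ext (restrict_natural_left f P)
      μIso_hom_natural_right := fun P f => hom_ext (restrict_natural_right P f)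
      associativity := fun M N P => hom_ext (restrict_assoc M N P)
      left_unitality := fun M => hom_ext (restrict_left_unit M)
      right_unitality := fun M => hom_ext (restrict_right_unit M) }

/-- The coproduct of the double is the one for which its diagonal action on a tensor product of
Yetter-Drinfel'd modules is the action given by the tensor product of the coactions. -/
theorem doubleAct_tensor (M N : YD k A) :
    (M ⊗ N).doubleAct = diagAct M.doubleAct N.doubleAct := by
  refine Double.algHom_ext (fun a => ?_) fun p => ?_
  · refine (doubleAct_incl (M ⊗ N) a).trans (LinearMap.ext fun t => ?_)
    refine Eq.trans ?_ (restrict_diagAct ((toDouble k A).obj M) ((toDouble k A).obj N) a t).symm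
    exact congr(diagAct $(M.doubleAct_comp_incl.symm) $(N.doubleAct_comp_incl.symm) a t)
  · refine (doubleAct_inclDual (M ⊗ N) p).trans (LinearMap.ext fun t => ?_)
    refine Eq.trans ?_
      (coslice_doubleCoact ((toDouble k A).obj M ⊗ (toDouble k A).obj N) p t)
    rw [doubleCoact_tensor, doubleCoact_toDouble, doubleCoact_toDouble]
    rfl

theorem doubleAct_unit : (𝟙_ (YD k A)).doubleAct = trivAct k (Double k A) := by
  refine Double.algHom_ext (fun a => ?_) fun p => ?_
  · refine (doubleAct_incl (𝟙_ (YD k A)) a).trans (LinearMap.ext fun (c : k) => ?_)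
    exact (restrictUnitIso k A).hom.comm a c
  · refine (doubleAct_inclDual (𝟙_ (YD k A)) p).trans (LinearMap.ext fun (c : k) => ?_)
    refine Eq.trans ?_ (coslice_doubleCoact (𝟙_ (LMod k (Double k A))) p c)
    exact congrArg (coslice k p) (doubleCoact_unit c).symm

/-- `YD.toDouble` is monoidal, with the identity maps as its structure maps. -/
instance : (toDouble k A).Monoidal :=
  Functor.CoreMonoidal.toMonoidal
    { εIso := LMod.isoMk (Iso.refl _) fun x (c : k) => congr($(doubleAct_unit.symm) x c)
      μIso := fun M N => LMod.isoMk (Iso.refl _) fun x t =>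
        congr($((doubleAct_tensor M N).symm) x t)
      μIso_hom_natural_left := fun f P => LMod.hom_ext
        ((Category.comp_id (f.hom.hom ▷ P.toLMod.V)).trans (Category.id_comp _).symm)
      μIso_hom_natural_right := fun P f => LMod.hom_ext
        ((Category.comp_id (P.toLMod.V ◁ f.hom.hom)).trans (Category.id_comp _).symm)
      associativity := fun M N P => LMod.hom_ext
        congr($(LaxMonoidal.associativity (forget k A) M N P).hom)
      left_unitality := fun M => LMod.hom_ext
        congr($(LaxMonoidal.left_unitality (forget k A) M).hom)
      right_unitality := fun M => LMod.hom_ext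
        congr($(LaxMonoidal.right_unitality (forget k A) M).hom) }

variable (k A) in
/-- `YD.ofDouble` as a monoidal functor. -/
def ofDoubleMon : MonFunctor (LMod k (Double k A)) (YD k A) := .of (ofDouble k A)

variable (k A) in
/-- `YD.toDouble` as a monoidal functor. -/
def toDoubleMon : MonFunctor (YD k A) (LMod k (Double k A)) := .of (toDouble k A)

theorem ofDoubleMon_isBraided : (ofDoubleMon k A).IsBraided := fun M N =>
  hom_ext (LMod.hom_ext ((Category.id_comp (doubleBraiding M N).hom.hom).trans
    (Category.comp_id (doubleBraiding M N).hom.hom).symm))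

theorem toDoubleMon_isBraided : (toDoubleMon k A).IsBraided := fun M N => by
  apply LMod.hom_ext
  have h : (β_ M N).hom.hom.hom =
      (doubleBraiding ((toDouble k A).obj M) ((toDouble k A).obj N)).hom.hom := by
    apply ModuleCat.hom_ext
    change coactBraid M.toLMod.act N.coact =
      coactBraid (M.doubleAct.comp (Double.incl k A)) (doubleCoact ((toDouble k A).obj N))
    exact (congr(coactBraid $(M.doubleAct_comp_incl) $(N.doubleCoact_toDouble))).symm
  exact (Category.id_comp _).trans (h.trans (Category.comp_id _).symm)

theorem ofDoubleMon_isLinearEquivalence : (ofDoubleMon k A).IsLinearEquivalence k where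
  additive := ⟨rfl⟩
  linear := ⟨fun _ _ => rfl⟩
  isEquivalence := inferInstanceAs (ofDouble k A).IsEquivalence

theorem toDoubleMon_isLinearEquivalence : (toDoubleMon k A).IsLinearEquivalence k where
  additive := ⟨rfl⟩
  linear := ⟨fun _ _ => rfl⟩
  isEquivalence := inferInstanceAs (toDouble k A).IsEquivalence

variable (k A) in
theorem ofDoubleMon_comp_forget :
    (ofDoubleMon k A).comp (.of (forget k A)) = .of (restrictDouble k A) :=
  MonFunctor.mk_eq_mk (fun M N => Category.id_comp (μ (restrictDouble k A) M N))
    (Category.id_comp (ε (restrictDouble k A)))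

variable (k A) in
/-- The monoidal functor `YD.ofDouble`, followed by `YD.toDouble`, is equal to the identity,
because an action of the double is determined by its restrictions to `A` and to `A*`. -/
theorem ofDoubleMon_comp_toDoubleMon :
    (ofDoubleMon k A).comp (toDoubleMon k A) = MonFunctor.id _ := by
  refine MonFunctor.ext_of_eqToHom_hom toDouble_ofDouble (fun {M N} f => ?_) (fun M N => ?_) ?_
  · exact (Category.comp_id f.hom).trans (Category.id_comp f.hom).symm
  · have h : (𝟙 (M.V ⊗ N.V) ≫ 𝟙 (M.V ⊗ N.V)) ≫ 𝟙 (M.V ⊗ N.V) =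
      (𝟙 M.V ⊗ₘ 𝟙 N.V) ≫ 𝟙 (M.V ⊗ N.V) := by simp
    exact h
  · have h : (𝟙 (𝟙_ (ModuleCat.{u} k)) ≫ 𝟙 (𝟙_ (ModuleCat.{u} k))) ≫ 𝟙 (𝟙_ (ModuleCat.{u} k)) =
      𝟙 (𝟙_ (ModuleCat.{u} k)) := by simp
    exact h

theorem restrict_toDouble (M : YD k A) :
    (restrictDouble k A).obj ((toDouble k A).obj M) = M.toLMod :=
  congrArg (LMod.mk M.toLMod.V) M.doubleAct_comp_incl

variable (k A) in
theorem toDoubleMon_comp_restrictDouble :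
    (toDoubleMon k A).comp (.of (restrictDouble k A)) = .of (forget k A) := by
  refine MonFunctor.ext_of_eqToHom_hom restrict_toDouble (fun {M N} f => ?_) (fun M N => ?_) ?_
  · exact (Category.comp_id f.hom.hom).trans (Category.id_comp f.hom.hom).symm
  · let V := M.toLMod.V
    let W := N.toLMod.V
    have h : (𝟙 (V ⊗ W) ≫ 𝟙 (V ⊗ W)) ≫ 𝟙 (V ⊗ W) = (𝟙 V ⊗ₘ 𝟙 W) ≫ 𝟙 (V ⊗ W) := by simp
    exact h
  · have h : (𝟙 (𝟙_ (ModuleCat.{u} k)) ≫ 𝟙 (𝟙_ (ModuleCat.{u} k))) ≫ 𝟙 (𝟙_ (ModuleCat.{u} k)) =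
      𝟙 (𝟙_ (ModuleCat.{u} k)) := by simp
    exact h

end YD
end HopfCat

/-! ### The Schrödinger module, and the lift to the doubles -/

namespace HopfCat
open CategoryTheory.Functor
open Coalgebra HopfAlgebra

namespace YD

/-- A Yetter-Drinfel'd structure which is transported along a bijective map is isomorphic to the
given one. -/
def transportIso {k : Type u} [Field k] {A : Type u} [Ring A] [Bialgebra k A] (M : YD k A)
    (N : LMod k A) (ρ : N.V →ₗ[k] N.V ⊗[k] A) (φ : M.toLMod.V →ₗ[k] N.V)
    (hφ : Function.Surjective φ) (h1 : ∀ a m, φ (M.toLMod.act a m) = N.act a (φ m))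
    (h2 : ∀ m, ρ (φ m) = φ.rTensor A (M.coact m)) (hφ' : Function.Injective φ) :
    M ≅ M.transport N ρ φ hφ h1 h2 :=
  isoMk (LMod.isoMk (LinearEquiv.ofBijective φ ⟨hφ', hφ⟩).toModuleIso h1) fun m => (h2 m).symm

variable {k : Type u} [Field k] {A B : Type u} [Ring A] [HopfAlgebra k A]
  [HasBijectiveAntipode k A] [Ring B] [HopfAlgebra k B] [HasBijectiveAntipode k B]

variable (k A) in
/-- The Schrödinger module, as a Yetter-Drinfel'd module, is induced from the unit object. The
isomorphism is `c ⊗ a ↦ c S(a)`. -/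
def radfordUnitIso : (radford k A).obj (𝟙_ (LMod k A)) ≅ schrodingerYD k A :=
  transportIso _ _ _ _ _ _ _ ((HasBijectiveAntipode.bijective (k := k) (A := A)).injective.comp
    (TensorProduct.lid k A).injective)

/-- The lift of an equivalence of monoidal categories of modules commutes with Radford's induction
functors. -/
def radfordCompLiftIso (F : LMod k A ⥤ LMod k B) [F.Monoidal] [F.IsEquivalence] :
    F ⋙ radford k B ≅ radford k A ⋙ (liftMon F).functor :=
  haveI : (liftMon F).functor.IsEquivalence := inferInstanceAs (lift F).IsEquivalence
  rightAdjointCompIso (radfordAdjunction k A) (radfordAdjunction k B) rfl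

/-- The lift of an equivalence of monoidal categories of modules preserves the Schrödinger
module. -/
def liftSchrodingerIso (F : LMod k A ⥤ LMod k B) [F.Monoidal] [F.IsEquivalence] :
    (liftMon F).functor.obj (schrodingerYD k A) ≅ schrodingerYD k B :=
  (liftMon F).functor.mapIso (radfordUnitIso k A).symm ≪≫
    (radfordCompLiftIso F).symm.app (𝟙_ (LMod k A)) ≪≫
      (radford k B).mapIso (Monoidal.εIso F).symm ≪≫ radfordUnitIso k B

end YD

section Double

open YD

variable {k : Type u} [Field k] {A B : Type u} [Ring A] [HopfAlgebra k A]
  [HasBijectiveAntipode k A] [FiniteDimensional k A] [Ring B] [HopfAlgebra k B]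
  [HasBijectiveAntipode k B] [FiniteDimensional k B]

variable (k A) in
theorem isSchrodingerObject_schrodinger :
    IsSchrodingerObject ((doubleToCenter k A).obj (schrodinger k A)) :=
  (isSchrodingerObject_radford k A).map fun r =>
    r.ofIsoObj ((toCenter k A).mapIso
      (ofDoubleToDoubleIso (schrodingerYD k A) ≪≫ (radfordUnitIso k A).symm))

/-- The equivalence of categories of modules over the doubles which is induced by an equivalence of
monoidal categories of modules. -/
def doubleLift (F : LMod k A ⥤ LMod k B) [F.Monoidal] [F.IsEquivalence] :
    MonFunctor (LMod k (Double k A)) (LMod k (Double k B)) :=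
  (ofDoubleMon k A).comp ((liftMon F).comp (toDoubleMon k B))

variable (F : LMod k A ⥤ LMod k B) [F.Monoidal] [F.IsEquivalence]

theorem doubleLift_isBraidedLift (hF : (MonFunctor.of F).IsLinearEquivalence k) :
    MonFunctor.IsBraidedLift k (.of (restrictDouble k A)) (.of (restrictDouble k B)) (.of F)
      (doubleLift F) where
  isLinearEquivalence := ofDoubleMon_isLinearEquivalence.comp
    ((liftMon_isLinearEquivalence F hF).comp toDoubleMon_isLinearEquivalence)
  isBraided := ofDoubleMon_isBraided.comp ((liftMon_isBraided F).comp toDoubleMon_isBraided)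
  comp_eq := by
    rw [doubleLift, MonFunctor.comp_assoc, MonFunctor.comp_assoc, toDoubleMon_comp_restrictDouble,
      liftMon_comp_forget, ← MonFunctor.comp_assoc, ofDoubleMon_comp_forget]

theorem eq_doubleLift {G : MonFunctor (LMod k (Double k A)) (LMod k (Double k B))}
    (hG : G.IsBraided) (h : G.comp (.of (restrictDouble k B)) =
      (MonFunctor.of (restrictDouble k A)).comp (.of F)) : G = doubleLift F := by
  have h1 : (toDoubleMon k A).comp (G.comp (ofDoubleMon k B)) = liftMon F :=
    eq_of_comp_forget_eq F (toDoubleMon_isBraided.comp (hG.comp ofDoubleMon_isBraided))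
      (liftMon_isBraided F)
      (by rw [MonFunctor.comp_assoc, MonFunctor.comp_assoc, ofDoubleMon_comp_forget, h,
        ← MonFunctor.comp_assoc, toDoubleMon_comp_restrictDouble])
      (liftMon_comp_forget F)
  rw [doubleLift, ← h1, MonFunctor.comp_assoc, MonFunctor.comp_assoc,
    ofDoubleMon_comp_toDoubleMon, MonFunctor.comp_id, ← MonFunctor.comp_assoc,
    ofDoubleMon_comp_toDoubleMon, MonFunctor.id_comp]

/-- The lift to the doubles commutes with the induction functors. -/
def inductionDoubleCompIso :
    F ⋙ inductionDouble k B ≅ inductionDouble k A ⋙ (doubleLift F).functor :=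
  isoWhiskerRight (radfordCompLiftIso F) (toDouble k B) ≪≫
    isoWhiskerRight (isoWhiskerLeft (radford k A) (doubleEquivalence k A).unitIso)
      (lift F ⋙ toDouble k B)

/-- The lift to the doubles preserves the Schrödinger module. -/
def doubleLiftSchrodingerIso :
    (doubleLift F).functor.obj (schrodinger k A) ≅ schrodinger k B :=
  (toDouble k B).mapIso
    ((lift F).mapIso (ofDoubleToDoubleIso (schrodingerYD k A)) ≪≫ liftSchrodingerIso F)

end Double
end HopfCat

end

/-- Invariance of Schrödinger objects and of the Schrödinger module under monoidal equivalences of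
module categories, for Yetter-Drinfel'd modules over Hopf algebras with bijective antipode and for
modules over the Drinfel'd double of finite-dimensional Hopf algebras. -/
theorem mainTheorem1 {k : Type u} [Field k] :
    ((∀ (A : Type u) [Ring A] [HopfAlgebra k A] [HopfCat.HasBijectiveAntipode k A],
        HopfCat.IsSchrodingerObject ((HopfCat.YD.toCenter k A).obj
          ((HopfCat.radford k A).obj (𝟙_ (HopfCat.LMod k A))))) ∧
      ∀ (A B : Type u) [Ring A] [HopfAlgebra k A] [HopfCat.HasBijectiveAntipode k A]
        [Ring B] [HopfAlgebra k B] [HopfCat.HasBijectiveAntipode k B]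
        (F : HopfCat.MonFunctor (HopfCat.LMod k A) (HopfCat.LMod k B)),
        F.IsLinearEquivalence k →
        ∃ G : HopfCat.MonFunctor (HopfCat.YD k A) (HopfCat.YD k B),
          HopfCat.MonFunctor.IsBraidedLift k (.of (HopfCat.YD.forget k A)) (.of (HopfCat.YD.forget k B)) F G ∧
          (∀ G', HopfCat.MonFunctor.IsBraidedLift k (.of (HopfCat.YD.forget k A))
            (.of (HopfCat.YD.forget k B)) F G' → G' = G) ∧
          Nonempty (F.functor ⋙ HopfCat.radford k B ≅ HopfCat.radford k A ⋙ G.functor)) ∧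
    ((∀ (A : Type u) [Ring A] [HopfAlgebra k A] [FiniteDimensional k A],
        HopfCat.IsSchrodingerObject ((HopfCat.doubleToCenter k A).obj
          (HopfCat.schrodinger k A))) ∧
      ∀ (A B : Type u) [Ring A] [HopfAlgebra k A] [FiniteDimensional k A]
        [Ring B] [HopfAlgebra k B] [FiniteDimensional k B]
        (F : HopfCat.MonFunctor (HopfCat.LMod k A) (HopfCat.LMod k B)),
        F.IsLinearEquivalence k →
        ∃ G : HopfCat.MonFunctor (HopfCat.LMod k (HopfCat.Double k A))
            (HopfCat.LMod k (HopfCat.Double k B)),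
          HopfCat.MonFunctor.IsBraidedLift k (.of (HopfCat.restrictDouble k A))
            (.of (HopfCat.restrictDouble k B)) F G ∧
          (∀ G', HopfCat.MonFunctor.IsBraidedLift k (.of (HopfCat.restrictDouble k A))
            (.of (HopfCat.restrictDouble k B)) F G' → G' = G) ∧
          Nonempty (F.functor ⋙ HopfCat.inductionDouble k B ≅
            HopfCat.inductionDouble k A ⋙ G.functor) ∧
          Nonempty (G.functor.obj (HopfCat.schrodinger k A) ≅ HopfCat.schrodinger k B)) := by
  refine ⟨⟨fun A _ _ _ => HopfCat.isSchrodingerObject_radford k A, ?_⟩,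
    ⟨fun A _ _ _ => HopfCat.isSchrodingerObject_schrodinger k A, ?_⟩⟩
  · intro A B _ _ _ _ _ _ ⟨F, _⟩ hF
    have := hF.isEquivalence
    exact ⟨HopfCat.YD.liftMon F, HopfCat.YD.liftMon_isBraidedLift F hF,
      fun G hG => HopfCat.YD.eq_of_comp_forget_eq F hG.isBraided (HopfCat.YD.liftMon_isBraided F)
        hG.comp_eq (HopfCat.YD.liftMon_comp_forget F), ⟨HopfCat.YD.radfordCompLiftIso F⟩⟩
  · intro A B _ _ _ _ _ _ ⟨F, _⟩ hF
    have := hF.isEquivalence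
    exact ⟨HopfCat.doubleLift F, HopfCat.doubleLift_isBraidedLift F hF,
      fun G hG => HopfCat.eq_doubleLift F hG.isBraided hG.comp_eq,
      ⟨HopfCat.inductionDoubleCompIso F⟩, ⟨HopfCat.doubleLiftSchrodingerIso F⟩⟩
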